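/- **Conventions.** A composition is a finite tuple $\alpha=(\alpha_1,\dots,\alpha_n)$ of non-negative integers, of length $\ell(\alpha)=n$ (the empty one $\emptyset$ is allowed); it is reduced if it is empty or $\alpha_n\neq 0$. A partition is a weakly decreasing tuple of positive integers (possibly empty). $*$ is concatenation and $\mathrm{rev}$ reverses a tuple. **Almost symmetric Schur functions.** Let $s_i$ swap $x_i,x_{i+1}$ (and the entries $\alpha_i,\alpha_{i+1}$), and let $\xi_i(f)=\frac{x_if-x_{i+1}s_i(f)}{x_i-x_{i+1}}$. The key polynomials $\mathcal K_\alpha\in\mathbb Q[x_1,\dots,x_n]$, $\alpha\in\mathbb Z_{\ge0}^n$, are determined by $\mathcal K_\alpha=x^\alpha$ if $\alpha_1\ge\dots\ge\alpha_n$, and $\mathcal K_{s_i(\alpha)}=\xi_i(\mathcal K_\alpha)$ if $\alpha_i>\alpha_{i+1}$. For $f\in\mathbb Q[x_1,\dots,x_n]$ let $$W^{(n)}_k(f)=\sum_{\sigma}\sigma\Big(f\prod_{k+1\le i<j\le n}\frac1{1-x_j/x_i}\Big),$$ where $\sigma$ runs over the permutations of $\{1,\dots,n\}$ fixing $1,\dots,k$.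 For an almost symmetric function $f$ (a series in $x_1,x_2,\dots$ with rational coefficients, of bounded degree, symmetric in $x_m,x_{m+1},\dots$ for some $m$) let $W_k(f)=\lim_n W_k^{(n)}(f(x_1,\dots,x_n,0,0,\dots))$, a coefficientwise limit. For a reduced composition $\mu$ and a partition $\lambda$ define $s_{(\mu|\lambda)}$ by $s_{(\mu|\emptyset)}=\mathcal K_\mu$ and, if $\mu_r\ge\lambda_1$ (no condition if $\lambda=\emptyset$), $$s_{(\mu_1,\dots,\mu_{r-1}\,|\,\mu_r,\lambda_1,\dots,\lambda_\ell)}=W_{r-1}\big(s_{(\mu_1,\dots,\mu_r\,|\,\lambda_1,\dots,\lambda_\ell)}\big).$$ **Diagrams and statistics.** For a composition $\alpha$ of length $n$ put $dg'(\alpha)=\{(i,j):1\le i\le n,\ 1\le j\le\alpha_i\}$ and $\widehat{dg}(\alpha)=dg'(\alpha)\cup\{(i,0):1\le i\le n\}$ ($i$ is the column, $j$ the row, rows are numbered upwards), and $d(i,j)=(i,j-1)$. For $u=(i,j)\in dg'(\alpha)$ let $$a(u)=|\{(i',j)\in dg'(\alpha):i'<i,\ \alpha_{i'}\le\alpha_i\}|+|\{(i',j-1)\in\widehat{dg}(\alpha):i'>i,\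 \alpha_{i'}<\alpha_i\}|.$$ Two distinct boxes attack each other if they are in the same row, or in consecutive rows with the lower box strictly to the right of the upper one. The reading order goes row by row from top to bottom, and from right to left in each row. Let $\tau$ be a labelling of $\widehat{dg}(\alpha)$ by elements of a totally ordered set. It is non-attacking if attacking boxes have different labels. A descent is a box $u\in dg'(\alpha)$ with $\tau(u)>\tau(d(u))$; $\mathrm{Des}(\tau)$ is the set of descents. $\mathrm{Inv}(\tau)$ is the set of pairs of attacking boxes $u,v$ with $u$ before $v$ in reading order and $\tau(u)>\tau(v)$. Set $$\mathrm{inv}(\tau)=|\mathrm{Inv}(\tau)|-|\{i<j:\alpha_i\le\alpha_j\}|-\sum_{u\in\mathrm{Des}(\tau)}a(u),\qquad \mathrm{coinv}(\tau)=\sum_{u\in dg'(\alpha)}a(u)-\mathrm{inv}(\tau).$$ A co-inversion triple of $\tau$ is a triple $(u,v,w)$ with $u\in dg'(\alpha)$, $w=d(u)$, $v\in\widehat{dg}(\alpha)$, such that either $v$ lies in the row of $w$, to its right, in a strictly shorter column than $u$, or $v$ lies in the row of $u$, to its left, in a weakly shorter column than $u$; and such that $\tau(u)<\tau(v)<\tau(w)$,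 or $\tau(v)<\tau(w)<\tau(u)$, or $\tau(w)<\tau(u)<\tau(v)$. **The labellings.** For a labelling $\sigma:dg'(\mu*\mathrm{rev}(\lambda))\to\{1,2,\dots\}$ let $\sigma^\star$ be its extension to $\widehat{dg}(\mu*\mathrm{rev}(\lambda))$, with values in $\{1,2,\dots\}\cup\{\omega,\omega+1,\dots\}$, given by $\sigma^\star(j,0)=j$ for $1\le j\le\ell(\mu)$ and $\sigma^\star(j,0)=\omega+j-\ell(\mu)-1$ for $\ell(\mu)<j\le\ell(\mu)+\ell(\lambda)$. Let $\mathcal L(\mu|\lambda)$ be the set of all $\sigma$ such that $\sigma^\star$ is non-attacking, $\mathrm{coinv}(\sigma^\star)=0$ and $\mathrm{Des}(\sigma^\star)=\emptyset$. Put $x^\sigma=\prod_{u\in dg'(\mu*\mathrm{rev}(\lambda))}x_{\sigma(u)}$. **Theorem.** Let $\mu$ be a reduced composition and $\lambda$ a partition. A labelling $\sigma$ belongs to $\mathcal L(\mu|\lambda)$ if and only if $\sigma^\star$ is non-attacking, has no descents and has no co-inversion triples, and $$s_{(\mu|\lambda)}=\sum_{\sigma\in\mathcal L(\mu|\lambda)}x^\sigma$$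 as formal power series in $x_1,x_2,\dots$ (the sum converges coefficientwise). -/

import Mathlib

open Finset Filter Topology
open scoped MvPowerSeries.WithPiTopology

namespace AlmostSymSchur

/-! Conventions.  Positions, variables and labels are indexed from `0`: the variable `X i` is
`x_{i+1}`, the label `c` stands for `c + 1`, and the `i`-th column is the column `i + 1`. -/

/-- A composition (a finite list of natural numbers) is reduced if it is empty or if its last part
is nonzero. -/
def IsReduced (μ : List ℕ) : Prop := ∀ h : μ ≠ [], μ.getLast h ≠ 0

/-- A partition: weakly decreasing with positive parts. -/
def IsPartition (ν : List ℕ) : Prop := ν.Pairwise (fun a b => b ≤ a) ∧ ∀ a ∈ ν, 1 ≤ a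

/-! ### Isobaric divided differences and key polynomials -/

section Key

variable {n : ℕ}

/-- The action of the transposition of two variables on polynomials. -/
noncomputable def swapVars (i j : Fin n) (f : MvPolynomial (Fin n) ℚ) : MvPolynomial (Fin n) ℚ :=
  MvPolynomial.rename (Equiv.swap i j) f

theorem sub_dvd_sub_swapVars (i j : Fin n) (f : MvPolynomial (Fin n) ℚ) :
    (MvPolynomial.X i - MvPolynomial.X j : MvPolynomial (Fin n) ℚ) ∣ f - swapVars i j f := by
  induction f using MvPolynomial.induction_on with
  | C a => simp [swapVars]
  | add p q hp hq =>
    have h := dvd_add hp hq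
    simp only [swapVars, map_add] at h ⊢
    convert h using 1
    ring
  | mul_X p k hp =>
    have hX : (MvPolynomial.X i - MvPolynomial.X j : MvPolynomial (Fin n) ℚ) ∣
        MvPolynomial.X k - swapVars i j (MvPolynomial.X k) := by
      simp only [swapVars, MvPolynomial.rename_X]
      rcases eq_or_ne k i with rfl | hki
      · simp
      · rcases eq_or_ne k j with rfl | hkj
        · rw [Equiv.swap_apply_right]
          exact (dvd_neg.mpr dvd_rfl).trans (by simp)
        · simp [Equiv.swap_apply_of_ne_of_ne hki hkj]
    have h := dvd_add (hp.mul_right (MvPolynomial.X k))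
      (hX.mul_left (swapVars i j p))
    simp only [swapVars, map_mul] at h ⊢
    convert h using 1
    ring

theorem sub_dvd_isobaric_num (i j : Fin n) (f : MvPolynomial (Fin n) ℚ) :
    (MvPolynomial.X i - MvPolynomial.X j : MvPolynomial (Fin n) ℚ) ∣
      MvPolynomial.X i * f - MvPolynomial.X j * swapVars i j f := by
  have h := dvd_add ((sub_dvd_sub_swapVars i j f).mul_left (MvPolynomial.X i))
    (Dvd.intro (swapVars i j f) rfl : (MvPolynomial.X i - MvPolynomial.X j :
      MvPolynomial (Fin n) ℚ) ∣ _)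
  convert h using 1
  ring

/-- The isobaric divided difference
`(x_i f - x_j s(f)) / (x_i - x_j)`, where `s` swaps `x_i` and `x_j`; it is used for `j = i + 1`. -/
noncomputable def isobaric (i j : Fin n) (f : MvPolynomial (Fin n) ℚ) : MvPolynomial (Fin n) ℚ :=
  (sub_dvd_isobaric_num i j f).choose

theorem isobaric_spec (i j : Fin n) (f : MvPolynomial (Fin n) ℚ) :
    (MvPolynomial.X i - MvPolynomial.X j) * isobaric i j f =
      MvPolynomial.X i * f - MvPolynomial.X j * swapVars i j f :=
  (sub_dvd_isobaric_num i j f).choose_spec.symm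

theorem weight_swap_lt (α : Fin n → ℕ) (i j : Fin n) (hij : i < j) (h : α i < α j) :
    ∑ k : Fin n, (k : ℕ) * (α ∘ Equiv.swap i j) k < ∑ k : Fin n, (k : ℕ) * α k := by
  have e : ∀ β : Fin n → ℕ, ∑ k : Fin n, (k : ℕ) * β k =
      (i : ℕ) * β i + ((j : ℕ) * β j + ∑ k ∈ (univ.erase i).erase j, (k : ℕ) * β k) := by
    intro β
    rw [← Finset.add_sum_erase _ _ (Finset.mem_univ i),
      ← Finset.add_sum_erase _ _ (show j ∈ univ.erase i by simp [hij.ne'])]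
  rw [e, e α]
  have r : ∑ k ∈ (univ.erase i).erase j, (k : ℕ) * (α ∘ Equiv.swap i j) k =
      ∑ k ∈ (univ.erase i).erase j, (k : ℕ) * α k := by
    refine Finset.sum_congr rfl fun k hk => ?_
    simp only [Finset.mem_erase] at hk
    simp [Equiv.swap_apply_of_ne_of_ne hk.2.1 hk.1]
  rw [r]
  simp only [Function.comp_apply, Equiv.swap_apply_left, Equiv.swap_apply_right]
  have : (i : ℕ) < j := hij
  nlinarith

open Classical in
/-- The key polynomial `K_α(x_1, …, x_n)`: it is `x^α` if `α` is weakly decreasing, and otherwise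
`ξ_i (K_{s_i α})` for an ascent `α_i < α_{i+1}`.  The choice of the ascent does not matter, see
`keyPoly_swap`. -/
noncomputable def keyPoly (α : Fin n → ℕ) : MvPolynomial (Fin n) ℚ :=
  if h : ∃ p : Fin n × Fin n, (p.2 : ℕ) = p.1 + 1 ∧ α p.1 < α p.2 then
    isobaric h.choose.1 h.choose.2 (keyPoly (α ∘ Equiv.swap h.choose.1 h.choose.2))
  else ∏ i, MvPolynomial.X i ^ α i
termination_by ∑ k : Fin n, (k : ℕ) * α k
decreasing_by
  exact weight_swap_lt α _ _ (Fin.lt_def.mpr (by have := h.choose_spec.1; omega))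
    h.choose_spec.2

theorem X_sub_X_ne_zero {i j : Fin n} (h : i ≠ j) :
    (MvPolynomial.X i - MvPolynomial.X j : MvPolynomial (Fin n) ℚ) ≠ 0 :=
  sub_ne_zero.mpr fun e => h (MvPolynomial.X_injective e)

theorem swapVars_mul (i j : Fin n) (f g : MvPolynomial (Fin n) ℚ) :
    swapVars i j (f * g) = swapVars i j f * swapVars i j g := map_mul _ _ _

theorem swapVars_sub (i j : Fin n) (f g : MvPolynomial (Fin n) ℚ) :
    swapVars i j (f - g) = swapVars i j f - swapVars i j g := map_sub _ _ _

theorem swapVars_X (i j k : Fin n) :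
    swapVars i j (MvPolynomial.X k) = MvPolynomial.X (Equiv.swap i j k) := by
  simp [swapVars]

theorem swapVars_swapVars (i j : Fin n) (f : MvPolynomial (Fin n) ℚ) :
    swapVars i j (swapVars i j f) = f := by
  simp [swapVars, MvPolynomial.rename_rename, ← Equiv.coe_trans]

theorem isobaric_comm {i j k l : Fin n} (hij : i ≠ j) (hkl : k ≠ l) (hik : i ≠ k) (hil : i ≠ l)
    (hjk : j ≠ k) (hjl : j ≠ l) (f : MvPolynomial (Fin n) ℚ) :
    isobaric i j (isobaric k l f) = isobaric k l (isobaric i j f) := by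
  have hc : swapVars i j (swapVars k l f) = swapVars k l (swapVars i j f) := by
    have : Equiv.swap i j * Equiv.swap k l = Equiv.swap k l * Equiv.swap i j :=
      (Equiv.Perm.disjoint_swap_swap (by simp [*])).commute
    simp only [swapVars, MvPolynomial.rename_rename, ← Equiv.Perm.coe_mul, this]
  apply mul_left_cancel₀ (mul_ne_zero (X_sub_X_ne_zero hij) (X_sub_X_ne_zero hkl))
  have a1 := isobaric_spec i j (isobaric k l f)
  have a2 := isobaric_spec k l (isobaric i j f)
  have a3 := isobaric_spec i j f
  have a4 := isobaric_spec k l f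
  have a5 := congrArg (swapVars i j) a4
  have a6 := congrArg (swapVars k l) a3
  simp only [swapVars_mul, swapVars_sub, swapVars_X,
    Equiv.swap_apply_of_ne_of_ne hik.symm hjk.symm, Equiv.swap_apply_of_ne_of_ne hil.symm hjl.symm,
    Equiv.swap_apply_of_ne_of_ne hik hil, Equiv.swap_apply_of_ne_of_ne hjk hjl, hc] at a5 a6
  linear_combination (MvPolynomial.X k - MvPolynomial.X l) * a1 -
    (MvPolynomial.X i - MvPolynomial.X j) * a2 + MvPolynomial.X i * a4 - MvPolynomial.X j * a5 -
    MvPolynomial.X k * a3 + MvPolynomial.X l * a6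

theorem swapVars_isobaric {i j : Fin n} (hij : i ≠ j) (f : MvPolynomial (Fin n) ℚ) :
    swapVars i j (isobaric i j f) = isobaric i j f := by
  apply mul_left_cancel₀ (X_sub_X_ne_zero hij)
  have a1 := isobaric_spec i j f
  have a2 := congrArg (swapVars i j) a1
  simp only [swapVars_mul, swapVars_sub, swapVars_X, Equiv.swap_apply_left,
    Equiv.swap_apply_right, swapVars_swapVars] at a2
  linear_combination -a2 - a1

theorem isobaric_braid {i j k : Fin n} (hij : i ≠ j) (hjk : j ≠ k) (hik : i ≠ k)
    (f : MvPolynomial (Fin n) ℚ) :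
    isobaric i j (isobaric j k (isobaric i j f)) =
      isobaric j k (isobaric i j (isobaric j k f)) := by
  have hc : swapVars i j (swapVars j k (swapVars i j f)) =
      swapVars j k (swapVars i j (swapVars j k f)) := by
    have h1 := Equiv.swap_mul_swap_mul_swap hij hik
    have h2 := Equiv.swap_mul_swap_mul_swap hjk.symm hik.symm
    rw [Equiv.swap_comm j i, Equiv.swap_comm k j, Equiv.swap_comm i k, ← h1] at h2
    have h3 := congrArg (fun e : Equiv.Perm (Fin n) => MvPolynomial.rename (R := ℚ) e f) h2
    simpa only [swapVars, MvPolynomial.rename_rename, Equiv.Perm.coe_mul, Function.comp_assoc]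
      using h3
  apply mul_left_cancel₀ (mul_ne_zero (mul_ne_zero (X_sub_X_ne_zero hij) (X_sub_X_ne_zero hik))
    (X_sub_X_ne_zero hjk))
  have e1 := isobaric_spec j k (isobaric i j f)
  have e2 := isobaric_spec i j (isobaric j k (isobaric i j f))
  have e3 := congrArg (swapVars i j) e1
  have e4 := isobaric_spec i j f
  have e5 := congrArg (swapVars j k) e4
  have e6 := congrArg (swapVars i j) e5
  have f1 := isobaric_spec i j (isobaric j k f)
  have f2 := isobaric_spec j k (isobaric i j (isobaric j k f))
  have f3 := congrArg (swapVars j k) f1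
  have f4 := isobaric_spec j k f
  have f5 := congrArg (swapVars i j) f4
  have f6 := congrArg (swapVars j k) f5
  simp only [swapVars_mul, swapVars_sub, swapVars_X, Equiv.swap_apply_left,
    Equiv.swap_apply_right, Equiv.swap_apply_of_ne_of_ne hik.symm hjk.symm,
    Equiv.swap_apply_of_ne_of_ne hij hik, swapVars_isobaric hij, swapVars_isobaric hjk]
    at e3 e5 e6 f3 f5 f6
  rw [hc] at e6
  set a := (MvPolynomial.X i : MvPolynomial (Fin n) ℚ)
  set b := (MvPolynomial.X j : MvPolynomial (Fin n) ℚ)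
  set c := (MvPolynomial.X k : MvPolynomial (Fin n) ℚ)
  linear_combination (a - c) * (b - c) * e2 + a * (a - c) * e1 - b * (b - c) * e3 + a * b * e4 -
    a * c * e5 + b * c * e6 - (a - b) * (a - c) * f2 - b * (a - c) * f1 + c * (a - b) * f3 -
    a ^ 2 * f4 + b ^ 2 * f5 - c ^ 2 * f6

/-- If `α` is weakly decreasing then `K_α = x^α`. -/
theorem keyPoly_of_antitone (α : Fin n → ℕ) (h : Antitone α) :
    keyPoly α = ∏ i, MvPolynomial.X i ^ α i := by
  rw [keyPoly, dif_neg]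
  rintro ⟨p, hp, hlt⟩
  exact absurd (h (show p.1 ≤ p.2 from Fin.le_def.mpr (by omega))) (not_le.mpr hlt)

theorem keyPoly_ascent (m : ℕ) : ∀ (α : Fin n → ℕ), ∑ k : Fin n, (k : ℕ) * α k = m →
    ∀ i j : Fin n, (j : ℕ) = i + 1 → α i < α j →
      keyPoly α = isobaric i j (keyPoly (α ∘ Equiv.swap i j)) := by
  induction m using Nat.strong_induction_on with
  | _ m ih =>
  intro α hm i j hij hlt
  -- the induction hypothesis below `α`
  have IH : ∀ β : Fin n → ℕ, ∑ k : Fin n, (k : ℕ) * β k < m → ∀ i j : Fin n, (j : ℕ) = i + 1 →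
      β i < β j → keyPoly β = isobaric i j (keyPoly (β ∘ Equiv.swap i j)) :=
    fun β hβ => ih _ hβ β rfl
  have hdown : ∀ (β : Fin n → ℕ) (i j : Fin n), (j : ℕ) = i + 1 → β i < β j →
      ∑ k : Fin n, (k : ℕ) * β k ≤ m → ∑ k : Fin n, (k : ℕ) * (β ∘ Equiv.swap i j) k < m :=
    fun β i j h1 h2 h3 => (weight_swap_lt β i j (Fin.lt_def.mpr (by omega)) h2).trans_le h3
  have far : ∀ i j k l : Fin n, (j : ℕ) = i + 1 → (l : ℕ) = k + 1 → (j : ℕ) < k → α i < α j →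
      α k < α l → isobaric i j (keyPoly (α ∘ Equiv.swap i j)) =
        isobaric k l (keyPoly (α ∘ Equiv.swap k l)) := by
    intro i j k l hij hkl hjk h1 h2
    have nij : i ≠ j := Fin.ne_of_val_ne (by omega)
    have nkl : k ≠ l := Fin.ne_of_val_ne (by omega)
    have nik : i ≠ k := Fin.ne_of_val_ne (by omega)
    have nil : i ≠ l := Fin.ne_of_val_ne (by omega)
    have njk : j ≠ k := Fin.ne_of_val_ne (by omega)
    have njl : j ≠ l := Fin.ne_of_val_ne (by omega)
    rw [IH _ (hdown α i j hij h1 hm.le) k l hkl (by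
        simpa [Equiv.swap_apply_of_ne_of_ne nik.symm njk.symm,
          Equiv.swap_apply_of_ne_of_ne nil.symm njl.symm] using h2),
      IH _ (hdown α k l hkl h2 hm.le) i j hij (by
        simpa [Equiv.swap_apply_of_ne_of_ne nik nil,
          Equiv.swap_apply_of_ne_of_ne njk njl] using h1),
      isobaric_comm nij nkl nik nil njk njl]
    have : Equiv.swap i j * Equiv.swap k l = Equiv.swap k l * Equiv.swap i j :=
      (Equiv.Perm.disjoint_swap_swap (by simp [*])).commute
    rw [Function.comp_assoc, Function.comp_assoc, ← Equiv.Perm.coe_mul, ← Equiv.Perm.coe_mul, this]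
  have near : ∀ i j k : Fin n, (j : ℕ) = i + 1 → (k : ℕ) = j + 1 → α i < α j →
      α j < α k → isobaric i j (keyPoly (α ∘ Equiv.swap i j)) =
        isobaric j k (keyPoly (α ∘ Equiv.swap j k)) := by
    intro i j k hij hjk h1 h2
    have nij : i ≠ j := Fin.ne_of_val_ne (by omega)
    have njk : j ≠ k := Fin.ne_of_val_ne (by omega)
    have nik : i ≠ k := Fin.ne_of_val_ne (by omega)
    have si := Equiv.swap_apply_of_ne_of_ne nij nik
    have sk := Equiv.swap_apply_of_ne_of_ne nik.symm njk.symm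
    have A1 := hdown α i j hij h1 hm.le
    have B1 : (α ∘ Equiv.swap i j) j < (α ∘ Equiv.swap i j) k := by
      simpa [sk] using h1.trans h2
    have A2 := hdown _ j k hjk B1 A1.le
    have B2 : (((α ∘ Equiv.swap i j) ∘ Equiv.swap j k)) i <
        ((α ∘ Equiv.swap i j) ∘ Equiv.swap j k) j := by
      simpa [si, sk] using h2
    have A3 := hdown α j k hjk h2 hm.le
    have B3 : (α ∘ Equiv.swap j k) i < (α ∘ Equiv.swap j k) j := by
      simpa [si] using h1.trans h2
    have A4 := hdown _ i j hij B3 A3.le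
    have B4 : (((α ∘ Equiv.swap j k) ∘ Equiv.swap i j)) j <
        ((α ∘ Equiv.swap j k) ∘ Equiv.swap i j) k := by
      simpa [si, sk] using h1
    rw [IH _ A1 j k hjk B1, IH _ A2 i j hij B2, IH _ A3 i j hij B3, IH _ A4 j k hjk B4,
      isobaric_braid nij njk nik]
    have e1 := Equiv.swap_mul_swap_mul_swap nij nik
    have e2 := Equiv.swap_mul_swap_mul_swap njk.symm nik.symm
    rw [Equiv.swap_comm j i, Equiv.swap_comm k j, Equiv.swap_comm i k, ← e1] at e2
    have e3 := congrArg (fun e : Equiv.Perm (Fin n) => α ∘ e) e2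
    simp only [Equiv.Perm.coe_mul, ← Function.comp_assoc] at e3
    rw [e3]
  have hex : ∃ p : Fin n × Fin n, (p.2 : ℕ) = p.1 + 1 ∧ α p.1 < α p.2 := ⟨(i, j), hij, hlt⟩
  rw [keyPoly, dif_pos hex]
  obtain ⟨h1, h2⟩ := hex.choose_spec
  generalize hex.choose = p at h1 h2 ⊢
  obtain ⟨k, l⟩ := p
  simp only at h1 h2 ⊢
  rcases lt_trichotomy (i : ℕ) k with h | h | h
  · rcases (show (j : ℕ) ≤ k by omega).lt_or_eq with h' | h'
    · exact (far i j k l hij h1 h' hlt h2).symm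
    · obtain rfl : j = k := Fin.ext h'
      exact (near i j l hij h1 hlt h2).symm
  · obtain rfl : i = k := Fin.ext h
    obtain rfl : j = l := Fin.ext (by omega)
    rfl
  · rcases (show (l : ℕ) ≤ i by omega).lt_or_eq with h' | h'
    · exact far k l i j h1 hij h' h2 hlt
    · obtain rfl : l = i := Fin.ext h'
      exact near k l j h1 hij h2 hlt

/-- The recursion of the key polynomials: `K_{s_i α} = ξ_i (K_α)` whenever `α_i > α_{i+1}`. -/
theorem keyPoly_swap (α : Fin n → ℕ) (i j : Fin n) (hij : (j : ℕ) = i + 1) (h : α j < α i) :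
    keyPoly (α ∘ Equiv.swap i j) = isobaric i j (keyPoly α) := by
  have := keyPoly_ascent _ (α ∘ Equiv.swap i j) rfl i j hij (by simpa using h)
  rwa [Function.comp_assoc, ← Equiv.Perm.coe_mul, Equiv.swap_mul_self, Equiv.Perm.coe_one,
    Function.comp_id] at this

end Key

/-! ### Weyl symmetrization and almost symmetric Schur functions -/

open Classical in
/-- The partial Weyl symmetrizer on `ℚ[x_1, …, x_n]`,
`f ↦ ∑_σ σ (f * ∏_{k < i < j ≤ n} 1 / (1 - x_j / x_i))`, where `σ` runs over the permutations of
`{1, …, n}` that fix `1, …, k`.  The sum is formed in the field of fractions; it is always a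
polynomial. -/
noncomputable def weylSymFin (k n : ℕ) (f : MvPolynomial (Fin n) ℚ) : MvPolynomial (Fin n) ℚ :=
  let x : Fin n → FractionRing (MvPolynomial (Fin n) ℚ) := fun i =>
    algebraMap (MvPolynomial (Fin n) ℚ) _ (MvPolynomial.X i)
  let total : FractionRing (MvPolynomial (Fin n) ℚ) :=
    ∑ σ : Equiv.Perm (Fin n) with ∀ i : Fin n, (i : ℕ) < k → σ i = i,
      algebraMap (MvPolynomial (Fin n) ℚ) _ (MvPolynomial.rename σ f) *
        ∏ p : Fin n × Fin n with k ≤ (p.1 : ℕ) ∧ p.1 < p.2, 1 / (1 - x (σ p.2) / x (σ p.1))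
  if h : ∃ g : MvPolynomial (Fin n) ℚ, algebraMap (MvPolynomial (Fin n) ℚ) _ g = total then
    h.choose
  else 0

/-- A polynomial in `x_1, …, x_n` as a power series in `x_1, x_2, …`. -/
noncomputable def toSeries {n : ℕ} (f : MvPolynomial (Fin n) ℚ) : MvPowerSeries ℕ ℚ :=
  ((MvPolynomial.rename Fin.val f : MvPolynomial ℕ ℚ) : MvPowerSeries ℕ ℚ)

open Classical in
/-- The polynomial `f(x_1, …, x_n, 0, 0, …)`, for a series `f` of bounded degree (for which only
finitely many monomials in `x_1, …, x_n` occur). -/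
noncomputable def restrictVars (n : ℕ) (f : MvPowerSeries ℕ ℚ) : MvPolynomial (Fin n) ℚ :=
  if h : {d : Fin n →₀ ℕ | MvPowerSeries.coeff (d.mapDomain Fin.val) f ≠ 0}.Finite then
    ∑ d ∈ h.toFinset, MvPolynomial.monomial d (MvPowerSeries.coeff (d.mapDomain Fin.val) f)
  else 0

/-- The Weyl symmetrization operator `W_k = lim_n W_k^{(n)}` (limit of coefficients). -/
noncomputable def weylSym (k : ℕ) (f : MvPowerSeries ℕ ℚ) : MvPowerSeries ℕ ℚ :=
  limUnder atTop fun n => toSeries (weylSymFin k n (restrictVars n f))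

/-- The almost symmetric Schur function `s_{(μ|ν)}(x_1, x_2, …)`:
`s_{(μ|∅)} = K_μ` and `s_{(μ | a, ν)} = W_{ℓ(μ)} (s_{(μ, a | ν)})`. -/
noncomputable def almostSymSchur : List ℕ → List ℕ → MvPowerSeries ℕ ℚ
  | μ, [] => toSeries (keyPoly μ.get)
  | μ, a :: ν => weylSym μ.length (almostSymSchur (μ ++ [a]) ν)
termination_by _ ν => ν

/-! ### Diagrams and labellings -/

/-- The column diagram of a composition: the boxes `(i, j)` with `1 ≤ j ≤ α_i`. -/
def diagram (α : List ℕ) : Finset (ℕ × ℕ) :=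
  (range α.length).biUnion fun i => {i} ×ˢ Icc 1 (α.getD i 0)

/-- The augmented diagram: the bottom row of boxes `(i, 0)` is added. -/
def augDiagram (α : List ℕ) : Finset (ℕ × ℕ) :=
  (range α.length).biUnion fun i => {i} ×ˢ Icc 0 (α.getD i 0)

/-- The box just below `u`. -/
def below (u : ℕ × ℕ) : ℕ × ℕ := (u.1, u.2 - 1)

def armLeft (α : List ℕ) (u : ℕ × ℕ) : Finset (ℕ × ℕ) :=
  {v ∈ diagram α | v.2 = u.2 ∧ v.1 < u.1 ∧ α.getD v.1 0 ≤ α.getD u.1 0}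

def armRight (α : List ℕ) (u : ℕ × ℕ) : Finset (ℕ × ℕ) :=
  {v ∈ augDiagram α | v.2 + 1 = u.2 ∧ u.1 < v.1 ∧ α.getD v.1 0 < α.getD u.1 0}

/-- The arm length `a(u)`. -/
def armLength (α : List ℕ) (u : ℕ × ℕ) : ℕ := (armLeft α u ∪ armRight α u).card

/-- Two distinct boxes attack each other if they are in the same row, or in consecutive rows with
the lower box strictly to the right of the upper box. -/
def Attacks (u v : ℕ × ℕ) : Prop :=
  (u ≠ v ∧ u.2 = v.2) ∨ (u.2 = v.2 + 1 ∧ u.1 < v.1) ∨ (v.2 = u.2 + 1 ∧ v.1 < u.1)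

/-- The reading order: row by row from top to bottom, and from right to left in each row. -/
def ReadsBefore (u v : ℕ × ℕ) : Prop := v.2 < u.2 ∨ (u.2 = v.2 ∧ v.1 < u.1)

section Statistics

variable {A : Type*} [LinearOrder A] (α : List ℕ) (τ : ℕ × ℕ → A)

/-- The labelling `τ` of the augmented diagram is non-attacking. -/
def NonAttacking : Prop :=
  ∀ u ∈ augDiagram α, ∀ v ∈ augDiagram α, Attacks u v → τ u ≠ τ v

/-- The descents of a labelling `τ` of the augmented diagram. -/
def descents : Finset (ℕ × ℕ) := {u ∈ diagram α | τ (below u) < τ u}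

open Classical in
/-- The inversions of a labelling `τ` of the augmented diagram. -/
noncomputable def inversions : Finset ((ℕ × ℕ) × (ℕ × ℕ)) :=
  {p ∈ augDiagram α ×ˢ augDiagram α | Attacks p.1 p.2 ∧ ReadsBefore p.1 p.2 ∧ τ p.2 < τ p.1}

/-- The statistic `inv`. -/
noncomputable def inv : ℤ :=
  ((inversions α τ).card : ℤ) -
    ({p ∈ range α.length ×ˢ range α.length |
      p.1 < p.2 ∧ α.getD p.1 0 ≤ α.getD p.2 0}.card : ℤ) -
    ∑ u ∈ descents α τ, (armLength α u : ℤ)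

/-- The statistic `coinv`. -/
noncomputable def coinv : ℤ := ∑ u ∈ diagram α, (armLength α u : ℤ) - inv α τ

/-- `(u, v, w)` is a co-inversion triple of the labelling `τ`: the box `w` is just below `u`; either
(type 1) `v` is in the row of `w`, to its right, in a strictly shorter column, or (type 2) `v` is in
the row of `u`, to its left, in a weakly shorter column; and the labels of `u`, `v`, `w` strictly
increase up to a cyclic rotation. -/
def IsCoinvTriple (u v w : ℕ × ℕ) : Prop :=
  u ∈ diagram α ∧ v ∈ augDiagram α ∧ w = below u ∧
    ((v.2 = w.2 ∧ w.1 < v.1 ∧ α.getD v.1 0 < α.getD u.1 0) ∨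
      (v.2 = u.2 ∧ v.1 < u.1 ∧ α.getD v.1 0 ≤ α.getD u.1 0)) ∧
    ((τ u < τ v ∧ τ v < τ w) ∨ (τ v < τ w ∧ τ w < τ u) ∨ (τ w < τ u ∧ τ u < τ v))

end Statistics

/-- The augmented labelling `σ*` with values in `{1, 2, …} ∪ {ω, ω + 1, …}`: the bottom row is
labelled `1, …, ℓ(μ), ω, ω + 1, …`.  (Labels are shifted by one, so that `1, …, ℓ(μ)` appear as
`0, …, ℓ(μ) - 1`; only `σ*` on the augmented diagram matters.) -/
noncomputable def starLabelling (μ ν : List ℕ) (σ : diagram (μ ++ ν.reverse) → ℕ)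
    (u : ℕ × ℕ) : Ordinal.{0} :=
  if h : u ∈ diagram (μ ++ ν.reverse) then (σ ⟨u, h⟩ : Ordinal.{0})
  else if u.1 < μ.length then (u.1 : Ordinal.{0})
  else Ordinal.omega0 + ((u.1 - μ.length : ℕ) : Ordinal.{0})

/-- The set `𝓛(μ|ν)` of the labellings `σ` of the diagram of `μ * rev(ν)` such that `σ*` is
non-attacking, `coinv(σ*) = 0` and `σ*` has no descents. -/
def labellings (μ ν : List ℕ) : Set (diagram (μ ++ ν.reverse) → ℕ) :=
  {σ | NonAttacking (μ ++ ν.reverse) (starLabelling μ ν σ) ∧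
    coinv (μ ++ ν.reverse) (starLabelling μ ν σ) = 0 ∧
    descents (μ ++ ν.reverse) (starLabelling μ ν σ) = ∅}

/-- The monomial `x^σ`, the product of the variables `x_{σ(u)}` over all boxes `u`. -/
noncomputable def labelMonomial {D : Finset (ℕ × ℕ)} (σ : D → ℕ) : MvPowerSeries ℕ ℚ :=
  ∏ u, MvPowerSeries.X (σ u)

end AlmostSymSchur

/-! Two facts meet. In n variables the almost symmetric Schur function is a single key polynomial,
and every key polynomial is a generating function of non-attacking fillings without descents and
co-inversion triples.

For the first fact let γ be μ, then zeros, then the reversed partition, of total length n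
(`padShape`). The symmetrizer W_k absorbs every ξ_i acting on variables beyond the k-th
(`weylTotal_isobaric`). So when W with k = ℓ(μ) is applied to the key polynomial of μ, a, 0, …, 0,
rev ν, the part a may first be carried to the last position by operators ξ_i, at no cost. The
composition then increases weakly beyond position k, its key polynomial is symmetric in those
variables, and W_k fixes it by the Weyl denominator formula (`weylSymFin_keyPoly_padShape`). Setting
the last variable to zero deletes one of the padding zeros (`dropLast_keyPoly_padShape`), so
coefficients stabilise and the limits exist; this gives `coeff_almostSymSchur`.

For the second fact, fillings are built row by row. Let G(b) be the generating function of the rows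
above a row labelled b, let s exchange the labels a and a + 1, and let π be the isobaric operator at
the two variables. If the column labelled a is to the left of, and strictly higher than, the column
labelled a + 1, then G(sb) = πG(b) - G(b). If a is absent, or its column is to the left of and at
most as high as that of a + 1, then G(b) = πG(sb). The second relation is the recursion of key
polynomials; the first is needed to close the induction on the number of rows. The induction step
groups the next row c with sc and compares which of the four pairs from {b, sb} × {c, sc} are
admissible, a finite case analysis on the few columns involved (`IsGt.rowTerm_add`,
`BaseOK.rowTerm_add`, `rowGen_exchangeRel`). When the composition is weakly decreasing only the
filling with constant columns survives, and it gives the leading monomial (`rowGen_eq_keyPoly`).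

The two facts are joined in `hasSum_labellings`. Without descents, coinv counts exactly the
co-inversion triples (`coinv_eq_zero_iff`). All conditions depend only on the order of the labels,
so for a fixed monomial the labels ω, ω + 1, … can be replaced by the last labels of a large finite
range, which are the positions of the parts of the partition in γ. -/

namespace AlmostSymSchur

/-! ### Two consecutive rows of a filling -/

section Rows

variable {N : ℕ}

/-- The transposition of the labels `a` and `a + 1`. -/
def lblSwap (a x : ℕ) : ℕ := if x = a then a + 1 else if x = a + 1 then a else x

theorem lblSwap_lblSwap (a x : ℕ) : lblSwap a (lblSwap a x) = x := by
  unfold lblSwap; split_ifs <;> omega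

/-- The condition on two columns `i < j` of heights `h`, `h'`, with labels `b`, `b'` in a row and
labels `c`, `c'` in the next row up. -/
def PairOK (h h' b b' c c' : ℕ) : Prop :=
  (h' < h → 1 ≤ b' → ¬ (c ≤ b' ∧ b' < b)) ∧ (h ≤ h' → 1 ≤ c → ¬ (c' < c ∧ c ≤ b'))

/-- Here `h i` counts the boxes of column `i` from the row of `b` upwards, and the label 0 marks a
missing box. The field `le` excludes descents. The field `pair` excludes both types of co-inversion
triples together with attacks between the two rows: the strict inequalities come from triples, and
the equality allowed in `c ≤ b'` from the attacking pair. -/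
structure RowOK (h b c : Fin N → ℕ) : Prop where
  le : ∀ i, c i ≤ b i
  zero : ∀ i, c i = 0 ↔ h i ≤ 1
  inj : ∀ i j, c i = c j → c i = 0 ∨ i = j
  pair : ∀ i j, i < j → PairOK (h i) (h j) (b i) (b j) (c i) (c j)

/-- The part of the coding that concerns one row alone; the upper row of an admissible pair
satisfies it for the heights `h - 1`. -/
structure BaseOK (h b : Fin N → ℕ) : Prop where
  zero : ∀ i, b i = 0 ↔ h i = 0
  inj : ∀ i j, b i = b j → b i = 0 ∨ i = j

/-- An adjacent transposition of labels preserves every comparison except that between `a` and `a +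
1`. So after swapping in either row, or in both, only the inequalities comparing two labels from
this pair need to be checked again. -/
theorem RowOK.transfer {a : ℕ} (ha : 1 ≤ a) {h b c b' c' : Fin N → ℕ} (H : RowOK h b c)
    (hb : (∀ i, b' i = b i) ∨ ∀ i, b' i = lblSwap a (b i))
    (hc : (∀ i, c' i = c i) ∨ ∀ i, c' i = lblSwap a (c i))
    (h0 : ∀ i, (b i = a ∨ b i = a + 1) → (c i = a ∨ c i = a + 1) → c' i ≤ b' i)
    (h1 : ∀ i j, i < j → h j < h i → (b j = a ∨ b j = a + 1) →
      (c i = a ∨ c i = a + 1 ∨ b i = a ∨ b i = a + 1) → ¬ (c' i ≤ b' j ∧ b' j < b' i))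
    (h2 : ∀ i j, i < j → h i ≤ h j → (c i = a ∨ c i = a + 1) →
      (c j = a ∨ c j = a + 1 ∨ b j = a ∨ b j = a + 1) → ¬ (c' j < c' i ∧ c' i ≤ b' j)) :
    RowOK h b' c' := by
  have hb' : ∀ i, (b i = a ∧ b' i = a + 1) ∨ (b i = a + 1 ∧ b' i = a) ∨ b' i = b i := by
    intro i
    rcases hb with e | e <;> rw [e i]
    · omega
    · unfold lblSwap; split_ifs <;> omega
  have hc' : ∀ i, (c i = a ∧ c' i = a + 1) ∨ (c i = a + 1 ∧ c' i = a) ∨ c' i = c i := by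
    intro i
    rcases hc with e | e <;> rw [e i]
    · omega
    · unfold lblSwap; split_ifs <;> omega
  refine ⟨fun i => ?_, fun i => ?_, fun i j e => ?_, fun i j hij => ⟨fun hh hb1 => ?_, fun hh hc1 => ?_⟩⟩
  · have := H.le i; have := h0 i; have := hb' i; have := hc' i
    omega
  · have := H.zero i; have := hc' i
    omega
  · have hi := hc' i
    have : c i = c j := by
      rcases hc with e' | e'
      · rwa [e', e'] at e
      · have := congrArg (lblSwap a) e
        rwa [e', e', lblSwap_lblSwap, lblSwap_lblSwap] at this
    rcases H.inj i j this with h | h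
    · left; omega
    · exact Or.inr h
  · have := (H.pair i j hij).1 hh
    have := h1 i j hij hh
    have := hb' i; have := hb' j; have := hc' i
    omega
  · have := (H.pair i j hij).2 hh
    have := h2 i j hij hh
    have := hb' j; have := hc' i; have := hc' j
    omega

end Rows

/-! ### Exchanging two adjacent labels in two consecutive rows: the case table -/

section RowTable

variable {N : ℕ}

theorem RowOK.pair' {h b c : Fin N → ℕ} (H : RowOK h b c) (i j : Fin N) : j ≤ i ∨
    ((h j < h i → 1 ≤ b j → b j < c i ∨ b i ≤ b j) ∧
      (h i ≤ h j → 1 ≤ c i → c i ≤ c j ∨ b j < c i)) := by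
  rcases le_or_gt j i with h | h
  · exact Or.inl h
  · have := H.pair i j h
    unfold PairOK at this
    omega

/-- Both orders of the two columns, with the negations turned into disjunctions of inequalities.
Each entry of the table is decided by these facts for the few columns that carry `a` or `a + 1`. -/
theorem RowOK.pairs {h b c : Fin N → ℕ} (H : RowOK h b c) (i j : Fin N) :
    (j ≤ i ∨ ((h j < h i → 1 ≤ b j → b j < c i ∨ b i ≤ b j) ∧
      (h i ≤ h j → 1 ≤ c i → c i ≤ c j ∨ b j < c i))) ∧
    (i ≤ j ∨ ((h i < h j → 1 ≤ b i → b i < c j ∨ b j ≤ b i) ∧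
      (h j ≤ h i → 1 ≤ c j → c j ≤ c i ∨ b i < c j))) ∧ c i ≤ b i ∧ c j ≤ b j :=
  ⟨H.pair' i j, H.pair' j i, H.le i, H.le j⟩

variable {a : ℕ} {h b c : Fin N → ℕ} {p r k l : Fin N}

/-- In these names the first word compares the columns of `b` labelled `a` and `a + 1` (`gt`: the
left one is strictly higher, `le`: it is not), and the second word does so for `c`, where `single`
and `none` mean that one or both labels are absent. Then come the states of `b` and `c`: `pos` has
`a` on the left (or only `a + 1`), and `neg` is the swapped row. All `gt` entries with `b` in state
`neg` rest on one remark: the pair `p`, `r` forces `a < c p ≤ b p = a + 1`, so column `p` repeats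
the label `a + 1`. -/
theorem rowOK_gt_gt_neg_pos_false (ha : 1 ≤ a) (H : RowOK h b c) (hpr : p < r) (hh : h r < h p)
    (hbp : b p = a + 1) (hbr : b r = a) (ub : ∀ i, (b i = a + 1 → i = p) ∧ (b i = a → i = r))
    (hkl : k < l) (hh' : h l < h k) (hck : c k = a)
    (uc : ∀ i, (c i = a → i = k) ∧ (c i = a + 1 → i = l)) : False := by
  have f1 := H.pairs p r
  have f2 := H.pairs p k
  have f3 := H.pairs p l
  have f4 := H.pairs r k
  have f5 := H.pairs r l
  have f6 := H.pairs k l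
  clear H
  grind (splits := 40)

theorem rowOK_gt_gt_pos_neg_to_pos_pos (ha : 1 ≤ a) (H : RowOK h b c) (hpr : p < r)
    (hh : h r < h p) (hbp : b p = a) (hbr : b r = a + 1)
    (ub : ∀ i, (b i = a → i = p) ∧ (b i = a + 1 → i = r)) (hkl : k < l) (hh' : h l < h k)
    (hck : c k = a + 1) (hcl : c l = a) (uc : ∀ i, (c i = a + 1 → i = k) ∧ (c i = a → i = l)) :
    RowOK h b (fun i => lblSwap a (c i)) := by
  have f1 := H.pairs p r
  have f2 := H.pairs p k
  have f3 := H.pairs p l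
  have f4 := H.pairs r k
  have f5 := H.pairs r l
  have f6 := H.pairs k l
  refine H.transfer ha (Or.inl fun _ => rfl) (Or.inr fun _ => rfl) ?_ ?_ ?_ <;>
    clear H <;> intros <;> simp only [lblSwap] at * <;> grind (splits := 40)

theorem rowOK_gt_gt_pos_neg_ne (ha : 1 ≤ a) (H : RowOK h b c) (hpr : p < r) (hh : h r < h p)
    (hbp : b p = a) (hbr : b r = a + 1) (hck : c k = a + 1) : p ≠ k := by
  have f1 := H.pairs p r
  have f2 := H.pairs p k
  have f4 := H.pairs r k
  clear H
  grind (splits := 40)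

theorem rowOK_gt_gt_neg_neg_to_pos_pos (ha : 1 ≤ a) (H : RowOK h b c) (hpr : p < r)
    (hh : h r < h p) (hbp : b p = a + 1) (hbr : b r = a)
    (ub : ∀ i, (b i = a + 1 → i = p) ∧ (b i = a → i = r)) (hkl : k < l) (hcl : c l = a) (uc : ∀ i, (c i = a + 1 → i = k) ∧ (c i = a → i = l)) :
    RowOK h (fun i => lblSwap a (b i)) (fun i => lblSwap a (c i)) := by
  have f1 := H.pairs p r
  have f2 := H.pairs p k
  have f3 := H.pairs p l
  have f4 := H.pairs r k
  have f5 := H.pairs r l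
  have f6 := H.pairs k l
  refine H.transfer ha (Or.inr fun _ => rfl) (Or.inr fun _ => rfl) ?_ ?_ ?_ <;>
    clear H <;> intros <;> simp only [lblSwap] at * <;> grind (splits := 40)

/-- Column `p` must repeat `a + 1`, and `k` is the only column of `c` that can carry this label. The
same alternative `p = k` or `p ≠ k` decides which pairs of rows correspond to each other below. -/
theorem rowOK_gt_gt_neg_neg_eq (ha : 1 ≤ a) (H : RowOK h b c) (hpr : p < r) (hh : h r < h p)
    (hbp : b p = a + 1) (hbr : b r = a)
    (uc : ∀ i, (c i = a + 1 → i = k) ∧ (c i = a → i = l)) : p = k := by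
  have f1 := H.pairs p r
  have f2 := H.pairs p k
  have f3 := H.pairs p l
  have f4 := H.pairs r k
  have f5 := H.pairs r l
  have f6 := H.pairs k l
  clear H
  grind (splits := 40)

theorem rowOK_gt_gt_pos_pos_to_neg_neg (ha : 1 ≤ a) (H : RowOK h b c) (hpr : p < r)
    (hh : h r < h p) (hbp : b p = a) (hbr : b r = a + 1)
    (ub : ∀ i, (b i = a → i = p) ∧ (b i = a + 1 → i = r)) (hkl : k < l) (hh' : h l < h k)
    (hck : c k = a) (hcl : c l = a + 1) (uc : ∀ i, (c i = a → i = k) ∧ (c i = a + 1 → i = l))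
    (hpk : p = k) :
    RowOK h (fun i => lblSwap a (b i)) (fun i => lblSwap a (c i)) := by
  have f1 := H.pairs p r
  have f2 := H.pairs p k
  have f3 := H.pairs p l
  have f4 := H.pairs r k
  have f5 := H.pairs r l
  have f6 := H.pairs k l
  refine H.transfer ha (Or.inr fun _ => rfl) (Or.inr fun _ => rfl) ?_ ?_ ?_ <;>
    clear H <;> intros <;> simp only [lblSwap] at * <;> grind (splits := 40)

theorem rowOK_gt_gt_pos_pos_to_pos_neg (ha : 1 ≤ a) (H : RowOK h b c) (hpr : p < r) (hbp : b p = a) (hbr : b r = a + 1)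
    (ub : ∀ i, (b i = a → i = p) ∧ (b i = a + 1 → i = r)) (hkl : k < l) (hh' : h l < h k)
    (hck : c k = a) (hcl : c l = a + 1) (uc : ∀ i, (c i = a → i = k) ∧ (c i = a + 1 → i = l))
    (hpk : p ≠ k) :
    RowOK h b (fun i => lblSwap a (c i)) := by
  have f1 := H.pairs p r
  have f2 := H.pairs p k
  have f3 := H.pairs p l
  have f4 := H.pairs r k
  have f5 := H.pairs r l
  have f6 := H.pairs k l
  refine H.transfer ha (Or.inl fun _ => rfl) (Or.inr fun _ => rfl) ?_ ?_ ?_ <;>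
    clear H <;> intros <;> simp only [lblSwap] at * <;> grind (splits := 40)

theorem rowOK_gt_le_pos_neg_false (ha : 1 ≤ a) (H : RowOK h b c) (hpr : p < r)
    (hbp : b p = a) (hbr : b r = a + 1) (ub : ∀ i, (b i = a → i = p) ∧ (b i = a + 1 → i = r))
    (hkl : k < l) (hh' : h k ≤ h l) (hck : c k = a + 1) (hcl : c l = a)
    (uc : ∀ i, (c i = a + 1 → i = k) ∧ (c i = a → i = l)) : False := by
  have f1 := H.pairs p r
  have f2 := H.pairs p k
  have f3 := H.pairs p l
  have f4 := H.pairs r k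
  have f5 := H.pairs r l
  have f6 := H.pairs k l
  clear H
  grind (splits := 40)

theorem rowOK_gt_le_neg_pos_false (ha : 1 ≤ a) (H : RowOK h b c) (hpr : p < r) (hh : h r < h p)
    (hbp : b p = a + 1) (hbr : b r = a) (ub : ∀ i, (b i = a + 1 → i = p) ∧ (b i = a → i = r))
    (hkl : k < l) (hck : c k = a)
    (uc : ∀ i, (c i = a → i = k) ∧ (c i = a + 1 → i = l)) : False := by
  have f1 := H.pairs p r
  have f2 := H.pairs p k
  have f3 := H.pairs p l
  have f4 := H.pairs r k
  have f5 := H.pairs r l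
  have f6 := H.pairs k l
  clear H
  grind (splits := 40)

theorem rowOK_gt_le_neg_neg_false (ha : 1 ≤ a) (H : RowOK h b c) (hpr : p < r) (hh : h r < h p)
    (hbp : b p = a + 1) (hbr : b r = a) (ub : ∀ i, (b i = a + 1 → i = p) ∧ (b i = a → i = r))
    (hkl : k < l) (hh' : h k ≤ h l) (hck : c k = a + 1) (hcl : c l = a)
    (uc : ∀ i, (c i = a + 1 → i = k) ∧ (c i = a → i = l)) : False := by
  have f1 := H.pairs p r
  have f2 := H.pairs p k
  have f3 := H.pairs p l
  have f4 := H.pairs r k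
  have f5 := H.pairs r l
  have f6 := H.pairs k l
  clear H
  grind (splits := 40)

theorem rowOK_gt_single_neg_neg_false (ha : 1 ≤ a) (H : RowOK h b c) (hpr : p < r)
    (hh : h r < h p) (hbp : b p = a + 1) (hbr : b r = a) (hck : ∀ i, c i ≠ a + 1) : False := by
  have f1 := H.pairs p r
  clear H
  grind (splits := 40)

theorem rowOK_gt_single_pos_pos_ne (ha : 1 ≤ a) (H : RowOK h b c) (hpr : p < r) (hh : h r < h p)
    (hbp : b p = a) (hbr : b r = a + 1) (hcl : c l = a + 1) : p ≠ l := by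
  have f1 := H.pairs p r
  have f2 := H.pairs p l
  have f3 := H.pairs r l
  clear H
  grind (splits := 40)

theorem rowOK_gt_single_pos_pos_to_pos_neg (ha : 1 ≤ a) (H : RowOK h b c) (hpr : p < r)
    (hh : h r < h p) (hbp : b p = a) (hbr : b r = a + 1)
    (ub : ∀ i, (b i = a → i = p) ∧ (b i = a + 1 → i = r)) (hck : ∀ i, c i ≠ a) (hcl : c l = a + 1)
    (uc : ∀ i, (c i = a + 1 → i = l)) :
    RowOK h b (fun i => lblSwap a (c i)) := by
  have f1 := H.pairs p r
  have f2 := H.pairs p l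
  have f3 := H.pairs r l
  refine H.transfer ha (Or.inl fun _ => rfl) (Or.inr fun _ => rfl) ?_ ?_ ?_ <;>
    clear H <;> intros <;> simp only [lblSwap] at * <;> grind (splits := 40)

theorem rowOK_gt_single_pos_neg_to_neg_pos (ha : 1 ≤ a) (H : RowOK h b c) (hpr : p < r)
    (hh : h r < h p) (hbp : b p = a)
    (ub : ∀ i, (b i = a → i = p) ∧ (b i = a + 1 → i = r)) (hck : ∀ i, c i ≠ a + 1) (hcl : c l = a)
    (uc : ∀ i, (c i = a → i = l)) (hpl : p = l) :
    RowOK h (fun i => lblSwap a (b i)) (fun i => lblSwap a (c i)) := by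
  have f1 := H.pairs p r
  have f2 := H.pairs p l
  have f3 := H.pairs r l
  refine H.transfer ha (Or.inr fun _ => rfl) (Or.inr fun _ => rfl) ?_ ?_ ?_ <;>
    clear H <;> intros <;> simp only [lblSwap] at * <;> grind (splits := 40)

theorem rowOK_gt_single_pos_neg_to_pos_pos (ha : 1 ≤ a) (H : RowOK h b c) (hpr : p < r) (hbr : b r = a + 1)
    (ub : ∀ i, (b i = a → i = p) ∧ (b i = a + 1 → i = r)) (hck : ∀ i, c i ≠ a + 1) (hcl : c l = a)
    (uc : ∀ i, (c i = a → i = l)) (hpl : p ≠ l) :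
    RowOK h b (fun i => lblSwap a (c i)) := by
  have f1 := H.pairs p r
  have f2 := H.pairs p l
  have f3 := H.pairs r l
  refine H.transfer ha (Or.inl fun _ => rfl) (Or.inr fun _ => rfl) ?_ ?_ ?_ <;>
    clear H <;> intros <;> simp only [lblSwap] at * <;> grind (splits := 40)

theorem rowOK_gt_single_neg_pos_eq (ha : 1 ≤ a) (H : RowOK h b c) (hpr : p < r) (hh : h r < h p)
    (hbp : b p = a + 1) (hbr : b r = a) (uc : ∀ i, (c i = a + 1 → i = l)) : p = l := by
  have f1 := H.pairs p r
  have f2 := H.pairs p l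
  have f3 := H.pairs r l
  clear H
  grind (splits := 40)

theorem rowOK_gt_single_neg_pos_to_pos_neg (ha : 1 ≤ a) (H : RowOK h b c) (hpr : p < r)
    (hh : h r < h p) (hbp : b p = a + 1) (hbr : b r = a)
    (ub : ∀ i, (b i = a + 1 → i = p) ∧ (b i = a → i = r)) (hck : ∀ i, c i ≠ a) (hcl : c l = a + 1)
    (uc : ∀ i, (c i = a + 1 → i = l)) :
    RowOK h (fun i => lblSwap a (b i)) (fun i => lblSwap a (c i)) := by
  have f1 := H.pairs p r
  have f2 := H.pairs p l
  have f3 := H.pairs r l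
  refine H.transfer ha (Or.inr fun _ => rfl) (Or.inr fun _ => rfl) ?_ ?_ ?_ <;>
    clear H <;> intros <;> simp only [lblSwap] at * <;> grind (splits := 40)

theorem rowOK_gt_none_neg_pos_false (ha : 1 ≤ a) (H : RowOK h b c) (hpr : p < r) (hh : h r < h p)
    (hbp : b p = a + 1) (hbr : b r = a)
    (hck : ∀ i, c i ≠ a ∧ c i ≠ a + 1) : False := by
  have f1 := H.pairs p r
  clear H
  grind (splits := 40)

/-- The implication form of `hbp` lets one statement also cover the rows `b` in which the label at
`p`, or both labels, do not occur. -/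
theorem rowOK_le_gt_pos_pos_to_pos_neg (ha : 1 ≤ a) (H : RowOK h b c)
    (hbp : b p = a → p < r ∧ h p ≤ h r ∧ b r = a + 1)
    (ub : ∀ i, (b i = a → i = p) ∧ (b i = a + 1 → i = r)) (hkl : k < l) (hh' : h l < h k)
    (hck : c k = a) (hcl : c l = a + 1) (uc : ∀ i, (c i = a → i = k) ∧ (c i = a + 1 → i = l)) :
    RowOK h b (fun i => lblSwap a (c i)) := by
  have f1 := H.pairs p r
  have f2 := H.pairs p k
  have f3 := H.pairs p l
  have f4 := H.pairs r k
  have f5 := H.pairs r l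
  have f6 := H.pairs k l
  refine H.transfer ha (Or.inl fun _ => rfl) (Or.inr fun _ => rfl) ?_ ?_ ?_ <;>
    clear H <;> intros <;> simp only [lblSwap] at * <;> grind (splits := 40)

theorem rowOK_le_gt_pos_neg_to_neg_pos (ha : 1 ≤ a) (H : RowOK h b c)
    (hbp : b p = a → p < r ∧ h p ≤ h r ∧ b r = a + 1)
    (ub : ∀ i, (b i = a → i = p) ∧ (b i = a + 1 → i = r)) (hkl : k < l) (hh' : h l < h k)
    (hck : c k = a + 1) (hcl : c l = a) (uc : ∀ i, (c i = a + 1 → i = k) ∧ (c i = a → i = l)) :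
    RowOK h (fun i => lblSwap a (b i)) (fun i => lblSwap a (c i)) := by
  have f1 := H.pairs p r
  have f2 := H.pairs p k
  have f3 := H.pairs p l
  have f4 := H.pairs r k
  have f5 := H.pairs r l
  have f6 := H.pairs k l
  refine H.transfer ha (Or.inr fun _ => rfl) (Or.inr fun _ => rfl) ?_ ?_ ?_ <;>
    clear H <;> intros <;> simp only [lblSwap] at * <;> grind (splits := 40)

theorem rowOK_le_gt_neg_pos_to_pos_pos (ha : 1 ≤ a) (H : RowOK h b c)
    (hbp : b p = a + 1 → p < r ∧ h p ≤ h r ∧ b r = a)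
    (ub : ∀ i, (b i = a + 1 → i = p) ∧ (b i = a → i = r)) (hkl : k < l) (hh' : h l < h k)
    (hck : c k = a) (hcl : c l = a + 1) (uc : ∀ i, (c i = a → i = k) ∧ (c i = a + 1 → i = l)) :
    RowOK h (fun i => lblSwap a (b i)) c := by
  have f1 := H.pairs p r
  have f2 := H.pairs p k
  have f3 := H.pairs p l
  have f4 := H.pairs r k
  have f5 := H.pairs r l
  have f6 := H.pairs k l
  refine H.transfer ha (Or.inr fun _ => rfl) (Or.inl fun _ => rfl) ?_ ?_ ?_ <;>
    clear H <;> intros <;> simp only [lblSwap] at * <;> grind (splits := 40)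

theorem rowOK_le_le_pos_neg_false (ha : 1 ≤ a) (H : RowOK h b c)
    (hbp : b p = a → p < r ∧ h p ≤ h r ∧ b r = a + 1)
    (ub : ∀ i, (b i = a → i = p) ∧ (b i = a + 1 → i = r)) (hkl : k < l) (hh' : h k ≤ h l)
    (hck : c k = a + 1) (hcl : c l = a) (uc : ∀ i, (c i = a + 1 → i = k) ∧ (c i = a → i = l)) : False := by
  have f1 := H.pairs p r
  have f2 := H.pairs p k
  have f3 := H.pairs p l
  have f4 := H.pairs r k
  have f5 := H.pairs r l
  have f6 := H.pairs k l
  clear H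
  grind (splits := 40)

theorem rowOK_le_le_pos_pos_to_neg_neg (ha : 1 ≤ a) (H : RowOK h b c)
    (hbp : b p = a → p < r ∧ h p ≤ h r ∧ b r = a + 1)
    (ub : ∀ i, (b i = a → i = p) ∧ (b i = a + 1 → i = r)) (hkl : k < l) (hh' : h k ≤ h l)
    (hck : c k = a) (hcl : c l = a + 1) (uc : ∀ i, (c i = a → i = k) ∧ (c i = a + 1 → i = l))
    (hbl : b l = a + 1) :
    RowOK h (fun i => lblSwap a (b i)) (fun i => lblSwap a (c i)) := by
  have f1 := H.pairs p r
  have f2 := H.pairs p k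
  have f3 := H.pairs p l
  have f4 := H.pairs r k
  have f5 := H.pairs r l
  have f6 := H.pairs k l
  refine H.transfer ha (Or.inr fun _ => rfl) (Or.inr fun _ => rfl) ?_ ?_ ?_ <;>
    clear H <;> intros <;> simp only [lblSwap] at * <;> grind (splits := 40)

theorem rowOK_le_le_pos_pos_to_neg_pos (ha : 1 ≤ a) (H : RowOK h b c)
    (hbp : b p = a → p < r ∧ h p ≤ h r ∧ b r = a + 1)
    (ub : ∀ i, (b i = a → i = p) ∧ (b i = a + 1 → i = r)) (hkl : k < l) (hh' : h k ≤ h l)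
    (hck : c k = a) (hcl : c l = a + 1) (uc : ∀ i, (c i = a → i = k) ∧ (c i = a + 1 → i = l))
    (hbl : b l ≠ a + 1) :
    RowOK h (fun i => lblSwap a (b i)) c := by
  have f1 := H.pairs p r
  have f2 := H.pairs p k
  have f3 := H.pairs p l
  have f4 := H.pairs r k
  have f5 := H.pairs r l
  have f6 := H.pairs k l
  refine H.transfer ha (Or.inr fun _ => rfl) (Or.inl fun _ => rfl) ?_ ?_ ?_ <;>
    clear H <;> intros <;> simp only [lblSwap] at * <;> grind (splits := 40)

theorem rowOK_le_le_neg_neg_to_pos_pos (ha : 1 ≤ a) (H : RowOK h b c)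
    (hbp : b p = a + 1 → p < r ∧ h p ≤ h r ∧ b r = a)
    (ub : ∀ i, (b i = a + 1 → i = p) ∧ (b i = a → i = r)) (hkl : k < l) (hh' : h k ≤ h l)
    (hck : c k = a + 1) (hcl : c l = a) (uc : ∀ i, (c i = a + 1 → i = k) ∧ (c i = a → i = l)) :
    RowOK h (fun i => lblSwap a (b i)) (fun i => lblSwap a (c i)) := by
  have f1 := H.pairs p r
  have f2 := H.pairs p k
  have f3 := H.pairs p l
  have f4 := H.pairs r k
  have f5 := H.pairs r l
  have f6 := H.pairs k l
  refine H.transfer ha (Or.inr fun _ => rfl) (Or.inr fun _ => rfl) ?_ ?_ ?_ <;>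
    clear H <;> intros <;> simp only [lblSwap] at * <;> grind (splits := 40)

/-- The second half of `PairOK` at `k`, `l` gives `b l < a + 1`, while `a = c l ≤ b l`. -/
theorem rowOK_le_le_neg_neg_eq (ha : 1 ≤ a) (H : RowOK h b c) (hkl : k < l) (hh' : h k ≤ h l)
    (hck : c k = a + 1) (hcl : c l = a) : b l = a := by
  have f6 := H.pairs k l
  clear H
  grind (splits := 40)

theorem rowOK_le_le_neg_pos_to_pos_pos (ha : 1 ≤ a) (H : RowOK h b c)
    (hbp : b p = a + 1 → p < r ∧ h p ≤ h r ∧ b r = a)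
    (ub : ∀ i, (b i = a + 1 → i = p) ∧ (b i = a → i = r)) (hkl : k < l) (hh' : h k ≤ h l)
    (hck : c k = a) (hcl : c l = a + 1) (uc : ∀ i, (c i = a → i = k) ∧ (c i = a + 1 → i = l)) :
    RowOK h (fun i => lblSwap a (b i)) c := by
  have f1 := H.pairs p r
  have f2 := H.pairs p k
  have f3 := H.pairs p l
  have f4 := H.pairs r k
  have f5 := H.pairs r l
  have f6 := H.pairs k l
  refine H.transfer ha (Or.inr fun _ => rfl) (Or.inl fun _ => rfl) ?_ ?_ ?_ <;>
    clear H <;> intros <;> simp only [lblSwap] at * <;> grind (splits := 40)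

theorem rowOK_le_le_neg_pos_ne (H : RowOK h b c) (hcl : c l = a + 1) : b l ≠ a := by
  have := H.le l
  clear H
  grind (splits := 40)

theorem rowOK_le_single_pos_pos_to_pos_neg (ha : 1 ≤ a) (H : RowOK h b c)
    (hbp : b p = a → p < r ∧ h p ≤ h r ∧ b r = a + 1)
    (ub : ∀ i, (b i = a → i = p) ∧ (b i = a + 1 → i = r)) (hck : ∀ i, c i ≠ a) (hcl : c l = a + 1)
    (uc : ∀ i, (c i = a + 1 → i = l)) :
    RowOK h b (fun i => lblSwap a (c i)) := by
  have f1 := H.pairs p r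
  have f2 := H.pairs p l
  have f3 := H.pairs r l
  refine H.transfer ha (Or.inl fun _ => rfl) (Or.inr fun _ => rfl) ?_ ?_ ?_ <;>
    clear H <;> intros <;> simp only [lblSwap] at * <;> grind (splits := 40)

theorem rowOK_le_single_pos_neg_to_neg_neg (ha : 1 ≤ a) (H : RowOK h b c)
    (hbp : b p = a → p < r ∧ h p ≤ h r ∧ b r = a + 1)
    (ub : ∀ i, (b i = a → i = p) ∧ (b i = a + 1 → i = r)) (hck : ∀ i, c i ≠ a + 1) (hcl : c l = a)
    (uc : ∀ i, (c i = a → i = l)) :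
    RowOK h (fun i => lblSwap a (b i)) c := by
  have f1 := H.pairs p r
  have f2 := H.pairs p l
  have f3 := H.pairs r l
  refine H.transfer ha (Or.inr fun _ => rfl) (Or.inl fun _ => rfl) ?_ ?_ ?_ <;>
    clear H <;> intros <;> simp only [lblSwap] at * <;> grind (splits := 40)

theorem rowOK_le_single_neg_neg_to_pos_pos (ha : 1 ≤ a) (H : RowOK h b c)
    (hbp : b p = a + 1 → p < r ∧ h p ≤ h r ∧ b r = a)
    (ub : ∀ i, (b i = a + 1 → i = p) ∧ (b i = a → i = r)) (hck : ∀ i, c i ≠ a + 1) (hcl : c l = a)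
    (uc : ∀ i, (c i = a → i = l)) :
    RowOK h (fun i => lblSwap a (b i)) (fun i => lblSwap a (c i)) := by
  have f1 := H.pairs p r
  have f2 := H.pairs p l
  have f3 := H.pairs r l
  refine H.transfer ha (Or.inr fun _ => rfl) (Or.inr fun _ => rfl) ?_ ?_ ?_ <;>
    clear H <;> intros <;> simp only [lblSwap] at * <;> grind (splits := 40)

theorem rowOK_le_none_pos_pos_to_neg_pos (ha : 1 ≤ a) (H : RowOK h b c)
    (hbp : b p = a → p < r ∧ h p ≤ h r ∧ b r = a + 1)
    (ub : ∀ i, (b i = a → i = p) ∧ (b i = a + 1 → i = r)) (hck : ∀ i, c i ≠ a ∧ c i ≠ a + 1) :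
    RowOK h (fun i => lblSwap a (b i)) c := by
  have f1 := H.pairs p r
  refine H.transfer ha (Or.inr fun _ => rfl) (Or.inl fun _ => rfl) ?_ ?_ ?_ <;>
    clear H <;> intros <;> simp only [lblSwap] at * <;> grind (splits := 40)

theorem rowOK_le_none_neg_pos_to_pos_pos (ha : 1 ≤ a) (H : RowOK h b c)
    (hbp : b p = a + 1 → p < r ∧ h p ≤ h r ∧ b r = a)
    (ub : ∀ i, (b i = a + 1 → i = p) ∧ (b i = a → i = r)) (hck : ∀ i, c i ≠ a ∧ c i ≠ a + 1) :
    RowOK h (fun i => lblSwap a (b i)) c := by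
  have f1 := H.pairs p r
  refine H.transfer ha (Or.inr fun _ => rfl) (Or.inl fun _ => rfl) ?_ ?_ ?_ <;>
    clear H <;> intros <;> simp only [lblSwap] at * <;> grind (splits := 40)

end RowTable

/-! ### Exchange relations and the contribution of one row -/

section Exchange

variable {N : ℕ} {R : Type*} [CommRing R]

/-- The properties of an isobaric divided difference operator at the variables `x a`, `x (a + 1)`
that are used below. -/
structure IsIsobaric (x : ℕ → R) (a : ℕ) (π : R →+ R) : Prop where
  one : π 1 = 1
  idem : ∀ f, π (π f) = π f
  mul_of_ne : ∀ y, y ≠ a → y ≠ a + 1 → ∀ f, π (x y * f) = x y * π f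
  mul_both : ∀ f, π (x a * x (a + 1) * f) = x a * x (a + 1) * π f
  mul_left : ∀ f, π (x a * f) = x a * f + x (a + 1) * π f

def swapRow (a : ℕ) (b : Fin N → ℕ) : Fin N → ℕ := fun i => lblSwap a (b i)

theorem swapRow_swapRow (a : ℕ) (b : Fin N → ℕ) : swapRow a (swapRow a b) = b :=
  funext fun _ => lblSwap_lblSwap _ _

theorem lblSwap_left (a : ℕ) : lblSwap a a = a + 1 := by simp [lblSwap]

theorem lblSwap_right (a : ℕ) : lblSwap a (a + 1) = a := by simp [lblSwap]

theorem lblSwap_of_ne {a y : ℕ} (h : y ≠ a) (h' : y ≠ a + 1) : lblSwap a y = y := by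
  simp [lblSwap, h, h']

theorem lblSwap_eq_left {a y : ℕ} : lblSwap a y = a ↔ y = a + 1 := by
  unfold lblSwap; split_ifs <;> omega

theorem lblSwap_eq_right {a y : ℕ} : lblSwap a y = a + 1 ↔ y = a := by
  unfold lblSwap; split_ifs <;> omega

theorem lblSwap_eq_zero {a y : ℕ} (ha : 1 ≤ a) : lblSwap a y = 0 ↔ y = 0 := by
  unfold lblSwap; split_ifs with h1 h2
  · simp [h1]; omega
  · simp [h2]; omega
  · rfl

theorem lblSwap_injective (a : ℕ) : Function.Injective (lblSwap a) :=
  Function.LeftInverse.injective (lblSwap_lblSwap a)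

theorem BaseOK.swap {a : ℕ} (ha : 1 ≤ a) {h b : Fin N → ℕ} (H : BaseOK h b) :
    BaseOK h (swapRow a b) where
  zero i := by rw [AlmostSymSchur.swapRow, lblSwap_eq_zero ha, H.zero]
  inj i j e := by
    rw [AlmostSymSchur.swapRow, lblSwap_eq_zero ha]
    exact H.inj i j (lblSwap_injective a e)

theorem RowOK.baseOK {h b c : Fin N → ℕ} (H : RowOK h b c) : BaseOK (fun i => h i - 1) c where
  zero i := by rw [H.zero]; omega
  inj := H.inj

/-- The columns labelled `a` and `a + 1` are `p` and `r`, with `p < r` and `p` higher than `r`. -/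
structure IsGt (h b : Fin N → ℕ) (a : ℕ) (p r : Fin N) : Prop where
  lt : p < r
  height : h r < h p
  left : b p = a
  right : b r = a + 1
  uniq : ∀ i, (b i = a → i = p) ∧ (b i = a + 1 → i = r)

/-- If there is a column `p` labelled `a` then the column `r` labelled `a + 1` is to its right and
at least as high. -/
structure IsLe (h b : Fin N → ℕ) (a : ℕ) (p r : Fin N) : Prop where
  left : b p = a → p < r ∧ h p ≤ h r ∧ b r = a + 1
  uniq : ∀ i, (b i = a → i = p) ∧ (b i = a + 1 → i = r)

structure IsSingle (b : Fin N → ℕ) (a : ℕ) (l : Fin N) : Prop where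
  left : ∀ i, b i ≠ a
  right : b l = a + 1
  uniq : ∀ i, b i = a + 1 → i = l

def IsNone (b : Fin N → ℕ) (a : ℕ) : Prop := ∀ i, b i ≠ a ∧ b i ≠ a + 1

theorem BaseOK.uniq {a : ℕ} (ha : 1 ≤ a) {h b : Fin N → ℕ} (H : BaseOK h b) {p r : Fin N}
    (hp : b p = a) (hr : b r = a + 1) : ∀ i, (b i = a → i = p) ∧ (b i = a + 1 → i = r) := fun i =>
  ⟨fun e => (H.inj i p (by omega)).resolve_left (by omega),
    fun e => (H.inj i r (by omega)).resolve_left (by omega)⟩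

/-- Each orbit of the swap contains a row in normal form (`IsGt`, `IsLe`, `IsSingle` or `IsNone`),
so either `b` or its swap is one. -/
theorem BaseOK.cases {a : ℕ} (ha : 1 ≤ a) {h b : Fin N → ℕ} (H : BaseOK h b) :
    (∃ p r, IsGt h b a p r) ∨ (∃ p r, b p = a ∧ IsLe h b a p r) ∨ (∃ l, IsSingle b a l) ∨
      IsNone b a ∨ (∃ p r, IsGt h (swapRow a b) a p r) ∨
      (∃ p r, swapRow a b p = a ∧ IsLe h (swapRow a b) a p r) ∨
      (∃ l, IsSingle (swapRow a b) a l) := by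
  have key : ∀ b : Fin N → ℕ, BaseOK h b → ∀ p r, b p = a → b r = a + 1 → p < r →
      (∃ p r, IsGt h b a p r) ∨ (∃ p r, b p = a ∧ IsLe h b a p r) := by
    intro b H p r hp hr hpr
    rcases lt_or_ge (h r) (h p) with hh | hh
    · exact Or.inl ⟨p, r, hpr, hh, hp, hr, H.uniq ha hp hr⟩
    · exact Or.inr ⟨p, r, hp, fun _ => ⟨hpr, hh, hr⟩, H.uniq ha hp hr⟩
  by_cases h1 : ∃ p, b p = a
  · obtain ⟨p, hp⟩ := h1
    have hp' : swapRow a b p = a + 1 := by simp [swapRow, lblSwap_eq_right, hp]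
    by_cases h2 : ∃ r, b r = a + 1
    · obtain ⟨r, hr⟩ := h2
      have hr' : swapRow a b r = a := by simp [swapRow, lblSwap_eq_left, hr]
      rcases lt_trichotomy p r with h | rfl | h
      · rcases key b H p r hp hr h with h | h
        · exact Or.inl h
        · exact Or.inr (Or.inl h)
      · omega
      · rcases key _ (H.swap ha) r p hr' hp' h with h | h
        · exact Or.inr (Or.inr (Or.inr (Or.inr (Or.inl h))))
        · exact Or.inr (Or.inr (Or.inr (Or.inr (Or.inr (Or.inl h)))))
    · push Not at h2
      refine Or.inr (Or.inr (Or.inr (Or.inr (Or.inr (Or.inr ⟨p, fun i e => ?_, hp', fun i e => ?_⟩)))))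
      · exact h2 i (lblSwap_eq_left.mp e)
      · exact (H.inj i p ((lblSwap_eq_right.mp e).trans hp.symm)).resolve_left
          (by have := lblSwap_eq_right.mp e; omega)
  · push Not at h1
    by_cases h2 : ∃ r, b r = a + 1
    · obtain ⟨r, hr⟩ := h2
      exact Or.inr (Or.inr (Or.inl ⟨r, h1, hr, fun i e =>
        (H.inj i r (e.trans hr.symm)).resolve_left (by omega)⟩))
    · push Not at h2
      exact Or.inr (Or.inr (Or.inr (Or.inl fun i => ⟨h1 i, h2 i⟩)))

variable {x : ℕ → R} {a : ℕ} {π : R →+ R}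

theorem IsIsobaric.mul_prod (I : IsIsobaric x a π) (c : Fin N → ℕ) (s : Finset (Fin N))
    (hs : ∀ i ∈ s, c i ≠ a ∧ c i ≠ a + 1) (f : R) :
    π ((∏ i ∈ s, x (c i)) * f) = (∏ i ∈ s, x (c i)) * π f := by
  induction s using Finset.induction_on generalizing f with
  | empty => simp
  | insert i s hi ih =>
    rw [Finset.prod_insert hi, mul_assoc, I.mul_of_ne _ (hs i (by simp)).1 (hs i (by simp)).2,
      ih (fun j hj => hs j (by simp [hj])), mul_assoc]

theorem prod_swapRow (c : Fin N → ℕ) (s : Finset (Fin N))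
    (hs : ∀ i ∈ s, c i ≠ a ∧ c i ≠ a + 1) :
    ∏ i ∈ s, x (swapRow a c i) = ∏ i ∈ s, x (c i) :=
  Finset.prod_congr rfl fun i hi => by rw [swapRow, lblSwap_of_ne (hs i hi).1 (hs i hi).2]

/-- When both labels occur the monomial of the row is symmetric in the two variables, so
multiplication by it commutes with `π` and the exchange relations of `G` pass unchanged to the terms
of the sum. -/
theorem prod_both {c : Fin N → ℕ} {k l : Fin N} (hk : c k = a) (hl : c l = a + 1)
    (hu : ∀ i, (c i = a → i = k) ∧ (c i = a + 1 → i = l)) :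
    ∃ M : R, (∏ i, x (c i) = x a * x (a + 1) * M) ∧ (∏ i, x (swapRow a c i) = x a * x (a + 1) * M) ∧
      ∀ (_ : IsIsobaric x a π) (f : R), π (M * f) = M * π f := by
  have hkl : l ∈ univ.erase k := by
    simp only [mem_erase, mem_univ, and_true]
    rintro rfl
    omega
  have hs : ∀ i ∈ (univ.erase k).erase l, c i ≠ a ∧ c i ≠ a + 1 := by
    intro i hi
    simp only [mem_erase, mem_univ, and_true] at hi
    exact ⟨fun e => hi.2 ((hu i).1 e), fun e => hi.1 ((hu i).2 e)⟩
  refine ⟨∏ i ∈ (univ.erase k).erase l, x (c i), ?_, ?_, fun I f => I.mul_prod c _ hs f⟩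
  · rw [← Finset.mul_prod_erase univ _ (mem_univ k), ← Finset.mul_prod_erase _ _ hkl, hk, hl,
      mul_assoc]
  · rw [← Finset.mul_prod_erase univ _ (mem_univ k), ← Finset.mul_prod_erase _ _ hkl,
      prod_swapRow c _ hs]
    simp only [swapRow, hk, hl, lblSwap_left, lblSwap_right]
    ring

theorem prod_single {c : Fin N → ℕ} {l : Fin N} (H : IsSingle c a l) :
    ∃ M : R, (∏ i, x (c i) = x (a + 1) * M) ∧ (∏ i, x (swapRow a c i) = x a * M) ∧
      ∀ (_ : IsIsobaric x a π) (f : R), π (M * f) = M * π f := by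
  have hs : ∀ i ∈ univ.erase l, c i ≠ a ∧ c i ≠ a + 1 := by
    intro i hi
    simp only [mem_erase, mem_univ, and_true] at hi
    exact ⟨H.left i, fun e => hi (H.uniq i e)⟩
  refine ⟨∏ i ∈ univ.erase l, x (c i), ?_, ?_, fun I f => I.mul_prod c _ hs f⟩
  · rw [← Finset.mul_prod_erase univ _ (mem_univ l), H.right]
  · rw [← Finset.mul_prod_erase univ _ (mem_univ l), prod_swapRow c _ hs]
    simp only [swapRow, H.right, lblSwap_right]

open Classical in
/-- The contribution of a next row `c` to the generating function of the labellings above `b`. -/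
noncomputable def rowTerm (x : ℕ → R) (G : (Fin N → ℕ) → R) (h b c : Fin N → ℕ) : R :=
  if RowOK h b c then (∏ i, x (c i)) * G c else 0

/-- The exchange relations at the labels `a`, `a + 1` for a function of the labels of a row. -/
structure ExchangeRel (a : ℕ) (π : R →+ R) (h : Fin N → ℕ) (G : (Fin N → ℕ) → R) : Prop where
  gt : ∀ b, BaseOK h b → ∀ p r, IsGt h b a p r → G (swapRow a b) = π (G b) - G b
  le : ∀ b, BaseOK h b → (∀ p, b p = a → ∃ r, p < r ∧ h p ≤ h r ∧ b r = a + 1) →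
    G b = π (G (swapRow a b))

variable {h : Fin N → ℕ} {G : (Fin N → ℕ) → R}

theorem ExchangeRel.term_gt (E : ExchangeRel a π (fun i => h i - 1) G) (I : IsIsobaric x a π)
    {c : Fin N → ℕ} (hc : BaseOK (fun i => h i - 1) c) {k l : Fin N}
    (H : IsGt (fun i => h i - 1) c a k l) :
    (∏ i, x (swapRow a c i)) * G (swapRow a c) =
      π ((∏ i, x (c i)) * G c) - (∏ i, x (c i)) * G c := by
  obtain ⟨M, h1, h2, h3⟩ := prod_both (x := x) (π := π) H.left H.right H.uniq
  rw [h1, h2, mul_assoc _ M (G c), I.mul_both, h3 I, E.gt c hc k l H]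
  ring

theorem ExchangeRel.term_le (E : ExchangeRel a π (fun i => h i - 1) G) (I : IsIsobaric x a π)
    {c : Fin N → ℕ} (hc : BaseOK (fun i => h i - 1) c) {k l : Fin N} (hk : c k = a)
    (H : IsLe (fun i => h i - 1) c a k l) :
    (∏ i, x (c i)) * G c = π ((∏ i, x (swapRow a c i)) * G (swapRow a c)) := by
  obtain ⟨M, h1, h2, h3⟩ := prod_both (x := x) (π := π) hk (H.left hk).2.2 H.uniq
  rw [h1, h2, mul_assoc _ M (G (swapRow a c)), I.mul_both, h3 I, E.le c hc ?_]
  · ring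
  · intro p hp
    obtain rfl := (H.uniq p).1 hp
    exact ⟨l, H.left hp⟩

/-- Here the monomial is not symmetric, and the rule π(x_a f) = x_a f + x_{a+1} π f turns the `le`
relation of `G` into a relation of the `gt` shape for the terms, with the roles of `c` and its swap
exchanged. -/
theorem ExchangeRel.term_single (E : ExchangeRel a π (fun i => h i - 1) G) (I : IsIsobaric x a π)
    {c : Fin N → ℕ} (hc : BaseOK (fun i => h i - 1) c) {l : Fin N} (H : IsSingle c a l) :
    (∏ i, x (c i)) * G c = π ((∏ i, x (swapRow a c i)) * G (swapRow a c)) -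
      (∏ i, x (swapRow a c i)) * G (swapRow a c) := by
  obtain ⟨M, h1, h2, h3⟩ := prod_single (x := x) (π := π) H
  rw [h1, h2, mul_assoc _ M (G (swapRow a c)), I.mul_left, h3 I, E.le c hc ?_]
  · ring
  · intro p hp
    exact absurd hp (H.left p)

theorem swapRow_of_isNone {c : Fin N → ℕ} (H : IsNone c a) : swapRow a c = c :=
  funext fun i => lblSwap_of_ne (H i).1 (H i).2

theorem ExchangeRel.term_none (E : ExchangeRel a π (fun i => h i - 1) G) (I : IsIsobaric x a π)
    {c : Fin N → ℕ} (hc : BaseOK (fun i => h i - 1) c) (H : IsNone c a) :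
    π ((∏ i, x (c i)) * G c) = (∏ i, x (c i)) * G c := by
  have := E.le c hc fun p hp => absurd hp (H p).1
  rw [swapRow_of_isNone H] at this
  rw [I.mul_prod c univ (fun i _ => H i), ← this]

end Exchange

/-! ### Which of the four pairs of rows in an orbit are admissible -/

section Orbit

variable {N : ℕ} {a : ℕ} {h b c : Fin N → ℕ} {p r k l : Fin N}

theorem IsGt.swap (H : IsGt h b a p r) : swapRow a b p = a + 1 ∧ swapRow a b r = a ∧
    ∀ i, (swapRow a b i = a + 1 → i = p) ∧ (swapRow a b i = a → i = r) := by
  simp only [swapRow, lblSwap_eq_left, lblSwap_eq_right]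
  exact ⟨H.left, H.right, H.uniq⟩

theorem IsLe.swap (H : IsLe h b a p r) :
    (swapRow a b p = a + 1 → p < r ∧ h p ≤ h r ∧ swapRow a b r = a) ∧
    ∀ i, (swapRow a b i = a + 1 → i = p) ∧ (swapRow a b i = a → i = r) := by
  simp only [swapRow, lblSwap_eq_left, lblSwap_eq_right]
  exact ⟨H.left, H.uniq⟩

theorem IsSingle.swap (H : IsSingle b a l) : (∀ i, swapRow a b i ≠ a + 1) ∧ swapRow a b l = a ∧
    ∀ i, swapRow a b i = a → i = l := by
  simp only [swapRow, lblSwap_eq_left, lblSwap_eq_right, ne_eq]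
  exact ⟨H.left, H.right, H.uniq⟩

theorem rowOK_swap_iff : RowOK h (fun i => lblSwap a (swapRow a b i)) c ↔ RowOK h b c := by
  rw [show (fun i => lblSwap a (swapRow a b i)) = b from swapRow_swapRow a b]

theorem rowOK_swap_iff' : RowOK h b (fun i => lblSwap a (swapRow a c i)) ↔ RowOK h b c := by
  rw [show (fun i => lblSwap a (swapRow a c i)) = c from swapRow_swapRow a c]

/-- With s the swap and T(c) the term of `c`: if `p = k` then sb receives T(sc) = πT(c) - T(c)
exactly when b receives T(c). If `p ≠ k` then sb receives nothing and b receives T(c) + T(sc) =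
πT(c) or nothing, which π - 1 kills. -/
theorem IsGt.rowOK_gt (ha : 1 ≤ a) (hb : IsGt h b a p r) (hc : IsGt h c a k l) :
    ¬ RowOK h (swapRow a b) c ∧
    ((¬ RowOK h b (swapRow a c) ∧ (RowOK h (swapRow a b) (swapRow a c) ↔ RowOK h b c)) ∨
      (¬ RowOK h (swapRow a b) (swapRow a c) ∧ (RowOK h b (swapRow a c) ↔ RowOK h b c))) := by
  obtain ⟨h1, h2, h3, h4, h5⟩ := hb
  obtain ⟨k1, k2, k3, k4, k5⟩ := hc
  obtain ⟨b1, b2, b3⟩ := IsGt.swap ⟨h1, h2, h3, h4, h5⟩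
  obtain ⟨c1, c2, c3⟩ := IsGt.swap ⟨k1, k2, k3, k4, k5⟩
  refine ⟨fun H => rowOK_gt_gt_neg_pos_false ha H h1 h2 b1 b2 b3 k1 k2 k3 k5, ?_⟩
  by_cases e : p = k
  · refine Or.inl ⟨fun H => rowOK_gt_gt_pos_neg_ne ha H h1 h2 h3 h4 c1 e,
      fun H => ?_, fun H => rowOK_gt_gt_pos_pos_to_neg_neg ha H h1 h2 h3 h4 h5 k1 k2 k3 k4 k5 e⟩
    have := rowOK_gt_gt_neg_neg_to_pos_pos ha H h1 h2 b1 b2 b3 k1 c2 c3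
    rwa [rowOK_swap_iff, rowOK_swap_iff'] at this
  · refine Or.inr ⟨fun H => e (rowOK_gt_gt_neg_neg_eq ha H h1 h2 b1 b2 c3),
      fun H => ?_, fun H => rowOK_gt_gt_pos_pos_to_pos_neg ha H h1 h3 h4 h5 k1 k2 k3 k4 k5 e⟩
    have := rowOK_gt_gt_pos_neg_to_pos_pos ha H h1 h2 h3 h4 h5 k1 k2 c1 c2 c3
    rwa [rowOK_swap_iff'] at this

theorem IsGt.rowOK_le (ha : 1 ≤ a) (hb : IsGt h b a p r) (hk : c k = a) (hc : IsLe h c a k l) :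
    ¬ RowOK h b (swapRow a c) ∧ ¬ RowOK h (swapRow a b) c ∧
      ¬ RowOK h (swapRow a b) (swapRow a c) := by
  obtain ⟨k1, k2⟩ := hc
  obtain ⟨c1, c2⟩ := IsLe.swap ⟨k1, k2⟩
  have ck : swapRow a c k = a + 1 := by simp [swapRow, lblSwap_eq_right, hk]
  obtain ⟨k1, k3, k4⟩ := k1 hk
  obtain ⟨c1, c3, c4⟩ := c1 ck
  obtain ⟨h1, h2, h3, h4, h5⟩ := hb
  obtain ⟨b1, b2, b3⟩ := IsGt.swap ⟨h1, h2, h3, h4, h5⟩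
  exact ⟨fun H => rowOK_gt_le_pos_neg_false ha H h1 h3 h4 h5 k1 k3 ck c4 c2,
    fun H => rowOK_gt_le_neg_pos_false ha H h1 h2 b1 b2 b3 k1 hk k2,
    fun H => rowOK_gt_le_neg_neg_false ha H h1 h2 b1 b2 b3 k1 k3 ck c4 c2⟩

/-- The same dichotomy with `p = l`. The basic term is now that of the swapped row, because
`term_single` expresses the term of `c` through it. -/
theorem IsGt.rowOK_single (ha : 1 ≤ a) (hb : IsGt h b a p r) (hc : IsSingle c a l) :
    ¬ RowOK h (swapRow a b) (swapRow a c) ∧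
    ((¬ RowOK h b c ∧ (RowOK h (swapRow a b) c ↔ RowOK h b (swapRow a c))) ∨
      (¬ RowOK h (swapRow a b) c ∧ (RowOK h b (swapRow a c) ↔ RowOK h b c))) := by
  obtain ⟨h1, h2, h3, h4, h5⟩ := hb
  obtain ⟨k1, k2, k3⟩ := hc
  obtain ⟨b1, b2, b3⟩ := IsGt.swap ⟨h1, h2, h3, h4, h5⟩
  obtain ⟨c1, c2, c3⟩ := IsSingle.swap ⟨k1, k2, k3⟩
  refine ⟨fun H => rowOK_gt_single_neg_neg_false ha H h1 h2 b1 b2 c1, ?_⟩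
  by_cases e : p = l
  · refine Or.inl ⟨fun H => rowOK_gt_single_pos_pos_ne ha H h1 h2 h3 h4 k2 e,
      fun H => ?_, fun H => ?_⟩
    · have := rowOK_gt_single_neg_pos_to_pos_neg ha H h1 h2 b1 b2 b3 k1 k2 k3
      rwa [rowOK_swap_iff] at this
    · have := rowOK_gt_single_pos_neg_to_neg_pos ha H h1 h2 h3 h5 c1 c2 c3 e
      rwa [rowOK_swap_iff'] at this
  · refine Or.inr ⟨fun H => e (rowOK_gt_single_neg_pos_eq ha H h1 h2 b1 b2 k3),
      fun H => ?_, fun H => rowOK_gt_single_pos_pos_to_pos_neg ha H h1 h2 h3 h4 h5 k1 k2 k3⟩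
    have := rowOK_gt_single_pos_neg_to_pos_pos ha H h1 h4 h5 c1 c2 c3 e
    rwa [rowOK_swap_iff'] at this

theorem IsGt.rowOK_none (ha : 1 ≤ a) (hb : IsGt h b a p r) (hc : IsNone c a) :
    ¬ RowOK h (swapRow a b) c := fun H =>
  rowOK_gt_none_neg_pos_false ha H hb.lt hb.height hb.swap.1 hb.swap.2.1 hc

/-- Nothing is needed about the pair of the two swapped rows: its term is πT(c) - T(c), which π
kills by idempotence. -/
theorem IsLe.rowOK_gt (ha : 1 ≤ a) (hb : IsLe h b a p r) (hc : IsGt h c a k l) :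
    (RowOK h b (swapRow a c) ↔ RowOK h b c) ∧ (RowOK h (swapRow a b) c ↔ RowOK h b c) := by
  obtain ⟨h1, h2⟩ := hb
  obtain ⟨b1, b2⟩ := IsLe.swap ⟨h1, h2⟩
  obtain ⟨k1, k2, k3, k4, k5⟩ := hc
  obtain ⟨c1, c2, c3⟩ := IsGt.swap ⟨k1, k2, k3, k4, k5⟩
  have e1 : RowOK h b c → RowOK h b (swapRow a c) := fun H =>
    rowOK_le_gt_pos_pos_to_pos_neg ha H h1 h2 k1 k2 k3 k4 k5
  have e2 : RowOK h b (swapRow a c) → RowOK h (swapRow a b) c := fun H =>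
    rowOK_swap_iff'.mp (rowOK_le_gt_pos_neg_to_neg_pos ha H h1 h2 k1 k2 c1 c2 c3)
  have e3 : RowOK h (swapRow a b) c → RowOK h b c := fun H =>
    rowOK_swap_iff.mp (rowOK_le_gt_neg_pos_to_pos_pos ha H b1 b2 k1 k2 k3 k4 k5)
  tauto

/-- The alternative is whether `b l = a + 1`. In both cases the admissible term above the swapped
`b` has image T(c) under π, since T(c) = πT(sc) already lies in the image of π. -/
theorem IsLe.rowOK_le (ha : 1 ≤ a) (hb : IsLe h b a p r) (hk : c k = a) (hc : IsLe h c a k l) :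
    ¬ RowOK h b (swapRow a c) ∧
    ((¬ RowOK h (swapRow a b) c ∧ (RowOK h (swapRow a b) (swapRow a c) ↔ RowOK h b c)) ∨
      (¬ RowOK h (swapRow a b) (swapRow a c) ∧ (RowOK h (swapRow a b) c ↔ RowOK h b c))) := by
  obtain ⟨k1, k2⟩ := hc
  obtain ⟨c1, c2⟩ := IsLe.swap ⟨k1, k2⟩
  have ck : swapRow a c k = a + 1 := by simp [swapRow, lblSwap_eq_right, hk]
  obtain ⟨k1, k3, k4⟩ := k1 hk
  obtain ⟨c1, c3, c4⟩ := c1 ck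
  obtain ⟨h1, h2⟩ := hb
  obtain ⟨b1, b2⟩ := IsLe.swap ⟨h1, h2⟩
  refine ⟨fun H => rowOK_le_le_pos_neg_false ha H h1 h2 k1 k3 ck c4 c2, ?_⟩
  by_cases e : b l = a + 1
  · have e' : swapRow a b l = a := by simp [swapRow, lblSwap_eq_left, e]
    refine Or.inl ⟨fun H => rowOK_le_le_neg_pos_ne H k4 e', fun H => ?_,
      fun H => rowOK_le_le_pos_pos_to_neg_neg ha H h1 h2 k1 k3 hk k4 k2 e⟩
    have := rowOK_le_le_neg_neg_to_pos_pos ha H b1 b2 k1 k3 ck c4 c2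
    rwa [rowOK_swap_iff, rowOK_swap_iff'] at this
  · refine Or.inr ⟨fun H => e ?_, fun H => ?_,
      fun H => rowOK_le_le_pos_pos_to_neg_pos ha H h1 h2 k1 k3 hk k4 k2 e⟩
    · have := rowOK_le_le_neg_neg_eq ha H k1 k3 ck c4
      simpa [swapRow, lblSwap_eq_left] using this
    · exact rowOK_swap_iff.mp (rowOK_le_le_neg_pos_to_pos_pos ha H b1 b2 k1 k3 hk k4 k2)

theorem IsLe.rowOK_single (ha : 1 ≤ a) (hb : IsLe h b a p r) (hc : IsSingle c a l) :
    (RowOK h b (swapRow a c) ↔ RowOK h b c) ∧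
      (RowOK h (swapRow a b) (swapRow a c) ↔ RowOK h b c) := by
  obtain ⟨h1, h2⟩ := hb
  obtain ⟨b1, b2⟩ := IsLe.swap ⟨h1, h2⟩
  obtain ⟨k1, k2, k3⟩ := hc
  obtain ⟨c1, c2, c3⟩ := IsSingle.swap ⟨k1, k2, k3⟩
  have e1 : RowOK h b c → RowOK h b (swapRow a c) := fun H =>
    rowOK_le_single_pos_pos_to_pos_neg ha H h1 h2 k1 k2 k3
  have e2 : RowOK h b (swapRow a c) → RowOK h (swapRow a b) (swapRow a c) := fun H =>
    rowOK_le_single_pos_neg_to_neg_neg ha H h1 h2 c1 c2 c3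
  have e3 : RowOK h (swapRow a b) (swapRow a c) → RowOK h b c := fun H =>
    rowOK_swap_iff'.mp (rowOK_swap_iff.mp (rowOK_le_single_neg_neg_to_pos_pos ha H b1 b2 c1 c2 c3))
  tauto

theorem IsLe.rowOK_none (ha : 1 ≤ a) (hb : IsLe h b a p r) (hc : IsNone c a) :
    RowOK h (swapRow a b) c ↔ RowOK h b c :=
  ⟨fun H => rowOK_swap_iff.mp (rowOK_le_none_neg_pos_to_pos_pos ha H hb.swap.1 hb.swap.2 hc),
    fun H => rowOK_le_none_pos_pos_to_neg_pos ha H hb.left hb.uniq hc⟩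

end Orbit

/-! ### The exchange relations for one orbit of upper rows -/

section Orbit

variable {N : ℕ} {R : Type*} [CommRing R] {x : ℕ → R} {a : ℕ} {π : R →+ R}
  {h b c : Fin N → ℕ} {p r k l : Fin N} {G : (Fin N → ℕ) → R}

theorem IsGt.of_pred (H : IsGt (fun i => h i - 1) c a k l) : IsGt h c a k l :=
  ⟨H.lt, by have := H.height; omega, H.left, H.right, H.uniq⟩

/-- If column `k` has the positive label `a`, then `h k - 1` is nonzero, so the inequality between
truncated differences lifts to the heights. -/
theorem IsLe.of_pred (ha : 1 ≤ a) (hc : BaseOK (fun i => h i - 1) c)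
    (H : IsLe (fun i => h i - 1) c a k l) : IsLe h c a k l :=
  ⟨fun e => ⟨(H.left e).1, by
    have h1 := (H.left e).2.1
    have h2 := hc.zero k
    omega, (H.left e).2.2⟩, H.uniq⟩

theorem rowTerm_of_not_baseOK (ha : 1 ≤ a) (hc : ¬ BaseOK (fun i => h i - 1) c) :
    rowTerm x G h b c = 0 ∧ rowTerm x G h b (swapRow a c) = 0 := by
  refine ⟨if_neg fun H => hc H.baseOK, if_neg fun H => hc ?_⟩
  have := H.baseOK.swap ha
  rwa [swapRow_swapRow] at this

/-- In each admissible configuration either the terms above `b` and its swap correspond by π - 1, or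
nothing lies above the swap and the total above `b` is in the image of the idempotent π (or, for
`IsNone`, fixed by it). -/
theorem IsGt.rowTerm_add (ha : 1 ≤ a) (I : IsIsobaric x a π)
    (E : ExchangeRel a π (fun i => h i - 1) G) (hb : IsGt h b a p r) (c : Fin N → ℕ) :
    rowTerm x G h (swapRow a b) c + rowTerm x G h (swapRow a b) (swapRow a c) =
      π (rowTerm x G h b c + rowTerm x G h b (swapRow a c)) -
        (rowTerm x G h b c + rowTerm x G h b (swapRow a c)) := by
  by_cases hc : BaseOK (fun i => h i - 1) c
  swap
  · simp [rowTerm_of_not_baseOK ha hc]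
  have hgt : ∀ c, BaseOK (fun i => h i - 1) c → (∃ k l, IsGt (fun i => h i - 1) c a k l) →
      rowTerm x G h (swapRow a b) c + rowTerm x G h (swapRow a b) (swapRow a c) =
        π (rowTerm x G h b c + rowTerm x G h b (swapRow a c)) -
          (rowTerm x G h b c + rowTerm x G h b (swapRow a c)) := by
    rintro c hc ⟨k, l, H⟩
    have e := E.term_gt I hc H
    have i := I.idem ((∏ i, x (c i)) * G c)
    obtain ⟨h1, ⟨h2, h3⟩ | ⟨h2, h3⟩⟩ := hb.rowOK_gt ha H.of_pred
    · rcases iff_iff_and_or_not_and_not.mp h3 with h4 | h4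
      · simp only [rowTerm, if_neg h1, if_neg h2, if_pos h4.1, if_pos h4.2]
        rw [e]; simp
      · simp [rowTerm, h1, h2, h4]
    · rcases iff_iff_and_or_not_and_not.mp h3 with h4 | h4
      · simp only [rowTerm, if_neg h1, if_neg h2, if_pos h4.1, if_pos h4.2]
        rw [e]; simp [i]
      · simp [rowTerm, h1, h2, h4]
  have hle : ∀ c, BaseOK (fun i => h i - 1) c →
      (∃ k l, c k = a ∧ IsLe (fun i => h i - 1) c a k l) →
      rowTerm x G h (swapRow a b) c + rowTerm x G h (swapRow a b) (swapRow a c) =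
        π (rowTerm x G h b c + rowTerm x G h b (swapRow a c)) -
          (rowTerm x G h b c + rowTerm x G h b (swapRow a c)) := by
    rintro c hc ⟨k, l, hk, H⟩
    have e := E.term_le I hc hk H
    have i := I.idem ((∏ i, x (swapRow a c i)) * G (swapRow a c))
    obtain ⟨h1, h2, h3⟩ := hb.rowOK_le ha hk (H.of_pred ha hc)
    simp only [rowTerm, if_neg h1, if_neg h2, if_neg h3]
    split_ifs
    · rw [e]; simp [i]
    · simp
  have hsi : ∀ c, BaseOK (fun i => h i - 1) c → (∃ l, IsSingle c a l) →
      rowTerm x G h (swapRow a b) c + rowTerm x G h (swapRow a b) (swapRow a c) =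
        π (rowTerm x G h b c + rowTerm x G h b (swapRow a c)) -
          (rowTerm x G h b c + rowTerm x G h b (swapRow a c)) := by
    rintro c hc ⟨l, H⟩
    have e := E.term_single I hc H
    have i := I.idem ((∏ i, x (swapRow a c i)) * G (swapRow a c))
    obtain ⟨h1, ⟨h2, h3⟩ | ⟨h2, h3⟩⟩ := hb.rowOK_single ha H
    · rcases iff_iff_and_or_not_and_not.mp h3 with h4 | h4
      · simp only [rowTerm, if_neg h1, if_neg h2, if_pos h4.1, if_pos h4.2]
        rw [e]; simp
      · simp [rowTerm, h1, h2, h4]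
    · rcases iff_iff_and_or_not_and_not.mp h3 with h4 | h4
      · simp only [rowTerm, if_neg h1, if_neg h2, if_pos h4.1, if_pos h4.2]
        rw [e]; simp [i]
      · simp [rowTerm, h1, h2, h4]
  -- The claim is symmetric in `c` and its swap, so it may be proved for whichever of the two is in
  -- normal form.
  have swap : ∀ f : (Fin N → ℕ) → Prop, (∀ c, BaseOK (fun i => h i - 1) c → f c →
      rowTerm x G h (swapRow a b) c + rowTerm x G h (swapRow a b) (swapRow a c) =
        π (rowTerm x G h b c + rowTerm x G h b (swapRow a c)) -
          (rowTerm x G h b c + rowTerm x G h b (swapRow a c))) → f (swapRow a c) →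
      rowTerm x G h (swapRow a b) c + rowTerm x G h (swapRow a b) (swapRow a c) =
        π (rowTerm x G h b c + rowTerm x G h b (swapRow a c)) -
          (rowTerm x G h b c + rowTerm x G h b (swapRow a c)) := by
    intro f hf h
    have := hf _ (hc.swap ha) h
    rw [swapRow_swapRow] at this
    rwa [add_comm (rowTerm x G _ b c), add_comm (rowTerm x G _ (swapRow a b) c)]
  rcases hc.cases ha with H | H | H | H | H | H | H
  · exact hgt c hc H
  · exact hle c hc H
  · exact hsi c hc H
  · have h1 := hb.rowOK_none ha H
    have e := E.term_none I hc H
    rw [swapRow_of_isNone H]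
    by_cases h2 : RowOK h b c
    · simp only [rowTerm, if_neg h1, if_pos h2]
      simp [e]
    · simp [rowTerm, h1, h2]
  · exact swap _ hgt H
  · exact swap _ hle H
  · exact swap _ hsi H

/-- If the label `a` is absent, the columns in `IsLe` are partly or wholly arbitrary; `i` only
serves to provide some column when neither label occurs. -/
theorem BaseOK.exists_isLe (ha : 1 ≤ a) (hB : BaseOK h b)
    (hb : ∀ p, b p = a → ∃ r, p < r ∧ h p ≤ h r ∧ b r = a + 1) (i : Fin N) :
    ∃ p r, IsLe h b a p r := by
  by_cases h1 : ∃ p, b p = a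
  · obtain ⟨p, hp⟩ := h1
    obtain ⟨r, h1, h2, h3⟩ := hb p hp
    exact ⟨p, r, fun _ => ⟨h1, h2, h3⟩, hB.uniq ha hp h3⟩
  · push Not at h1
    by_cases h2 : ∃ r, b r = a + 1
    · obtain ⟨r, hr⟩ := h2
      exact ⟨r, r, fun e => absurd e (h1 r), fun i => ⟨fun e => absurd e (h1 i), fun e =>
        (hB.inj i r (e.trans hr.symm)).resolve_left (by omega)⟩⟩
    · push Not at h2
      exact ⟨i, i, fun e => absurd e (h1 i), fun j => ⟨fun e => absurd e (h1 j), fun e =>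
        absurd e (h2 j)⟩⟩

/-- The total above `b` is always in the fixed space of π, and the total above the swap differs from
a preimage of it only by terms that π kills or by replacing an element with its image under π. -/
theorem BaseOK.rowTerm_add (ha : 1 ≤ a) (I : IsIsobaric x a π)
    (E : ExchangeRel a π (fun i => h i - 1) G) (hB : BaseOK h b)
    (hb : ∀ p, b p = a → ∃ r, p < r ∧ h p ≤ h r ∧ b r = a + 1) (c : Fin N → ℕ) :
    rowTerm x G h b c + rowTerm x G h b (swapRow a c) =
      π (rowTerm x G h (swapRow a b) c + rowTerm x G h (swapRow a b) (swapRow a c)) := by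
  by_cases hc : BaseOK (fun i => h i - 1) c
  swap
  · simp [rowTerm_of_not_baseOK ha hc]
  have hgt : ∀ c, BaseOK (fun i => h i - 1) c → (∃ k l, IsGt (fun i => h i - 1) c a k l) →
      rowTerm x G h b c + rowTerm x G h b (swapRow a c) =
        π (rowTerm x G h (swapRow a b) c + rowTerm x G h (swapRow a b) (swapRow a c)) := by
    rintro c hc ⟨k, l, H⟩
    obtain ⟨p, r, hb⟩ := hB.exists_isLe ha hb k
    have e := E.term_gt I hc H
    have i := I.idem ((∏ i, x (c i)) * G c)
    obtain ⟨h1, h2⟩ := hb.rowOK_gt ha H.of_pred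
    by_cases h3 : RowOK h b c <;> by_cases h4 : RowOK h (swapRow a b) (swapRow a c) <;>
      simp [rowTerm, h1, h2, h3, h4, e, i]
  have hle : ∀ c, BaseOK (fun i => h i - 1) c →
      (∃ k l, c k = a ∧ IsLe (fun i => h i - 1) c a k l) →
      rowTerm x G h b c + rowTerm x G h b (swapRow a c) =
        π (rowTerm x G h (swapRow a b) c + rowTerm x G h (swapRow a b) (swapRow a c)) := by
    rintro c hc ⟨k, l, hk, H⟩
    obtain ⟨p, r, hb⟩ := hB.exists_isLe ha hb k
    have e := E.term_le I hc hk H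
    have i := I.idem ((∏ i, x (swapRow a c i)) * G (swapRow a c))
    obtain ⟨h1, ⟨h2, h3⟩ | ⟨h2, h3⟩⟩ := hb.rowOK_le ha hk (H.of_pred ha hc)
    · rcases iff_iff_and_or_not_and_not.mp h3 with h4 | h4
      · simp only [rowTerm, if_neg h1, if_neg h2, if_pos h4.1, if_pos h4.2]
        rw [e]; simp
      · simp [rowTerm, h1, h2, h4]
    · rcases iff_iff_and_or_not_and_not.mp h3 with h4 | h4
      · simp only [rowTerm, if_neg h1, if_neg h2, if_pos h4.1, if_pos h4.2]
        rw [e]; simp [i]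
      · simp [rowTerm, h1, h2, h4]
  have hsi : ∀ c, BaseOK (fun i => h i - 1) c → (∃ l, IsSingle c a l) →
      rowTerm x G h b c + rowTerm x G h b (swapRow a c) =
        π (rowTerm x G h (swapRow a b) c + rowTerm x G h (swapRow a b) (swapRow a c)) := by
    rintro c hc ⟨l, H⟩
    obtain ⟨p, r, hb⟩ := hB.exists_isLe ha hb l
    have e := E.term_single I hc H
    have i := I.idem ((∏ i, x (swapRow a c i)) * G (swapRow a c))
    obtain ⟨h1, h2⟩ := hb.rowOK_single ha H
    by_cases h3 : RowOK h b c <;> by_cases h4 : RowOK h (swapRow a b) c <;>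
      simp [rowTerm, h1, h2, h3, h4, e, i]
  have swap : ∀ f : (Fin N → ℕ) → Prop, (∀ c, BaseOK (fun i => h i - 1) c → f c →
      rowTerm x G h b c + rowTerm x G h b (swapRow a c) =
        π (rowTerm x G h (swapRow a b) c + rowTerm x G h (swapRow a b) (swapRow a c))) →
      f (swapRow a c) →
      rowTerm x G h b c + rowTerm x G h b (swapRow a c) =
        π (rowTerm x G h (swapRow a b) c + rowTerm x G h (swapRow a b) (swapRow a c)) := by
    intro f hf h
    have := hf _ (hc.swap ha) h
    rw [swapRow_swapRow] at this
    rwa [add_comm (rowTerm x G _ b c), add_comm (rowTerm x G _ (swapRow a b) c)]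
  rcases hc.cases ha with H | H | H | H | H | H | H
  · exact hgt c hc H
  · exact hle c hc H
  · exact hsi c hc H
  · have h1 : RowOK h (swapRow a b) c ↔ RowOK h b c := by
      rcases isEmpty_or_nonempty (Fin N) with _ | ⟨⟨i⟩⟩
      · rw [Subsingleton.elim (swapRow a b) b]
      · obtain ⟨p, r, hb⟩ := hB.exists_isLe ha hb i
        exact hb.rowOK_none ha H
    have e := E.term_none I hc H
    rw [swapRow_of_isNone H]
    rcases iff_iff_and_or_not_and_not.mp h1 with h4 | h4
    · simp only [rowTerm, if_pos h4.1, if_pos h4.2]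
      simp [e]
    · simp [rowTerm, h4]
  · exact swap _ hgt H
  · exact swap _ hle H
  · exact swap _ hsi H

end Orbit

/-! ### The exchange relations for generating functions of fillings -/

section RowGen

variable {N : ℕ} {R : Type*} [CommRing R]

/-- The generating function of the labellings, in rows `1, …, r`, of a diagram with augmented
heights `h` and labels `b` in row `0`; the labels are at most `n`. -/
noncomputable def rowGen (x : ℕ → R) (n : ℕ) : ℕ → (Fin N → ℕ) → (Fin N → ℕ) → R
  | 0, _, _ => 1
  | r + 1, h, b => ∑ c : Fin N → Fin (n + 1),
      rowTerm x (rowGen x n r fun i => h i - 1) h b fun i => (c i : ℕ)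

theorem sum_labels_swap {n a : ℕ} (han : a + 1 ≤ n) (f : (Fin N → ℕ) → R) :
    ∑ c : Fin N → Fin (n + 1), f (swapRow a fun i => (c i : ℕ)) =
      ∑ c : Fin N → Fin (n + 1), f fun i => (c i : ℕ) := by
  let s : Equiv.Perm (Fin (n + 1)) := Equiv.swap ⟨a, by omega⟩ ⟨a + 1, by omega⟩
  refine Fintype.sum_equiv ((Equiv.refl (Fin N)).arrowCongr s) _ _ fun c => congrArg f ?_
  funext i
  simp only [swapRow, Equiv.arrowCongr_apply, Equiv.coe_refl, Function.comp_apply,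
    Equiv.refl_symm, id_eq, s, Equiv.swap_apply_def, Fin.ext_iff, lblSwap]
  split_ifs <;> rfl

/-- Summing over all rows together with their swaps counts everything twice, which avoids choosing
representatives of the orbits; the factor 2 is cancelled afterwards. -/
theorem two_mul_sum_labels {n a : ℕ} (han : a + 1 ≤ n) (f : (Fin N → ℕ) → R) :
    2 * ∑ c : Fin N → Fin (n + 1), f (fun i => (c i : ℕ)) =
      ∑ c : Fin N → Fin (n + 1), (f (fun i => (c i : ℕ)) + f (swapRow a fun i => (c i : ℕ))) := by
  rw [Finset.sum_add_distrib, sum_labels_swap han]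
  ring

/-- Induction on the number of rows: removing the lowest row lowers all heights by one, and the
relations for the rows above are exactly what the orbit computation consumes. -/
theorem rowGen_exchangeRel [IsDomain R] [CharZero R] {x : ℕ → R} {n a : ℕ} (ha : 1 ≤ a)
    (han : a + 1 ≤ n) {π : R →+ R} (I : IsIsobaric x a π) (r : ℕ) (h : Fin N → ℕ)
    (hr : ∀ i, h i ≤ r + 1) : ExchangeRel a π h (rowGen x n r h) := by
  have two : ∀ y : R, π (2 * y) = 2 * π y := fun y => by rw [two_mul, map_add, two_mul]
  induction r generalizing h with
  | zero =>
    -- With heights at most 1 the strictly lower column `q` would have height 0 and hence label 0,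
    -- so the first relation is vacuous.
    refine ⟨fun b hB p q H => ?_, fun b hB H => I.one.symm⟩
    have h1 := hr p
    have h2 := hB.zero q
    have h3 := H.right
    have h4 := H.height
    omega
  | succ r ih =>
    have E := ih (fun i => h i - 1) fun i => by have := hr i; omega
    refine ⟨fun b hB p q H => ?_, fun b hB H => ?_⟩
    · refine mul_left_cancel₀ (two_ne_zero' R) ?_
      rw [mul_sub, ← two, rowGen, rowGen, two_mul_sum_labels han, two_mul_sum_labels han,
        map_sum, ← Finset.sum_sub_distrib]
      exact Finset.sum_congr rfl fun c _ => H.rowTerm_add ha I E _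
    · refine mul_left_cancel₀ (two_ne_zero' R) ?_
      rw [← two, rowGen, rowGen, two_mul_sum_labels han, two_mul_sum_labels han, map_sum]
      exact Finset.sum_congr rfl fun c _ => hB.rowTerm_add ha I E H _

end RowGen

/-! ### Isobaric divided differences satisfy the abstract axioms -/

section Isobaric

variable {n : ℕ} {i j : Fin n}

theorem isobaric_unique (hij : i ≠ j) {f g : MvPolynomial (Fin n) ℚ}
    (h : (MvPolynomial.X i - MvPolynomial.X j) * g =
      MvPolynomial.X i * f - MvPolynomial.X j * swapVars i j f) : isobaric i j f = g :=
  mul_left_cancel₀ (X_sub_X_ne_zero hij) ((isobaric_spec i j f).trans h.symm)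

theorem swapVars_add (i j : Fin n) (f g : MvPolynomial (Fin n) ℚ) :
    swapVars i j (f + g) = swapVars i j f + swapVars i j g := map_add _ _ _

theorem isobaric_add (hij : i ≠ j) (f g : MvPolynomial (Fin n) ℚ) :
    isobaric i j (f + g) = isobaric i j f + isobaric i j g := by
  apply isobaric_unique hij
  rw [mul_add, isobaric_spec, isobaric_spec, swapVars_add]
  ring

theorem isobaric_of_swapVars_eq (hij : i ≠ j) {f : MvPolynomial (Fin n) ℚ}
    (h : swapVars i j f = f) : isobaric i j f = f :=
  isobaric_unique hij (by rw [h]; ring)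

theorem isobaric_isobaric (hij : i ≠ j) (f : MvPolynomial (Fin n) ℚ) :
    isobaric i j (isobaric i j f) = isobaric i j f :=
  isobaric_of_swapVars_eq hij (swapVars_isobaric hij f)

theorem isobaric_mul_of_swapVars_eq (hij : i ≠ j) {y : MvPolynomial (Fin n) ℚ}
    (h : swapVars i j y = y) (f : MvPolynomial (Fin n) ℚ) :
    isobaric i j (y * f) = y * isobaric i j f := by
  apply isobaric_unique hij
  rw [mul_left_comm, isobaric_spec, swapVars_mul, h]
  ring

theorem isobaric_X_mul (hij : i ≠ j) (f : MvPolynomial (Fin n) ℚ) :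
    isobaric i j (MvPolynomial.X i * f) =
      MvPolynomial.X i * f + MvPolynomial.X j * isobaric i j f := by
  apply isobaric_unique hij
  rw [mul_add, mul_left_comm, mul_left_comm _ (MvPolynomial.X j), isobaric_spec, swapVars_mul,
    swapVars_X, Equiv.swap_apply_left]
  ring

/-- The isobaric divided difference as an additive map. -/
noncomputable def isobaricHom (hij : i ≠ j) :
    MvPolynomial (Fin n) ℚ →+ MvPolynomial (Fin n) ℚ :=
  AddMonoidHom.mk' (isobaric i j) (isobaric_add hij)

/-- The variable of the label `m` among the labels `1, …, n`. -/
noncomputable def lblVar (n m : ℕ) : MvPolynomial (Fin n) ℚ :=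
  if h : 1 ≤ m ∧ m ≤ n then MvPolynomial.X ⟨m - 1, by omega⟩ else 1

theorem lblVar_zero : lblVar n 0 = 1 := by simp [lblVar]

theorem lblVar_succ (m : Fin n) : lblVar n (m + 1) = MvPolynomial.X m := by
  have : 1 ≤ (m : ℕ) + 1 ∧ (m : ℕ) + 1 ≤ n := by omega
  rw [lblVar, dif_pos this]
  rfl

theorem isIsobaric_lblVar (hij : i ≠ j) (h : (j : ℕ) = i + 1) :
    IsIsobaric (lblVar n) (i + 1) (isobaricHom hij) where
  one := isobaric_of_swapVars_eq hij (map_one _)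
  idem := isobaric_isobaric hij
  mul_of_ne y h1 h2 := by
    refine isobaric_mul_of_swapVars_eq hij ?_
    unfold lblVar
    split_ifs with hy
    · rw [swapVars_X, Equiv.swap_apply_of_ne_of_ne] <;> rw [ne_eq, Fin.ext_iff] <;> simp <;> omega
    · exact map_one _
  mul_both := by
    rw [← h, lblVar_succ, h, lblVar_succ]
    refine isobaric_mul_of_swapVars_eq hij ?_
    rw [swapVars_mul, swapVars_X, swapVars_X, Equiv.swap_apply_left, Equiv.swap_apply_right,
      mul_comm]
  mul_left := by
    rw [← h, lblVar_succ, h, lblVar_succ]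
    exact isobaric_X_mul hij

end Isobaric

/-! ### Key polynomials as generating functions of fillings -/

section KeyFillings

variable {N : ℕ}

/-- Every column must keep its bottom label. If column `i` took a smaller label y in the next row,
the column labelled y below is at least as high, and by induction on labels it also keeps y there,
so y would occur twice. -/
theorem rowGen_of_dominant {R : Type*} [CommRing R] {x : ℕ → R} (hx : x 0 = 1) {n : ℕ} (r : ℕ)
    (h b : Fin N → ℕ) (hB : BaseOK h b) (hr : ∀ i, h i ≤ r + 1) (hn : ∀ i, b i ≤ n)
    (hdom : ∀ m i, 1 ≤ m → b i = m + 1 → 2 ≤ h i → ∃ k, b k = m ∧ h i ≤ h k) :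
    rowGen x n r h b = ∏ i, x (b i) ^ (h i - 1) := by
  induction r generalizing h b with
  | zero =>
    rw [rowGen]
    refine (Finset.prod_eq_one fun i _ => ?_).symm
    rw [show h i - 1 = 0 by have := hr i; omega, pow_zero]
  | succ r ih =>
    set c : Fin N → ℕ := fun i => if 2 ≤ h i then b i else 0 with hc
    have hc2 : ∀ i, 2 ≤ h i → c i = b i := fun i hi => if_pos hi
    have hcle : ∀ i, c i ≤ b i := by
      intro i; simp only [hc]; split_ifs <;> omega
    have hrow : RowOK h b c := by
      refine ⟨hcle, fun i => ?_, fun i j e => ?_, fun i j _ => ⟨fun hh h1 => ?_, fun hh h1 => ?_⟩⟩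
      · have := hB.zero i
        simp only [hc]; split_ifs <;> omega
      · have := hB.inj i j
        simp only [hc] at e ⊢
        split_ifs at e ⊢ <;> omega
      · have := hB.zero j
        rw [hc2 i (by omega)]
        omega
      · have : 2 ≤ h i := by
          by_contra h2
          simp [hc, h2] at h1
        rw [hc2 i this, hc2 j (by omega)]
        omega
    have huniq : ∀ c', RowOK h b c' → c' = c := by
      intro c' H
      have key : ∀ m i, b i = m → 2 ≤ h i → c' i = m := by
        intro m
        induction m using Nat.strong_induction_on with
        | _ m IH =>
        intro i hi h2
        by_contra hne
        have hle := H.le i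
        have h0 := H.zero i
        -- Iterating `hdom` downwards from the label of column `i` reaches every smaller positive
        -- label, always on a column at least as high.
        have down : ∀ t, ∀ y, y + t = m → 1 ≤ y → ∃ k, b k = y ∧ h i ≤ h k := by
          intro t
          induction t with
          | zero => exact fun y hy _ => ⟨i, by omega, le_rfl⟩
          | succ t iht =>
            intro y hy h1
            obtain ⟨k, hk, hk'⟩ := iht (y + 1) (by omega) (by omega)
            obtain ⟨k', e1, e2⟩ := hdom y k h1 hk (by omega)
            exact ⟨k', e1, hk'.trans e2⟩
        obtain ⟨k, hk, hk'⟩ := down (m - c' i) (c' i) (by omega) (by omega)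
        have := IH (c' i) (by omega) k hk (by omega)
        rcases H.inj k i this with e | e
        · omega
        · subst e; omega
      funext i
      by_cases h2 : 2 ≤ h i
      · rw [key _ i rfl h2, hc2 i h2]
      · simp only [hc, if_neg h2]
        exact (H.zero i).mpr (by omega)
    have hIH := ih (fun i => h i - 1) c hrow.baseOK (fun i => by have := hr i; omega)
      (fun i => (hcle i).trans (hn i)) (fun m i hm hi h2 => by
        have h3 : 2 ≤ h i := by omega
        rw [hc2 i h3] at hi
        obtain ⟨k, e1, e2⟩ := hdom m i hm hi h3
        exact ⟨k, by rw [hc2 k (by omega), e1], by omega⟩)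
    rw [rowGen, Finset.sum_eq_single fun i => ⟨c i, by have := hcle i; have := hn i; omega⟩]
    · rw [rowTerm, if_pos hrow, hIH, ← Finset.prod_mul_distrib]
      refine Finset.prod_congr rfl fun i _ => ?_
      by_cases h2 : 2 ≤ h i
      · dsimp only
        rw [hc2 i h2, ← pow_succ']
        congr 1
        omega
      · have : c i = 0 := by simp [hc, h2]
        simp only [this, hx, one_pow, mul_one]
        rw [show h i - 1 = 0 by omega, pow_zero]
    · intro c' _ hne
      refine if_neg fun H => hne ?_
      have := huniq _ H
      funext i
      exact Fin.ext (congrFun this i)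
    · simp

/-- `γ m` is the height of the column with label `m + 1`, or zero if there is none. -/
def IsHeightFun {n : ℕ} (h b : Fin N → ℕ) (γ : Fin n → ℕ) : Prop :=
  ∀ m : Fin n, (∀ i, b i = m + 1 → h i = γ m + 1) ∧ ((∀ i, b i ≠ m + 1) → γ m = 0)

/-- The key polynomial of `γ` is the generating function of the labellings whose bottom row has the
labels `b`. -/
theorem rowGen_eq_keyPoly {n : ℕ} (r : ℕ) (h : Fin N → ℕ) (hpos : ∀ i, 1 ≤ h i)
    (hr : ∀ i, h i ≤ r + 1) (w : ℕ) (γ : Fin n → ℕ) (hw : ∑ k : Fin n, (k : ℕ) * γ k = w)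
    (b : Fin N → ℕ) (hB : BaseOK h b) (hn : ∀ i, b i ≤ n)
    (hord : ∀ i j, i < j → h j ≤ h i → b i < b j) (hγ : IsHeightFun h b γ) :
    rowGen (lblVar n) n r h b = keyPoly γ := by
  have hb1 : ∀ i, 1 ≤ b i := fun i => by
    have := hB.zero i
    have := hpos i
    omega
  induction w using Nat.strong_induction_on generalizing γ b with
  | _ w ih =>
  by_cases hasc : ∃ i j : Fin n, (j : ℕ) = i + 1 ∧ γ i < γ j
  · obtain ⟨i, j, hij, hlt⟩ := hasc
    have hne : i ≠ j := Fin.ne_of_val_ne (by omega)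
    obtain ⟨q, hq⟩ : ∃ q, b q = j + 1 := by
      by_contra hcon
      push Not at hcon
      have := (hγ j).2 hcon
      omega
    have hhq := (hγ j).1 q hq
    -- At an ascent of γ the column labelled `i + 1`, if there is one, is lower than the column `q`
    -- labelled `j + 1`. By `hord` it cannot be to the right of `q`, so the `le` relation applies
    -- and is the recursion of key polynomials.
    have hE := (rowGen_exchangeRel (x := lblVar n) (n := n) (a := i + 1) (by omega)
      (by omega) (isIsobaric_lblVar hne hij) r h hr).le b hB (by
        intro p hp
        have hhp := (hγ i).1 p hp
        refine ⟨q, ?_, by omega, by omega⟩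
        rcases lt_trichotomy p q with h1 | h1 | h1
        · exact h1
        · subst h1; omega
        · have := hord q p h1 (by omega)
          omega)
    rw [hE, keyPoly_ascent _ γ rfl i j hij hlt]
    refine congrArg _ ?_
    have hsw : ∀ m : Fin n, ∀ k, swapRow (i + 1) b k = m + 1 ↔ b k = (Equiv.swap i j m : Fin n) + 1 := by
      intro m k
      have e1 : swapRow (i + 1) b k = m + 1 ↔ b k = lblSwap (i + 1) (m + 1) := by
        constructor
        · intro e
          rw [← e, swapRow, lblSwap_lblSwap]
        · intro e
          rw [swapRow, e, lblSwap_lblSwap]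
      rw [e1]
      have : lblSwap (i + 1) (m + 1) = (Equiv.swap i j m : Fin n) + 1 := by
        rw [Equiv.swap_apply_def]
        unfold lblSwap
        simp only [Fin.ext_iff]
        split_ifs <;> omega
      rw [this]
    refine ih _ ?_ _ rfl _ (hB.swap (by omega)) ?_ ?_ ?_ ?_
    · rw [← hw]
      exact weight_swap_lt γ i j (Fin.lt_def.mpr (by omega)) hlt
    · intro k
      have := hn k
      simp only [swapRow, lblSwap]
      split_ifs <;> omega
    · intro k l hkl hh
      have h1 := hord k l hkl hh
      -- The swap could violate `hord` only for these two columns, and their heights are in the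
      -- wrong order for `hord` to constrain them.
      have h2 : ¬ (b k = i + 1 ∧ b l = i + 1 + 1) := by
        rintro ⟨e1, e2⟩
        have := (hγ i).1 k e1
        have := (hγ j).1 l (by omega)
        omega
      simp only [swapRow, lblSwap]
      split_ifs <;> omega
    · intro m
      simp only [hsw, Function.comp_apply, ne_eq]
      exact hγ _
    · intro k
      have := hb1 k
      simp only [swapRow, lblSwap]
      split_ifs <;> omega
  -- Without ascents γ is weakly decreasing, which makes the bottom row dominant, and the unique
  -- filling gives x^γ.
  · have hanti : Antitone γ := by
      rcases n with _ | n
      · exact fun i => i.elim0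
      · rw [Fin.antitone_iff_succ_le]
        intro i
        by_contra hcon
        exact hasc ⟨i.castSucc, i.succ, by simp, by omega⟩
    rw [keyPoly_of_antitone γ hanti, rowGen_of_dominant lblVar_zero r h b hB hr hn]
    · refine Fintype.prod_of_injective
        (fun i => (⟨b i - 1, by have := hb1 i; have := hn i; omega⟩ : Fin n)) ?_ _ _ ?_ ?_
      · intro i j e
        have := hb1 i
        have := hb1 j
        simp only [Fin.mk.injEq] at e
        exact (hB.inj i j (by omega)).resolve_left (by omega)
      · intro m hm
        have : γ m = 0 := (hγ m).2 fun i e => hm ⟨i, Fin.ext (by simp [e])⟩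
        rw [this, pow_zero]
      · intro i
        have e1 := hb1 i
        have e2 := hn i
        have := (hγ ⟨b i - 1, by omega⟩).1 i (by simp; omega)
        rw [this, ← lblVar_succ]
        simp only [Nat.add_sub_cancel]
        rw [Nat.sub_add_cancel e1]
    · intro m i hm hi h2
      have h3 := hn i
      have e1 := (hγ ⟨m, by omega⟩).1 i hi
      have e2 : γ ⟨m, by omega⟩ ≤ γ ⟨m - 1, by omega⟩ := hanti (by simp [Fin.le_def])
      obtain ⟨k, hk⟩ : ∃ k, b k = m - 1 + 1 := by
        by_contra hcon
        push Not at hcon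
        have := (hγ ⟨m - 1, by omega⟩).2 hcon
        omega
      have e3 := (hγ ⟨m - 1, by omega⟩).1 k hk
      exact ⟨k, by omega, by omega⟩

end KeyFillings

/-! ### The Weyl symmetrizer: denominator formula and absorption of ξ_i -/

section Weyl

/-- The Weyl denominator formula in type `A`. -/
theorem sum_perm_prod_one_sub_inv {K : Type*} [Field K] {m : ℕ} (y : Fin m → K)
    (hy : Function.Injective y) (h0 : ∀ i, y i ≠ 0) :
    ∑ τ : Equiv.Perm (Fin m), ∏ i, ∏ j ∈ Ioi i, 1 / (1 - y (τ j) / y (τ i)) = 1 := by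
  -- The projective form with first argument 1 has decreasing exponents, so its determinant is the
  -- product of z_i - z_j over i < j with no sign to correct.
  have hdet : ∀ z : Fin m → K, (Matrix.projVandermonde 1 z).det =
      ∏ i, ∏ j ∈ Ioi i, (z i - z j) := by
    intro z
    rw [Matrix.det_projVandermonde]
    simp
  have hne : ∏ i, ∏ j ∈ Ioi i, (y i - y j) ≠ 0 := by
    refine Finset.prod_ne_zero_iff.mpr fun i _ => Finset.prod_ne_zero_iff.mpr fun j hj => ?_
    exact sub_ne_zero.mpr fun e => (Finset.mem_Ioi.mp hj).ne (hy e)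
  -- Each summand is a signed monomial over the common Vandermonde denominator, so the numerators
  -- add up to the Leibniz expansion of that same determinant.
  have hterm : ∀ τ : Equiv.Perm (Fin m), ∏ i, ∏ j ∈ Ioi i, 1 / (1 - y (τ j) / y (τ i)) =
      ((Equiv.Perm.sign τ : ℤ) : K) * (∏ i, y (τ i) ^ (Fin.rev i : ℕ)) /
        ∏ i, ∏ j ∈ Ioi i, (y i - y j) := by
    intro τ
    have h1 : ∏ i, ∏ j ∈ Ioi i, (y (τ i) - y (τ j)) =
        ((Equiv.Perm.sign τ : ℤ) : K) * ∏ i, ∏ j ∈ Ioi i, (y i - y j) := by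
      have e := hdet fun i => y (τ i)
      rw [← e, ← hdet y, ← Matrix.det_permute]
      rfl
    have h2 : ∏ i, ∏ j ∈ Ioi i, 1 / (1 - y (τ j) / y (τ i)) =
        (∏ i, y (τ i) ^ (Fin.rev i : ℕ)) / ∏ i, ∏ j ∈ Ioi i, (y (τ i) - y (τ j)) := by
      rw [← Finset.prod_div_distrib]
      refine Finset.prod_congr rfl fun i _ => ?_
      have : (Fin.rev i : ℕ) = (Ioi i).card := by simp [Fin.val_rev]; omega
      rw [this, ← Finset.prod_const, ← Finset.prod_div_distrib]
      refine Finset.prod_congr rfl fun j hj => ?_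
      have h3 := h0 (τ i)
      have h4 : y (τ i) - y (τ j) ≠ 0 := sub_ne_zero.mpr fun e =>
        (Finset.mem_Ioi.mp hj).ne (τ.injective (hy e))
      rw [one_sub_div h3, one_div_div]
    have h5 : ((Equiv.Perm.sign τ : ℤ) : K) * ((Equiv.Perm.sign τ : ℤ) : K) = 1 := by
      rw [← Int.cast_mul, ← Units.val_mul, Int.units_mul_self]
      simp
    have h6 : ((Equiv.Perm.sign τ : ℤ) : K) ≠ 0 := left_ne_zero_of_mul_eq_one h5
    rw [h2, h1, div_eq_div_iff (mul_ne_zero h6 hne) hne]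
    linear_combination -(∏ i, y (τ i) ^ (Fin.rev i : ℕ)) * (∏ i, ∏ j ∈ Ioi i, (y i - y j)) * h5
  rw [Finset.sum_congr rfl fun τ _ => hterm τ, ← Finset.sum_div, div_eq_one_iff_eq hne, ← hdet,
    Matrix.det_apply]
  refine Finset.sum_congr rfl fun τ _ => ?_
  simp [Matrix.projVandermonde, Matrix.rectVandermonde, Units.smul_def]

variable {n : ℕ}

/-- The variable `x_i` in the field of fractions. -/
noncomputable def fracVar (i : Fin n) : FractionRing (MvPolynomial (Fin n) ℚ) :=
  algebraMap (MvPolynomial (Fin n) ℚ) _ (MvPolynomial.X i)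

theorem fracVar_injective : Function.Injective (fracVar (n := n)) := fun _ _ e =>
  MvPolynomial.X_injective (IsFractionRing.injective _ (FractionRing (MvPolynomial (Fin n) ℚ)) e)

theorem fracVar_ne_zero (i : Fin n) : fracVar i ≠ 0 := fun e =>
  MvPolynomial.X_ne_zero (R := ℚ) i
    ((IsFractionRing.to_map_eq_zero_iff (K := FractionRing (MvPolynomial (Fin n) ℚ))).mp e)

open Classical in
/-- The permutations that fix the first `k` elements. -/
noncomputable def permsFixing (k n : ℕ) : Finset (Equiv.Perm (Fin n)) :=
  {σ : Equiv.Perm (Fin n) | ∀ i : Fin n, (i : ℕ) < k → σ i = i}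

noncomputable def pairsAbove (k n : ℕ) : Finset (Fin n × Fin n) :=
  {p : Fin n × Fin n | k ≤ (p.1 : ℕ) ∧ p.1 < p.2}

noncomputable def weylWeight (k : ℕ) (σ : Equiv.Perm (Fin n)) :
    FractionRing (MvPolynomial (Fin n) ℚ) :=
  ∏ p ∈ pairsAbove k n, 1 / (1 - fracVar (σ p.2) / fracVar (σ p.1))

/-- The partial Weyl symmetrizer with values in the field of fractions. -/
noncomputable def weylTotal (k : ℕ) (f : MvPolynomial (Fin n) ℚ) :
    FractionRing (MvPolynomial (Fin n) ℚ) :=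
  ∑ σ ∈ permsFixing k n, algebraMap (MvPolynomial (Fin n) ℚ) _ (MvPolynomial.rename σ f) *
    weylWeight k σ

theorem weylSymFin_eq_of_weylTotal_eq {k : ℕ} {f g : MvPolynomial (Fin n) ℚ}
    (h : weylTotal k f = algebraMap (MvPolynomial (Fin n) ℚ) _ g) : weylSymFin k n f = g := by
  have hex : ∃ g : MvPolynomial (Fin n) ℚ,
      algebraMap (MvPolynomial (Fin n) ℚ) _ g = weylTotal k f := ⟨g, h.symm⟩
  have : weylSymFin k n f = hex.choose := dif_pos hex
  rw [this]
  exact IsFractionRing.injective _ (FractionRing (MvPolynomial (Fin n) ℚ))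
    (hex.choose_spec.trans h)

/-- Permutations fixing the first `k` letters are the permutations of the remaining ones, so this is
the denominator formula in the last `n - k` variables. -/
theorem sum_weylWeight {k : ℕ} (hk : k ≤ n) : ∑ σ ∈ permsFixing k n, weylWeight k σ = 1 := by
  obtain ⟨m, rfl⟩ := Nat.exists_eq_add_of_le hk
  let f : Fin m ≃ {i : Fin (k + m) // k ≤ (i : ℕ)} :=
    { toFun := fun i => ⟨Fin.natAdd k i, by simp⟩
      invFun := fun i => ⟨i.1 - k, by have := i.1.2; have := i.2; omega⟩
      left_inv := fun i => by simp
      right_inv := fun i => by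
        have := i.2
        ext
        simp
        omega }
  let E := f.permCongr.trans (Equiv.Perm.subtypeEquivSubtypePerm fun i : Fin (k + m) => k ≤ (i : ℕ))
  have hE : ∀ τ i, (E τ).1 (Fin.natAdd k i) = Fin.natAdd k (τ i) := by
    intro τ i
    have := Equiv.Perm.subtypeEquivSubtypePerm_apply_of_mem (f.permCongr τ)
      (show k ≤ (Fin.natAdd k i : ℕ) by simp)
    refine this.trans ?_
    have e : (⟨Fin.natAdd k i, by simp⟩ : {i : Fin (k + m) // k ≤ (i : ℕ)}) = f i := rfl
    rw [e, Equiv.permCongr_apply, Equiv.symm_apply_apply]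
    rfl
  rw [Finset.sum_subtype (p := fun σ : Equiv.Perm (Fin (k + m)) => ∀ a : Fin (k + m), ¬ k ≤ (a : ℕ) → σ a = a) _ (by
    intro σ; simp [permsFixing]), ← Equiv.sum_comp E]
  rw [← sum_perm_prod_one_sub_inv (fun i : Fin m => fracVar (Fin.natAdd k i))
    (fun i j e => Fin.natAdd_injective _ _ (fracVar_injective e)) (fun i => fracVar_ne_zero _)]
  refine Finset.sum_congr rfl fun τ _ => ?_
  rw [weylWeight, Finset.prod_sigma']
  refine (Finset.prod_bij (fun q _ => (Fin.natAdd k q.1, Fin.natAdd k q.2)) ?_ ?_ ?_ ?_).symm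
  · intro q hq
    simp only [mem_sigma, mem_univ, mem_Ioi, true_and] at hq
    simpa [pairsAbove] using hq
  · rintro ⟨q1, q2⟩ _ ⟨r1, r2⟩ _ e
    simpa using e
  · rintro ⟨p1, p2⟩ hp
    simp only [pairsAbove, mem_filter, mem_univ, true_and] at hp
    have h12 := Fin.lt_def.mp hp.2
    refine ⟨⟨⟨p1 - k, by omega⟩, ⟨p2 - k, by omega⟩⟩, ?_, ?_⟩
    · simp only [mem_sigma, mem_univ, mem_Ioi, true_and, Fin.lt_def]
      omega
    · simp only [Prod.mk.injEq, Fin.ext_iff, Fin.val_natAdd]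
      omega
  · intro q _
    rw [hE, hE]

theorem weylTotal_of_invariant {k : ℕ} (hk : k ≤ n) {f : MvPolynomial (Fin n) ℚ}
    (hf : ∀ σ ∈ permsFixing k n, MvPolynomial.rename σ f = f) :
    weylTotal k f = algebraMap (MvPolynomial (Fin n) ℚ) _ f := by
  rw [weylTotal, Finset.sum_congr rfl fun σ hσ => by rw [hf σ hσ], ← Finset.mul_sum,
    sum_weylWeight hk, mul_one]

theorem mul_swap_mem_permsFixing {k : ℕ} {i j : Fin n} (hi : k ≤ (i : ℕ)) (hj : k ≤ (j : ℕ))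
    {σ : Equiv.Perm (Fin n)} (hσ : σ ∈ permsFixing k n) :
    σ * Equiv.swap i j ∈ permsFixing k n := by
  simp only [permsFixing, mem_filter, mem_univ, true_and] at hσ ⊢
  intro m hm
  rw [Equiv.Perm.mul_apply, Equiv.swap_apply_of_ne_of_ne, hσ m hm] <;> rintro rfl <;> omega

/-- The part of the weight that does not change under the transposition of `i` and `i + 1`. -/
theorem exists_weylWeight_swap {k : ℕ} {i j : Fin n} (hi : k ≤ (i : ℕ)) (hij : (j : ℕ) = i + 1)
    (σ : Equiv.Perm (Fin n)) : ∃ Q, weylWeight k σ =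
      Q * (fracVar (σ i) / (fracVar (σ i) - fracVar (σ j))) ∧
      weylWeight k (σ * Equiv.swap i j) =
        Q * (fracVar (σ j) / (fracVar (σ j) - fracVar (σ i))) := by
  have hmem : (i, j) ∈ pairsAbove k n := by
    simp only [pairsAbove, mem_filter, mem_univ, true_and, Fin.lt_def]
    omega
  have hfac : ∀ u v : Fin n, 1 / (1 - fracVar u / fracVar v) =
      fracVar v / (fracVar v - fracVar u) := fun u v => by
    rw [one_sub_div (fracVar_ne_zero v), one_div_div]
  refine ⟨∏ p ∈ (pairsAbove k n).erase (i, j), 1 / (1 - fracVar (σ p.2) / fracVar (σ p.1)), ?_, ?_⟩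
  · rw [weylWeight, ← Finset.prod_erase_mul _ _ hmem, hfac]
  · rw [weylWeight, ← Finset.prod_erase_mul _ _ hmem, hfac, Equiv.Perm.mul_apply,
      Equiv.Perm.mul_apply, Equiv.swap_apply_left, Equiv.swap_apply_right]
    congr 1
    have hval : ∀ m : Fin n, ((Equiv.swap i j m : Fin n) : ℕ) =
        if (m : ℕ) = i then (j : ℕ) else if (m : ℕ) = j then (i : ℕ) else m := by
      intro m
      rw [Equiv.swap_apply_def]
      simp only [Fin.ext_iff]
      split_ifs <;> rfl
    have hmap : ∀ p ∈ (pairsAbove k n).erase (i, j),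
        (Equiv.swap i j p.1, Equiv.swap i j p.2) ∈ (pairsAbove k n).erase (i, j) := by
      rintro ⟨p1, p2⟩ hp
      simp only [pairsAbove, mem_erase, mem_filter, mem_univ, true_and, Fin.lt_def, ne_eq,
        Prod.mk.injEq, Fin.ext_iff, hval] at hp ⊢
      split_ifs <;> omega
    refine Finset.prod_bij' (fun p _ => (Equiv.swap i j p.1, Equiv.swap i j p.2))
      (fun p _ => (Equiv.swap i j p.1, Equiv.swap i j p.2)) hmap hmap ?_ ?_ ?_
    · intro p _
      simp
    · intro p _
      simp
    · intro p _
      simp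

/-- Pairing σ with σ s, where s is the transposition of `i` and `j`, the two summands for a
polynomial g combine to a common factor times σ applied to the isobaric difference of g. So the
total depends on g only through that difference, which is idempotent. -/
theorem weylTotal_isobaric {k : ℕ} {i j : Fin n} (hi : k ≤ (i : ℕ)) (hij : (j : ℕ) = i + 1)
    (f : MvPolynomial (Fin n) ℚ) : weylTotal k (isobaric i j f) = weylTotal k f := by
  have hne : i ≠ j := Fin.ne_of_val_ne (by omega)
  have hpair : ∀ g : MvPolynomial (Fin n) ℚ, weylTotal k g + weylTotal k g =
      ∑ σ ∈ permsFixing k n, (algebraMap (MvPolynomial (Fin n) ℚ) _ (MvPolynomial.rename σ g) *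
        weylWeight k σ + algebraMap (MvPolynomial (Fin n) ℚ) _
          (MvPolynomial.rename (σ * Equiv.swap i j) g) * weylWeight k (σ * Equiv.swap i j)) := by
    intro g
    rw [Finset.sum_add_distrib]
    congr 1
    refine Finset.sum_bij' (fun σ _ => σ * Equiv.swap i j) (fun σ _ => σ * Equiv.swap i j)
      (fun σ hσ => mul_swap_mem_permsFixing hi (by omega) hσ)
      (fun σ hσ => mul_swap_mem_permsFixing hi (by omega) hσ) ?_ ?_ ?_
    · intro σ _; simp [mul_assoc]
    · intro σ _; simp [mul_assoc]
    · intro σ _; simp [mul_assoc]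
  -- The two weights differ only in the factor of the pair `(i, j)`, and these two factors are the
  -- coefficients in the definition of ξ, moved by σ.
  have hterm : ∀ (σ : Equiv.Perm (Fin n)) (Q : FractionRing (MvPolynomial (Fin n) ℚ))
      (g : MvPolynomial (Fin n) ℚ),
      algebraMap (MvPolynomial (Fin n) ℚ) _ (MvPolynomial.rename σ g) *
        (Q * (fracVar (σ i) / (fracVar (σ i) - fracVar (σ j)))) +
      algebraMap (MvPolynomial (Fin n) ℚ) _ (MvPolynomial.rename (σ * Equiv.swap i j) g) *
        (Q * (fracVar (σ j) / (fracVar (σ j) - fracVar (σ i)))) =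
      Q * algebraMap (MvPolynomial (Fin n) ℚ) _ (MvPolynomial.rename σ (isobaric i j g)) := by
    intro σ Q g
    have h1 := congrArg (fun p => algebraMap (MvPolynomial (Fin n) ℚ)
      (FractionRing (MvPolynomial (Fin n) ℚ)) (MvPolynomial.rename σ p)) (isobaric_spec i j g)
    simp only [map_mul, map_sub, MvPolynomial.rename_X, swapVars, MvPolynomial.rename_rename] at h1
    change (fracVar (σ i) - fracVar (σ j)) * _ = fracVar (σ i) * _ - fracVar (σ j) * _ at h1
    rw [Equiv.Perm.coe_mul]
    have h2 : fracVar (σ i) - fracVar (σ j) ≠ 0 := sub_ne_zero.mpr fun e =>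
      hne (σ.injective (fracVar_injective e))
    have h3 : fracVar (σ j) - fracVar (σ i) ≠ 0 := sub_ne_zero.mpr fun e =>
      hne (σ.injective (fracVar_injective e)).symm
    field_simp
    linear_combination (-Q * (fracVar (σ j) - fracVar (σ i))) * h1
  have h2 : weylTotal k (isobaric i j f) + weylTotal k (isobaric i j f) =
      weylTotal k f + weylTotal k f := by
    rw [hpair, hpair]
    refine Finset.sum_congr rfl fun σ _ => ?_
    obtain ⟨Q, e1, e2⟩ := exists_weylWeight_swap hi hij σ
    rw [e1, e2, hterm, hterm, isobaric_isobaric hne]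
  rw [← two_mul, ← two_mul] at h2
  exact mul_left_cancel₀ two_ne_zero h2

end Weyl

/-! ### Symmetries of key polynomials -/

section KeySymmetry

variable {n : ℕ}

/-- By the filling formula with all positions as columns, the `le` exchange relation writes the key
polynomial as ξ of something, and ξ is idempotent. This also covers equal parts, which the recursion
of key polynomials does not mention. -/
theorem isobaric_keyPoly (γ : Fin n → ℕ) (i j : Fin n) (hij : (j : ℕ) = i + 1) (h : γ i ≤ γ j) :
    isobaric i j (keyPoly γ) = keyPoly γ := by
  have hne : i ≠ j := Fin.ne_of_val_ne (by omega)
  set b : Fin n → ℕ := fun k => k + 1 with hb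
  -- Only an upper bound for the parts is needed.
  set r := ∑ k, γ k
  have hr : ∀ k, γ k + 1 ≤ r + 1 := fun k =>
    Nat.succ_le_succ (Finset.single_le_sum (fun _ _ => Nat.zero_le _) (Finset.mem_univ k))
  have hB : BaseOK (fun k => γ k + 1) b :=
    ⟨fun k => by simp [hb], fun k l e => Or.inr (Fin.ext (by simpa [hb] using e))⟩
  have hK := rowGen_eq_keyPoly r (fun k => γ k + 1) (fun k => by omega) hr _ γ rfl b hB
    (fun k => k.2) (fun k l hkl _ => Nat.succ_lt_succ hkl) (fun m =>
      ⟨fun k hk => by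
        obtain rfl : k = m := Fin.ext (by simpa [hb] using hk)
        rfl, fun hk => absurd rfl (hk m)⟩)
  have hE := (rowGen_exchangeRel (x := lblVar n) (n := n) (a := i + 1) (by omega) (by omega)
    (isIsobaric_lblVar hne hij) r (fun k => γ k + 1) hr).le b hB (by
      intro p hp
      obtain rfl : p = i := Fin.ext (by simpa [hb] using hp)
      exact ⟨j, Fin.lt_def.mpr (by omega), by omega, by simp [hb, hij]⟩)
  rw [← hK, hE]
  exact isobaric_isobaric hne _

theorem keyPoly_comp_swap (γ : Fin n → ℕ) (i j : Fin n) (hij : (j : ℕ) = i + 1) (h : γ j ≤ γ i) :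
    keyPoly (γ ∘ Equiv.swap i j) = isobaric i j (keyPoly γ) := by
  rcases h.lt_or_eq with h | h
  · exact keyPoly_swap γ i j hij h
  · rw [isobaric_keyPoly γ i j hij h.ge]
    congr 1
    funext k
    rw [Function.comp_apply, Equiv.swap_apply_def]
    split_ifs with h1 h2
    · rw [h1, h]
    · rw [h2, h]
    · rfl

/-- Isobaric differences are symmetric in their two variables, so `f` is invariant under adjacent
transpositions beyond `k`, and these generate the permutations fixing the first `k` letters. -/
theorem rename_eq_of_isobaric_eq {k : ℕ} {f : MvPolynomial (Fin n) ℚ}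
    (hf : ∀ i j : Fin n, k ≤ (i : ℕ) → (j : ℕ) = i + 1 → isobaric i j f = f) :
    ∀ σ ∈ permsFixing k n, MvPolynomial.rename σ f = f := by
  have hadj : ∀ i j : Fin n, k ≤ (i : ℕ) → (j : ℕ) = i + 1 →
      MvPolynomial.rename (Equiv.swap i j) f = f := by
    intro i j hi hij
    have := swapVars_isobaric (Fin.ne_of_val_ne (by omega) : i ≠ j) f
    rwa [hf i j hi hij] at this
  have hlt : ∀ (t : ℕ) (i j : Fin n), k ≤ (i : ℕ) → (j : ℕ) = i + 1 + t →
      MvPolynomial.rename (Equiv.swap i j) f = f := by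
    intro t
    induction t with
    | zero => exact hadj
    | succ t ih =>
      intro i j hi hij
      let l : Fin n := ⟨i + 1 + t, by omega⟩
      -- Conjugation by the adjacent transposition of `l` and `j` shortens the distance by one.
      have e : Equiv.swap i j = Equiv.swap l j * Equiv.swap i l * Equiv.swap l j := by
        have := Equiv.swap_mul_swap_mul_swap (x := i) (y := l) (z := j)
          (Fin.ne_of_val_ne (by simp [l]; omega)) (Fin.ne_of_val_ne (by omega))
        rw [this, Equiv.swap_comm]
      rw [e, Equiv.Perm.coe_mul, Equiv.Perm.coe_mul, Function.comp_assoc,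
        ← MvPolynomial.rename_rename, ← MvPolynomial.rename_rename,
        hadj l j (by simp [l]; omega) (by simp [l]; omega), ih i l hi rfl,
        hadj l j (by simp [l]; omega) (by simp [l]; omega)]
  have hne : ∀ i j : Fin n, k ≤ (i : ℕ) → k ≤ (j : ℕ) → i ≠ j →
      MvPolynomial.rename (Equiv.swap i j) f = f := by
    intro i j hi hj hij
    rcases lt_or_gt_of_ne hij with h | h <;> rw [Fin.lt_def] at h
    · exact hlt (j - i - 1) i j hi (by omega)
    · rw [Equiv.swap_comm]
      exact hlt (i - j - 1) j i hj (by omega)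
  intro σ
  induction hc : σ.support.card using Nat.strong_induction_on generalizing σ with
  | _ c ih =>
  intro hσ
  by_cases h1 : σ = 1
  · subst h1
    exact MvPolynomial.rename_id_apply f
  · obtain ⟨i, hi⟩ : ∃ i, σ i ≠ i := by
      by_contra hcon
      push Not at hcon
      exact h1 (Equiv.ext hcon)
    have hfix : ∀ m : Fin n, (m : ℕ) < k → σ m = m := by
      simpa [permsFixing] using hσ
    have hki : k ≤ (i : ℕ) := by
      by_contra hcon
      exact hi (hfix i (by omega))
    have hkσ : k ≤ (σ i : ℕ) := by
      by_contra hcon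
      exact hi (σ.injective (hfix _ (by omega)))
    have hlt := Equiv.Perm.card_support_swap_mul hi
    -- This product still fixes the first `k` letters and has smaller support than σ.
    have hmem : Equiv.swap i (σ i) * σ ∈ permsFixing k n := by
      simp only [permsFixing, mem_filter, mem_univ, true_and]
      intro m hm
      rw [Equiv.Perm.mul_apply, hfix m hm, Equiv.swap_apply_of_ne_of_ne] <;> rintro rfl <;> omega
    have := ih _ (hc ▸ hlt) _ rfl hmem
    have e : σ = Equiv.swap i (σ i) * (Equiv.swap i (σ i) * σ) := by
      rw [← mul_assoc, Equiv.swap_mul_self, one_mul]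
    rw [e, Equiv.Perm.coe_mul, ← MvPolynomial.rename_rename, this]
    exact hne _ _ hki hkσ (Ne.symm hi)

end KeySymmetry

/-! ### Symmetrizing key polynomials of padded shapes -/

section Shapes

theorem getD_le_getD {ν : List ℕ} (hν : ν.Pairwise fun a b => b ≤ a) {i j : ℕ} (hij : i ≤ j) :
    ν.getD j 0 ≤ ν.getD i 0 := by
  rcases hij.eq_or_lt with rfl | hij
  · exact le_rfl
  · by_cases hj : j < ν.length
    · rw [List.getD_eq_getElem _ _ hj, List.getD_eq_getElem _ _ (hij.trans hj)]
      exact List.pairwise_iff_getElem.mp hν i j _ _ hij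
    · rw [List.getD_eq_default _ _ (by omega)]
      exact Nat.zero_le _

/-- The composition `μ * (0, …, 0) * rev(ν)` of length `n`. -/
def padShape (μ ν : List ℕ) (n : ℕ) (i : Fin n) : ℕ :=
  if (i : ℕ) < μ.length then μ.getD i 0 else ν.getD (n - 1 - i) 0

theorem padShape_le (μ : List ℕ) {ν : List ℕ} (hν : ν.Pairwise fun a b => b ≤ a) {n : ℕ}
    {i j : Fin n} (hi : μ.length ≤ i) (hij : i ≤ j) : padShape μ ν n i ≤ padShape μ ν n j := by
  rw [Fin.le_def] at hij
  rw [padShape, padShape, if_neg (by omega), if_neg (by omega)]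
  exact getD_le_getD hν (by omega)

/-- Since `a` is at least every part of ν and every padding zero, each move of `a` one step to the
right is an application of some ξ_i, which the symmetrizer absorbs. Once `a` is last, the tail is
weakly increasing and the symmetrizer acts as the identity. -/
theorem weylSymFin_keyPoly_padShape (μ : List ℕ) (a : ℕ) {ν : List ℕ}
    (hν : (a :: ν).Pairwise fun a b => b ≤ a) {n : ℕ} (hn : μ.length + 1 + ν.length ≤ n) :
    weylSymFin μ.length n (keyPoly (padShape (μ ++ [a]) ν n)) =
      keyPoly (padShape μ (a :: ν) n) := by
  set r := μ.length
  -- The intermediate composition with `a` at position `j`: tail entries it has already passed are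
  -- shifted one place to the left, hence the index `n - 2 - i`.
  let mv : ℕ → Fin n → ℕ := fun j i => if (i : ℕ) < r then μ.getD i 0 else
    if (i : ℕ) < j then ν.getD (n - 2 - i) 0 else if (i : ℕ) = j then a else ν.getD (n - 1 - i) 0
  have mvA : ∀ j (i : Fin n), r ≤ i → (i : ℕ) < j → mv j i = ν.getD (n - 2 - i) 0 :=
    fun j i h1 h2 => by simp only [mv]; rw [if_neg (by omega), if_pos h2]
  have mvB : ∀ j (i : Fin n), r ≤ i → (i : ℕ) = j → mv j i = a :=
    fun j i h1 h2 => by simp only [mv]; rw [if_neg (by omega), if_neg (by omega), if_pos h2]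
  have mvC : ∀ j (i : Fin n), r ≤ i → j < (i : ℕ) → mv j i = ν.getD (n - 1 - i) 0 :=
    fun j i h1 h2 => by
      simp only [mv]; rw [if_neg (by omega), if_neg (by omega), if_neg (by omega)]
  have hstart : padShape (μ ++ [a]) ν n = mv r := by
    funext i
    simp only [padShape, mv, List.length_append, List.length_singleton]
    rcases lt_trichotomy (i : ℕ) r with h | h | h
    · rw [if_pos (by omega), if_pos h, List.getD_append _ _ _ _ h]
    · rw [if_pos (by omega), if_neg (by omega), if_neg (by omega), if_pos h,
        List.getD_append_right _ _ _ _ h.ge, h]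
      simp [r]
    · rw [if_neg (by omega), if_neg (by omega), if_neg (by omega), if_neg (by omega)]
  have hend : padShape μ (a :: ν) n = mv (n - 1) := by
    funext i
    have := i.2
    simp only [padShape, mv]
    split_ifs with h1 h2 h3
    · rfl
    · rw [show n - 1 - (i : ℕ) = n - 2 - i + 1 by omega, List.getD_cons_succ]
    · rw [show n - 1 - (i : ℕ) = 0 by omega, List.getD_cons_zero]
    · omega
  have hle : ∀ i, ν.getD i 0 ≤ a := fun i => by
    have := getD_le_getD hν (Nat.zero_le (i + 1))
    rwa [List.getD_cons_succ, List.getD_cons_zero] at this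
  have hstep : ∀ t, r + t + 1 ≤ n →
      weylTotal r (keyPoly (mv (r + t))) = weylTotal r (keyPoly (mv r)) := by
    intro t
    induction t with
    | zero => intro _; rfl
    | succ t ih =>
      intro ht
      have hi : r + t < n := by omega
      have hj : r + t + 1 < n := by omega
      have e : mv (r + (t + 1)) = mv (r + t) ∘ Equiv.swap ⟨r + t, hi⟩ ⟨r + t + 1, hj⟩ := by
        funext i
        rw [Function.comp_apply, Equiv.swap_apply_def]
        simp only [Fin.ext_iff]
        split_ifs with h1 h2
        · rw [mvA _ i (by omega) (by omega), mvC _ ⟨r + t + 1, hj⟩ (by simp; omega) (by simp)]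
          congr 1
          simp only
          omega
        · rw [mvB _ i (by omega) (by omega), mvB _ ⟨r + t, hi⟩ (by simp) rfl]
        · simp only [mv]
          split_ifs <;> first | rfl | omega
      rw [e, keyPoly_comp_swap _ ⟨r + t, hi⟩ ⟨r + t + 1, hj⟩ rfl, weylTotal_isobaric (by simp) rfl,
        ih (by omega)]
      rw [mvC _ ⟨r + t + 1, hj⟩ (by simp; omega) (by simp), mvB _ ⟨r + t, hi⟩ (by simp) rfl]
      exact hle _
  apply weylSymFin_eq_of_weylTotal_eq
  rw [hstart, ← hstep (n - 1 - r) (by omega), show r + (n - 1 - r) = n - 1 by omega, ← hend]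
  refine weylTotal_of_invariant (by omega) (rename_eq_of_isobaric_eq fun i j hi hij => ?_)
  exact isobaric_keyPoly _ i j hij (padShape_le μ hν hi (Fin.le_def.mpr (by omega)))

end Shapes

/-! ### Stability when the last variable is set to zero -/

section Stability

variable {n : ℕ}

theorem isobaric_rename_castSucc {i j : Fin n} (hij : i ≠ j) (f : MvPolynomial (Fin n) ℚ) :
    isobaric i.castSucc j.castSucc (MvPolynomial.rename Fin.castSucc f) =
      MvPolynomial.rename Fin.castSucc (isobaric i j f) := by
  have hne : i.castSucc ≠ j.castSucc := fun h => hij (Fin.castSucc_injective n h)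
  apply mul_left_cancel₀ (X_sub_X_ne_zero hne)
  have h := congrArg (MvPolynomial.rename Fin.castSucc) (isobaric_spec i j f)
  simp only [map_mul, map_sub, MvPolynomial.rename_X] at h
  rw [isobaric_spec, h]
  congr 2
  simp only [swapVars, MvPolynomial.rename_rename]
  rw [Function.Injective.swap_comp (Fin.castSucc_injective n)]

/-- The substitution `x_{n+1} = 0`. -/
noncomputable def dropLast (n : ℕ) :
    MvPolynomial (Fin (n + 1)) ℚ →ₐ[ℚ] MvPolynomial (Fin n) ℚ :=
  MvPolynomial.killCompl (Fin.castSucc_injective n)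

theorem dropLast_rename (f : MvPolynomial (Fin n) ℚ) :
    dropLast n (MvPolynomial.rename Fin.castSucc f) = f :=
  MvPolynomial.killCompl_rename_app _ f

theorem dropLast_X_castSucc (i : Fin n) :
    dropLast n (MvPolynomial.X i.castSucc) = MvPolynomial.X i := by
  rw [← MvPolynomial.rename_X, dropLast_rename]

theorem dropLast_X_last : dropLast n (MvPolynomial.X (Fin.last n)) = 0 := by
  rw [dropLast, MvPolynomial.killCompl, MvPolynomial.aeval_X, dif_neg]
  rintro ⟨i, hi⟩
  exact absurd hi i.castSucc_ne_last

theorem dropLast_swapVars (i j : Fin n) (f : MvPolynomial (Fin (n + 1)) ℚ) :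
    dropLast n (swapVars i.castSucc j.castSucc f) = swapVars i j (dropLast n f) := by
  have : (dropLast n).comp (MvPolynomial.rename (Equiv.swap i.castSucc j.castSucc)) =
      (MvPolynomial.rename (Equiv.swap i j)).comp (dropLast n) := by
    apply MvPolynomial.algHom_ext
    intro k
    simp only [AlgHom.comp_apply, MvPolynomial.rename_X]
    induction k using Fin.lastCases with
    | last =>
      rw [Equiv.swap_apply_of_ne_of_ne i.castSucc_ne_last.symm j.castSucc_ne_last.symm,
        dropLast_X_last, map_zero]
    | cast k =>
      have := congrFun (Function.Injective.swap_comp (Fin.castSucc_injective n) i j) k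
      simp only [Function.comp_apply] at this
      rw [this, dropLast_X_castSucc, dropLast_X_castSucc, MvPolynomial.rename_X]
  exact DFunLike.congr_fun this f

theorem dropLast_isobaric {i j : Fin n} (hij : i ≠ j) (f : MvPolynomial (Fin (n + 1)) ℚ) :
    dropLast n (isobaric i.castSucc j.castSucc f) = isobaric i j (dropLast n f) := by
  apply mul_left_cancel₀ (X_sub_X_ne_zero hij)
  have h := congrArg (dropLast n) (isobaric_spec i.castSucc j.castSucc f)
  simp only [map_mul, map_sub, dropLast_X_castSucc, dropLast_swapVars] at h
  rw [h, isobaric_spec]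

/-- At x_{n+1} = 0 the defining identity of ξ_n f collapses to x_n ξ_n f = x_n f. -/
theorem dropLast_isobaric_last (i : Fin n) (f : MvPolynomial (Fin (n + 1)) ℚ) :
    dropLast n (isobaric i.castSucc (Fin.last n) f) = dropLast n f := by
  have h := congrArg (dropLast n) (isobaric_spec i.castSucc (Fin.last n) f)
  simp only [map_mul, map_sub, dropLast_X_castSucc, dropLast_X_last, sub_zero, zero_mul] at h
  exact mul_left_cancel₀ (MvPolynomial.X_ne_zero i) h

theorem coeff_dropLast (d : Fin n →₀ ℕ) (f : MvPolynomial (Fin (n + 1)) ℚ) :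
    MvPolynomial.coeff d (dropLast n f) =
      MvPolynomial.coeff (d.mapDomain Fin.castSucc) f :=
  MvPolynomial.coeff_killCompl _

theorem antitone_of_no_ascent (γ : Fin n → ℕ)
    (h : ∀ i j : Fin n, (j : ℕ) = i + 1 → γ j ≤ γ i) : Antitone γ := by
  have : ∀ (t : ℕ) (i j : Fin n), (j : ℕ) = i + t → γ j ≤ γ i := by
    intro t
    induction t with
    | zero => intro i j hij; rw [Fin.ext hij]
    | succ t ih =>
      intro i j hij
      exact (h ⟨i + t, by omega⟩ j (by simp; omega)).trans (ih _ _ rfl)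
  intro i j hij
  rw [Fin.le_def] at hij
  exact this (j - i) i j (by omega)

/-- A trailing zero creates no ascent, so both key polynomials arise from the same sequence of
operators in the first `n` variables. -/
theorem keyPoly_snoc_zero (w : ℕ) : ∀ γ : Fin n → ℕ, ∑ k : Fin n, (k : ℕ) * γ k = w →
    keyPoly (Fin.snoc γ 0 : Fin (n + 1) → ℕ) = MvPolynomial.rename Fin.castSucc (keyPoly γ) := by
  induction w using Nat.strong_induction_on with
  | _ w ih =>
  intro γ hw
  by_cases hex : ∃ i j : Fin n, (j : ℕ) = i + 1 ∧ γ i < γ j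
  · obtain ⟨i, j, hij, hlt⟩ := hex
    have hlt' := weight_swap_lt γ i j (Fin.lt_def.mpr (by omega)) hlt
    rw [keyPoly_ascent _ γ rfl i j hij hlt,
      keyPoly_ascent _ (Fin.snoc γ 0 : Fin (n + 1) → ℕ) rfl i.castSucc j.castSucc
        (by simpa using hij) (by simpa using hlt),
      ← isobaric_rename_castSucc (Fin.ne_of_val_ne (by omega)), ← ih _ (hw ▸ hlt') _ rfl]
    congr 2
    funext k
    induction k using Fin.lastCases with
    | last =>
      rw [Function.comp_apply, Equiv.swap_apply_of_ne_of_ne i.castSucc_ne_last.symm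
        j.castSucc_ne_last.symm]
      simp
    | cast k =>
      have := congrFun (Function.Injective.swap_comp (Fin.castSucc_injective n) i j) k
      simp only [Function.comp_apply] at this
      rw [Function.comp_apply, this]
      simp
  · push Not at hex
    rw [keyPoly_of_antitone γ (antitone_of_no_ascent γ fun i j hij => hex i j hij),
      keyPoly_of_antitone, Fin.prod_univ_castSucc]
    · simp
    · apply antitone_of_no_ascent
      intro i j hij
      induction j using Fin.lastCases with
      | last => simp
      | cast j =>
        obtain ⟨i, rfl⟩ : ∃ i' : Fin n, i = i'.castSucc :=
          ⟨⟨i, by have := j.2; simp at hij; omega⟩, rfl⟩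
        simpa using hex i j (by simpa using hij)

/-- The shape for `n + 1` is obtained from the shape for `n` followed by a zero by moving that zero
left to just after μ. Each move is some ξ_i. The one at the last variable becomes trivial when that
variable vanishes, and the others fix the key polynomial for `n`, whose tail is weakly increasing.
-/
theorem dropLast_keyPoly_padShape (μ : List ℕ) {ν : List ℕ}
    (hν : ν.Pairwise fun a b => b ≤ a) (hn : μ.length + ν.length ≤ n) :
    dropLast n (keyPoly (padShape μ ν (n + 1))) = keyPoly (padShape μ ν n) := by
  let P : ℕ → ℕ := fun i => if i < μ.length then μ.getD i 0 else ν.getD (n - 1 - i) 0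
  -- The shape for `n` with a zero inserted at position `t`; `t = n` appends it, and `t = μ.length`
  -- adds it to the padding.
  let δ : ℕ → Fin (n + 1) → ℕ := fun t i =>
    if (i : ℕ) < t then P i else if (i : ℕ) = t then 0 else P (i - 1)
  have hend : δ n = Fin.snoc (padShape μ ν n) 0 := by
    funext k
    induction k using Fin.lastCases with
    | last => simp [δ]
    | cast k => simp [δ, P, padShape]
  have hstart : δ μ.length = padShape μ ν (n + 1) := by
    funext k
    simp only [δ, P, padShape]
    split_ifs with h1 h2 h3
    · rfl
    · rw [List.getD_eq_default _ _ (by omega)]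
    · omega
    · congr 1
      omega
  have key : ∀ s t, t + s = n → μ.length ≤ t →
      dropLast n (keyPoly (δ t)) = keyPoly (padShape μ ν n) := by
    intro s
    induction s with
    | zero =>
      intro t ht _
      rw [show t = n from ht, hend, keyPoly_snoc_zero _ _ rfl, dropLast_rename]
    | succ s ih =>
      intro t ht hr
      let i : Fin n := ⟨t, by omega⟩
      let j : Fin (n + 1) := ⟨t + 1, by omega⟩
      have e : δ t = δ (t + 1) ∘ Equiv.swap i.castSucc j := by
        funext k
        rw [Function.comp_apply, Equiv.swap_apply_def]
        simp only [Fin.ext_iff]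
        split_ifs with h1 h2
        · have : (k : ℕ) = t := h1
          simp [δ, j, this]
        · have : (k : ℕ) = t + 1 := h2
          simp [δ, i, this]
        · have h1' : (k : ℕ) ≠ t := h1
          have h2' : (k : ℕ) ≠ t + 1 := h2
          simp only [δ]
          split_ifs <;> first | rfl | omega
      have h0 : δ (t + 1) j = 0 := by simp [δ, j]
      rw [e, keyPoly_comp_swap _ i.castSucc j rfl (h0 ▸ Nat.zero_le _)]
      rcases s.eq_zero_or_pos with rfl | hs
      · have : j = Fin.last n := Fin.ext (by simp [j]; omega)
        rw [this, dropLast_isobaric_last, ih (t + 1) (by omega) (by omega)]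
      · obtain ⟨j', hj'⟩ : ∃ j' : Fin n, j = j'.castSucc := ⟨⟨t + 1, by omega⟩, rfl⟩
        have hv : (j' : ℕ) = i + 1 := by
          have := congrArg Fin.val hj'
          simp only [j, Fin.val_castSucc] at this
          simp [← this, i]
        rw [hj', dropLast_isobaric (Fin.ne_of_val_ne (by omega)), ih (t + 1) (by omega) (by omega)]
        exact isobaric_keyPoly _ i j' hv (padShape_le μ hν hr (Fin.le_def.mpr (by omega)))
  rw [← hstart]
  exact key (n - μ.length) _ (by omega) le_rfl

end Stability

/-! ### Coefficients of almost symmetric Schur functions -/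

section Series

variable {n : ℕ}

theorem coeff_toSeries (d : Fin n →₀ ℕ) (f : MvPolynomial (Fin n) ℚ) :
    MvPowerSeries.coeff (d.mapDomain Fin.val) (toSeries f) = MvPolynomial.coeff d f := by
  rw [toSeries, MvPolynomial.coeff_coe,
    MvPolynomial.coeff_rename_mapDomain _ Fin.val_injective]

theorem exists_mapDomain_val {n : ℕ} (e : ℕ →₀ ℕ) (h : ∀ k, e k ≠ 0 → k < n) :
    ∃ d : Fin n →₀ ℕ, d.mapDomain Fin.val = e := by
  refine ⟨e.comapDomain Fin.val Fin.val_injective.injOn, ?_⟩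
  apply Finsupp.mapDomain_comapDomain _ Fin.val_injective
  intro k hk
  exact ⟨⟨k, h k (by simpa using hk)⟩, rfl⟩

theorem toSeries_rename_castSucc (f : MvPolynomial (Fin n) ℚ) :
    toSeries (MvPolynomial.rename Fin.castSucc f) = toSeries f := by
  rw [toSeries, MvPolynomial.rename_rename]
  rfl

theorem restrictVars_eq {f : MvPowerSeries ℕ ℚ} {g : MvPolynomial (Fin n) ℚ}
    (h : ∀ d : Fin n →₀ ℕ, MvPowerSeries.coeff (d.mapDomain Fin.val) f = MvPolynomial.coeff d g) :
    restrictVars n f = g := by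
  have hs : {d : Fin n →₀ ℕ | MvPowerSeries.coeff (d.mapDomain Fin.val) f ≠ 0} = g.support := by
    ext d
    simp [h]
  have hf : {d : Fin n →₀ ℕ | MvPowerSeries.coeff (d.mapDomain Fin.val) f ≠ 0}.Finite :=
    hs ▸ g.support.finite_toSet
  rw [restrictVars, dif_pos hf]
  have : hf.toFinset = g.support := by
    ext d
    simp [h]
  rw [this]
  conv_rhs => rw [g.as_sum]
  exact Finset.sum_congr rfl fun d _ => by rw [h]

theorem coeff_toSeries_padShape_succ (μ : List ℕ) {ν : List ℕ}
    (hν : ν.Pairwise fun a b => b ≤ a) (hn : μ.length + ν.length ≤ n) (e : ℕ →₀ ℕ)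
    (he : ∀ k, e k ≠ 0 → k < n) :
    MvPowerSeries.coeff e (toSeries (keyPoly (padShape μ ν (n + 1)))) =
      MvPowerSeries.coeff e (toSeries (keyPoly (padShape μ ν n))) := by
  obtain ⟨d, rfl⟩ := exists_mapDomain_val e he
  rw [coeff_toSeries, ← dropLast_keyPoly_padShape μ hν hn, coeff_dropLast, ← coeff_toSeries,
    ← Finsupp.mapDomain_comp]
  rfl

theorem coeff_toSeries_padShape_of_le (μ : List ℕ) {ν : List ℕ}
    (hν : ν.Pairwise fun a b => b ≤ a) (hn : μ.length + ν.length ≤ n) (e : ℕ →₀ ℕ)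
    (he : ∀ k, e k ≠ 0 → k < n) {m : ℕ} (hm : n ≤ m) :
    MvPowerSeries.coeff e (toSeries (keyPoly (padShape μ ν m))) =
      MvPowerSeries.coeff e (toSeries (keyPoly (padShape μ ν n))) := by
  induction m, hm using Nat.le_induction with
  | base => rfl
  | succ m hm ih =>
    rw [← ih, coeff_toSeries_padShape_succ μ hν (hn.trans hm) e fun k hk => (he k hk).trans_le hm]

/-- In the variables `x_1, …, x_n`, the almost symmetric Schur function is a key polynomial. -/
theorem coeff_almostSymSchur (ν : List ℕ) : ∀ (μ : List ℕ), (ν.Pairwise fun a b => b ≤ a) →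
    ∀ {n : ℕ}, μ.length + ν.length ≤ n → ∀ e : ℕ →₀ ℕ, (∀ k, e k ≠ 0 → k < n) →
      MvPowerSeries.coeff e (almostSymSchur μ ν) =
        MvPowerSeries.coeff e (toSeries (keyPoly (padShape μ ν n))) := by
  induction ν with
  | nil =>
    intro μ hν n hn e he
    rw [almostSymSchur]
    congr 1
    simp only [List.length_nil, add_zero] at hn
    clear he
    induction n, hn using Nat.le_induction with
    | base =>
      congr 2
      funext i
      simp [padShape]
    | succ n hn ih =>
      rw [ih, ← toSeries_rename_castSucc, ← keyPoly_snoc_zero _ _ rfl]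
      congr 2
      funext k
      induction k using Fin.lastCases with
      | last => simp [padShape, Nat.not_lt.mpr hn]
      | cast k => simp [padShape]
  | cons a ν ih =>
    intro μ hν n hn e he
    have hν' := (List.pairwise_cons.mp hν).2
    -- By induction the restriction to `m` variables is a key polynomial, so the sequence that
    -- defines the limit is eventually made of key polynomials of padded shapes.
    have hseq : ∀ m, μ.length + (a :: ν).length ≤ m →
        toSeries (weylSymFin μ.length m (restrictVars m (almostSymSchur (μ ++ [a]) ν))) =
          toSeries (keyPoly (padShape μ (a :: ν) m)) := by
      intro m hm
      rw [List.length_cons] at hm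
      rw [restrictVars_eq (g := keyPoly (padShape (μ ++ [a]) ν m)),
        weylSymFin_keyPoly_padShape μ a hν (by omega)]
      intro d
      rw [← coeff_toSeries]
      refine ih _ hν' (by simp; omega) _ fun k hk => ?_
      by_contra hcon
      refine hk (Finsupp.mapDomain_of_notMem_range _ _ ?_)
      rintro ⟨i, rfl⟩
      exact hcon i.2
    -- A number of variables from which on the coefficient at `e` is constant; the limit is read off
    -- there, coefficient by coefficient.
    let bd : (ℕ →₀ ℕ) → ℕ := fun e => max (μ.length + (a :: ν).length) (e.support.sup id + 1)
    have hbd : ∀ (e : ℕ →₀ ℕ) k, e k ≠ 0 → k < bd e := fun e k hk =>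
      lt_max_of_lt_right (Nat.lt_succ_of_le
        (Finset.le_sup (f := id) (Finsupp.mem_support_iff.mpr hk)))
    let L : MvPowerSeries ℕ ℚ := fun e =>
      MvPowerSeries.coeff e (toSeries (keyPoly (padShape μ (a :: ν) (bd e))))
    have hlim : Tendsto (fun m => toSeries (weylSymFin μ.length m
        (restrictVars m (almostSymSchur (μ ++ [a]) ν)))) atTop (𝓝 L) := by
      rw [MvPowerSeries.WithPiTopology.tendsto_iff_coeff_tendsto]
      intro e
      apply tendsto_const_nhds.congr'
      filter_upwards [eventually_ge_atTop (bd e)] with m hm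
      rw [hseq m ((le_max_left _ _).trans hm),
        coeff_toSeries_padShape_of_le μ hν (le_max_left _ _) e (hbd e) hm]
      rfl
    rw [almostSymSchur, weylSym, hlim.limUnder_eq]
    change MvPowerSeries.coeff e (toSeries (keyPoly (padShape μ (a :: ν) (bd e)))) = _
    rcases le_total n (bd e) with h | h
    · exact coeff_toSeries_padShape_of_le μ hν hn e he h
    · exact (coeff_toSeries_padShape_of_le μ hν (le_max_left _ _) e (hbd e) h).symm

end Series

/-! ### Coinversions count co-inversion triples -/

section Coinversions

theorem mem_diagram {α : List ℕ} {u : ℕ × ℕ} :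
    u ∈ diagram α ↔ u.1 < α.length ∧ 1 ≤ u.2 ∧ u.2 ≤ α.getD u.1 0 := by
  obtain ⟨i, j⟩ := u
  simp only [diagram, mem_biUnion, mem_range, mem_product, mem_singleton, mem_Icc]
  constructor
  · rintro ⟨a, h1, rfl, h2, h3⟩
    exact ⟨h1, h2, h3⟩
  · rintro ⟨h1, h2, h3⟩
    exact ⟨i, h1, rfl, h2, h3⟩

theorem mem_augDiagram {α : List ℕ} {u : ℕ × ℕ} :
    u ∈ augDiagram α ↔ u.1 < α.length ∧ u.2 ≤ α.getD u.1 0 := by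
  obtain ⟨i, j⟩ := u
  simp only [augDiagram, mem_biUnion, mem_range, mem_product, mem_singleton, mem_Icc]
  constructor
  · rintro ⟨a, h1, rfl, -, h3⟩
    exact ⟨h1, h3⟩
  · rintro ⟨h1, h3⟩
    exact ⟨i, h1, rfl, Nat.zero_le _, h3⟩

/-- The set of boxes counted by the arm length. -/
def arm (α : List ℕ) (u : ℕ × ℕ) : Finset (ℕ × ℕ) := armLeft α u ∪ armRight α u

/-- The arm of `u` consists of the boxes `v` that can complete `u` and the box below it to a triple
of either type. -/
theorem mem_arm {α : List ℕ} {u v : ℕ × ℕ} (hu : u ∈ diagram α) :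
    v ∈ arm α u ↔ v ∈ augDiagram α ∧
      ((v.2 = u.2 ∧ v.1 < u.1 ∧ α.getD v.1 0 ≤ α.getD u.1 0) ∨
        (v.2 + 1 = u.2 ∧ u.1 < v.1 ∧ α.getD v.1 0 < α.getD u.1 0)) := by
  rw [mem_diagram] at hu
  simp only [arm, armLeft, armRight, mem_union, mem_filter, mem_diagram, mem_augDiagram]
  grind

variable {A : Type*} [LinearOrder A] {α : List ℕ} {τ : ℕ × ℕ → A}

/-- Each attacking pair in reading order has exactly one of three forms: `(u, v)` with `v` in the
arm of `u`, `(v, below u)` with `v` in the arm of `u`, or two bottom boxes of which the left one is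
in a weakly shorter column. The increasing bottom row makes every pair of the third form an
inversion, which is the correction term in `inv`. -/
theorem card_inversions (hbase : ∀ i j, i < j → j < α.length → τ (i, 0) < τ (j, 0)) :
    (inversions α τ).card =
      ∑ u ∈ diagram α, {v ∈ arm α u | τ v < τ u}.card +
      ∑ u ∈ diagram α, {v ∈ arm α u | τ (below u) < τ v}.card +
      {p ∈ range α.length ×ˢ range α.length |
        p.1 < p.2 ∧ α.getD p.1 0 ≤ α.getD p.2 0}.card := by
  classical
  let S := augDiagram α ×ˢ augDiagram α
  let up : ℕ × ℕ → ℕ × ℕ := fun q => (q.1, q.2 + 1)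
  have hS : ∀ p : (ℕ × ℕ) × (ℕ × ℕ), p ∈ S ↔ p.1 ∈ augDiagram α ∧ p.2 ∈ augDiagram α :=
    fun p => mem_product
  have hup : ∀ u ∈ diagram α, up (below u) = u := fun u hu => by
    rw [mem_diagram] at hu
    exact Prod.ext rfl (Nat.sub_add_cancel hu.2.1)
  have hdi : ∀ u ∈ diagram α, u ∈ augDiagram α := fun u hu => by
    rw [mem_diagram] at hu
    exact mem_augDiagram.mpr ⟨hu.1, hu.2.2⟩
  have hbe : ∀ u ∈ diagram α, below u ∈ augDiagram α := fun u hu => by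
    rw [mem_diagram] at hu
    exact mem_augDiagram.mpr ⟨hu.1, (Nat.sub_le _ _).trans hu.2.2⟩
  let I1 := {p ∈ S | p.1 ∈ diagram α ∧ p.2 ∈ arm α p.1 ∧ τ p.2 < τ p.1}
  let I2 := {p ∈ S | up p.2 ∈ diagram α ∧ p.1 ∈ arm α (up p.2) ∧ τ p.2 < τ p.1}
  let I3 := {p ∈ S | p.1.2 = 0 ∧ p.2.2 = 0 ∧ p.2.1 < p.1.1 ∧
    α.getD p.2.1 0 ≤ α.getD p.1.1 0}
  have h1 : I1.card = ∑ u ∈ diagram α, {v ∈ arm α u | τ v < τ u}.card := by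
    rw [← Finset.card_sigma]
    refine Finset.card_bij' (fun p _ => ⟨p.1, p.2⟩) (fun s _ => (s.1, s.2)) ?_ ?_
      (fun _ _ => rfl) (fun _ _ => rfl)
    · intro p hp
      simp only [I1, mem_filter] at hp
      simpa using hp.2
    · intro s hs
      simp only [mem_sigma, mem_filter] at hs
      simp only [I1, mem_filter, hS]
      exact ⟨⟨hdi _ hs.1, ((mem_arm hs.1).mp hs.2.1).1⟩, hs⟩
  have h2 : I2.card = ∑ u ∈ diagram α, {v ∈ arm α u | τ (below u) < τ v}.card := by
    rw [← Finset.card_sigma]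
    refine Finset.card_bij' (fun p _ => ⟨up p.2, p.1⟩) (fun s _ => (s.2, below s.1)) ?_ ?_
      (fun _ _ => rfl) ?_
    · intro p hp
      simp only [I2, mem_filter] at hp
      simp only [mem_sigma, mem_filter]
      exact hp.2
    · intro s hs
      simp only [mem_sigma, mem_filter] at hs
      simp only [I2, mem_filter, hS]
      rw [hup _ hs.1]
      exact ⟨⟨((mem_arm hs.1).mp hs.2.1).1, hbe _ hs.1⟩, hs⟩
    · rintro ⟨u, v⟩ hs
      simp only [mem_sigma, mem_filter] at hs
      simp only [hup _ hs.1]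
  have h3 : I3.card = {p ∈ range α.length ×ˢ range α.length |
      p.1 < p.2 ∧ α.getD p.1 0 ≤ α.getD p.2 0}.card := by
    refine Finset.card_bij' (fun p _ => (p.2.1, p.1.1)) (fun s _ => ((s.2, 0), (s.1, 0))) ?_ ?_
      ?_ (fun _ _ => rfl)
    · intro p hp
      simp only [I3, mem_filter, hS, mem_augDiagram] at hp
      simp only [mem_filter, mem_product, mem_range]
      exact ⟨⟨hp.1.2.1, hp.1.1.1⟩, hp.2.2.2⟩
    · intro s hs
      simp only [mem_filter, mem_product, mem_range] at hs
      simp only [I3, mem_filter, hS, mem_augDiagram]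
      exact ⟨⟨⟨hs.1.2, Nat.zero_le _⟩, hs.1.1, Nat.zero_le _⟩, trivial, trivial, hs.2⟩
    · rintro ⟨⟨a, b⟩, c, d⟩ hp
      simp only [I3, mem_filter] at hp
      obtain ⟨-, rfl, rfl, -⟩ := hp
      rfl
  have hd12 : Disjoint I1 I2 := by
    rw [Finset.disjoint_left]
    rintro ⟨⟨a, b⟩, c, d⟩ hp hq
    simp only [I1, I2, mem_filter] at hp hq
    have e1 := ((mem_arm hp.2.1).mp hp.2.2.1).2
    have e2 := ((mem_arm hq.2.1).mp hq.2.2.1).2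
    simp only [up] at e1 e2
    grind
  have hd3 : Disjoint (I1 ∪ I2) I3 := by
    rw [Finset.disjoint_left]
    rintro ⟨⟨a, b⟩, c, d⟩ hp hq
    simp only [I3, mem_filter] at hq
    obtain ⟨-, rfl, rfl, e3⟩ := hq
    rcases mem_union.mp hp with hp | hp
    · simp only [I1, mem_filter, mem_diagram] at hp
      omega
    · simp only [I2, mem_filter] at hp
      have e2 := ((mem_arm hp.2.1).mp hp.2.2.1).2
      simp only [up] at e2
      omega
  rw [← h1, ← h2, ← h3, ← Finset.card_union_of_disjoint hd12, ← Finset.card_union_of_disjoint hd3]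
  congr 1
  ext ⟨⟨a, b⟩, c, d⟩
  have key : ((a, b) ∈ augDiagram α ∧ (c, d) ∈ augDiagram α) →
      (Attacks (a, b) (c, d) ∧ ReadsBefore (a, b) (c, d) ↔
        ((a, b) ∈ diagram α ∧ (c, d) ∈ arm α (a, b)) ∨
        (up (c, d) ∈ diagram α ∧ (a, b) ∈ arm α (up (c, d))) ∨
        (b = 0 ∧ d = 0 ∧ c < a ∧ α.getD c 0 ≤ α.getD a 0)) := by
    rintro ⟨m1, m2⟩
    have r1 : ((a, b) ∈ diagram α ∧ (c, d) ∈ arm α (a, b)) ↔ ((a, b) ∈ diagram α ∧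
      ((d = b ∧ c < a ∧ α.getD c 0 ≤ α.getD a 0) ∨
        (d + 1 = b ∧ a < c ∧ α.getD c 0 < α.getD a 0))) := by
      refine and_congr_right fun h => ?_
      rw [mem_arm h]
      exact and_iff_right m2
    have r2 : (up (c, d) ∈ diagram α ∧ (a, b) ∈ arm α (up (c, d))) ↔ (up (c, d) ∈ diagram α ∧
      ((b = d + 1 ∧ a < c ∧ α.getD a 0 ≤ α.getD c 0) ∨
        (b + 1 = d + 1 ∧ c < a ∧ α.getD a 0 < α.getD c 0))) := by
      refine and_congr_right fun h => ?_
      rw [mem_arm h]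
      exact and_iff_right m1
    rw [r1, r2]
    simp only [up, mem_diagram, mem_augDiagram, Attacks, ReadsBefore, ne_eq, Prod.mk.injEq]
      at m1 m2 ⊢
    generalize α.getD a 0 = x at *
    generalize α.getD c 0 = y at *
    omega
  simp only [inversions, I1, I2, I3, mem_filter, mem_union, hS, mem_product]
  constructor
  · rintro ⟨m, h1, h2, h3⟩
    rcases (key m).mp ⟨h1, h2⟩ with h | h | h
    · exact Or.inl (Or.inl ⟨m, h.1, h.2, h3⟩)
    · exact Or.inl (Or.inr ⟨m, h.1, h.2, h3⟩)
    · exact Or.inr ⟨m, h⟩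
  · rintro ((⟨m, h1, h2, h3⟩ | ⟨m, h1, h2, h3⟩) | ⟨m, h⟩)
    · have := (key m).mpr (Or.inl ⟨h1, h2⟩)
      exact ⟨m, this.1, this.2, h3⟩
    · have := (key m).mpr (Or.inr (Or.inl ⟨h1, h2⟩))
      exact ⟨m, this.1, this.2, h3⟩
    · have := (key m).mpr (Or.inr (Or.inr h))
      refine ⟨m, this.1, this.2, ?_⟩
      obtain ⟨rfl, rfl, h, -⟩ := h
      exact hbase c a h (mem_augDiagram.mp m.1).1

/-- Without descents the label of `u` is at most that of the box `w` below it, so a box `v` of the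
arm of `u` gives at most one inversion, and gives none exactly when its label lies strictly between
those of `u` and `w`. The other two cyclic orders of a triple would make `u` a descent. Hence
`coinv` is the number of triples. -/
theorem coinv_eq_zero_iff (hbase : ∀ i j, i < j → j < α.length → τ (i, 0) < τ (j, 0))
    (hna : NonAttacking α τ) (hdes : descents α τ = ∅) :
    coinv α τ = 0 ↔ ∀ u v w : ℕ × ℕ, ¬ IsCoinvTriple α τ u v w := by
  have hle : ∀ u ∈ diagram α, τ u ≤ τ (below u) := by
    intro u hu
    by_contra hcon
    have : u ∈ descents α τ := mem_filter.mpr ⟨hu, not_le.mp hcon⟩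
    simp [hdes] at this
  have hbe : ∀ u ∈ diagram α, below u ∈ augDiagram α := fun u hu => by
    rw [mem_diagram] at hu
    exact mem_augDiagram.mpr ⟨hu.1, (Nat.sub_le _ _).trans hu.2.2⟩
  have hdi : ∀ u ∈ diagram α, u ∈ augDiagram α := fun u hu => by
    rw [mem_diagram] at hu
    exact mem_augDiagram.mpr ⟨hu.1, hu.2.2⟩
  have hne : ∀ u ∈ diagram α, ∀ v ∈ arm α u, τ v ≠ τ u ∧ τ v ≠ τ (below u) := by
    intro u hu v hv
    obtain ⟨h1, h2⟩ := (mem_arm hu).mp hv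
    have hu' := mem_diagram.mp hu
    refine ⟨hna v h1 u (hdi u hu) ?_, hna v h1 (below u) (hbe u hu) ?_⟩
    · rcases h2 with h2 | h2
      · exact Or.inl ⟨fun e => by simp [e] at h2, h2.1⟩
      · exact Or.inr (Or.inr ⟨h2.1.symm, h2.2.1⟩)
    · rcases h2 with h2 | h2
      · refine Or.inr (Or.inl ⟨?_, h2.2.1⟩)
        simp only [below]
        omega
      · refine Or.inl ⟨fun e => ?_, ?_⟩
        · have := h2.2.1
          simp [e, below] at this
        · simp only [below]
          omega
  have hterm : ∀ u ∈ diagram α, ∀ v ∈ arm α u,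
      (τ u < τ v ∧ τ v < τ (below u)) ↔ ¬ (τ v < τ u) ∧ ¬ (τ (below u) < τ v) := by
    intro u hu v hv
    obtain ⟨h1, h2⟩ := hne u hu v hv
    constructor
    · rintro ⟨h3, h4⟩
      exact ⟨h3.not_gt, h4.not_gt⟩
    · rintro ⟨h3, h4⟩
      exact ⟨(not_lt.mp h3).lt_of_ne h1.symm, (not_lt.mp h4).lt_of_ne h2⟩
  have hcoinv : coinv α τ =
      ((∑ u ∈ diagram α, {v ∈ arm α u | τ u < τ v ∧ τ v < τ (below u)}.card : ℕ) : ℤ) := by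
    have hsplit : ∀ u ∈ diagram α, armLength α u =
        {v ∈ arm α u | τ v < τ u}.card + {v ∈ arm α u | τ (below u) < τ v}.card +
        {v ∈ arm α u | τ u < τ v ∧ τ v < τ (below u)}.card := by
      intro u hu
      rw [Finset.filter_congr (hterm u hu), ← Finset.card_union_of_disjoint, ← Finset.filter_or]
      · have := Finset.card_filter_add_card_filter_not (s := arm α u)
          (fun v => τ v < τ u ∨ τ (below u) < τ v)
        simp only [not_or] at this
        exact this.symm
      · rw [Finset.disjoint_filter]
        intro v hv h1 h2
        exact absurd (h2.trans h1) (not_lt.mpr (hle u hu))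
    have hsum := Finset.sum_congr rfl hsplit
    rw [Finset.sum_add_distrib, Finset.sum_add_distrib] at hsum
    have hcard := card_inversions hbase
    rw [coinv, inv, hdes, Finset.sum_empty, ← Nat.cast_sum, hsum, hcard]
    push_cast
    ring
  rw [hcoinv, Nat.cast_eq_zero, Finset.sum_eq_zero_iff]
  constructor
  · rintro h u v w ⟨h1, h2, rfl, h3, h4⟩
    have hu := mem_diagram.mp h1
    have hv : v ∈ arm α u := by
      rw [mem_arm h1]
      refine ⟨h2, ?_⟩
      simp only [below] at h3
      omega
    have h5 := Finset.card_eq_zero.mp (h u h1)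
    have h6 := Finset.filter_eq_empty_iff.mp h5 hv
    rcases h4 with h4 | h4 | h4
    · exact h6 h4
    · exact absurd h4.2 (not_lt.mpr (hle u h1))
    · exact absurd h4.1 (not_lt.mpr (hle u h1))
  · intro h u hu
    rw [Finset.card_eq_zero, Finset.filter_eq_empty_iff]
    intro v hv h4
    obtain ⟨h1, h2⟩ := (mem_arm hu).mp hv
    refine h u v _ ⟨hu, h1, rfl, ?_, Or.inl h4⟩
    have := mem_diagram.mp hu
    simp only [below]
    omega

theorem starLabelling_base_lt (μ ν : List ℕ) (σ : diagram (μ ++ ν.reverse) → ℕ) {i j : ℕ}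
    (hij : i < j) : starLabelling μ ν σ (i, 0) < starLabelling μ ν σ (j, 0) := by
  have h0 : ∀ k, (k, 0) ∉ diagram (μ ++ ν.reverse) := fun k h => by
    have := mem_diagram.mp h
    omega
  rw [starLabelling, starLabelling, dif_neg (h0 i), dif_neg (h0 j)]
  simp only
  split_ifs with h1 h2 h2
  · exact_mod_cast hij
  · exact (Ordinal.natCast_lt_omega0 _).trans_le le_self_add
  · omega
  · have : i - μ.length < j - μ.length := by omega
    exact (add_lt_add_iff_left _).mpr (by exact_mod_cast this)

theorem mem_labellings_iff (μ ν : List ℕ) (σ : diagram (μ ++ ν.reverse) → ℕ) :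
    σ ∈ labellings μ ν ↔
      NonAttacking (μ ++ ν.reverse) (starLabelling μ ν σ) ∧
      descents (μ ++ ν.reverse) (starLabelling μ ν σ) = ∅ ∧
      ∀ u v w : ℕ × ℕ, ¬ IsCoinvTriple (μ ++ ν.reverse) (starLabelling μ ν σ) u v w := by
  rw [labellings, Set.mem_ofPred_eq]
  constructor
  · rintro ⟨h1, h2, h3⟩
    exact ⟨h1, h3, (coinv_eq_zero_iff (fun i j h _ => starLabelling_base_lt μ ν σ h) h1 h3).mp h2⟩
  · rintro ⟨h1, h3, h2⟩
    exact ⟨h1, (coinv_eq_zero_iff (fun i j h _ => starLabelling_base_lt μ ν σ h) h1 h3).mpr h2, h3⟩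

end Coinversions

/-! ### From labellings to sequences of admissible rows -/

section Rows

/-- The row `k` of a labelling, with label `0` at the columns that do not reach row `k`. -/
def rowOf (α : List ℕ) (τ : ℕ × ℕ → ℕ) (k : ℕ) (i : Fin α.length) : ℕ :=
  if k ≤ α.getD i 0 then τ (i, k) else 0

theorem rowOf_of_le {α : List ℕ} {τ : ℕ × ℕ → ℕ} {k : ℕ} {i : Fin α.length}
    (h : k ≤ α.getD i 0) : rowOf α τ k i = τ (i, k) := if_pos h

theorem rowOf_of_lt {α : List ℕ} {τ : ℕ × ℕ → ℕ} {k : ℕ} {i : Fin α.length}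
    (h : α.getD i 0 < k) : rowOf α τ k i = 0 := if_neg (not_le.mpr h)

/-- A violation of `PairOK` is a co-inversion triple, except in the case of equality, where the two
boxes attack each other. -/
theorem rowOK_rowOf {α : List ℕ} {τ : ℕ × ℕ → ℕ} (hpos : ∀ u ∈ augDiagram α, 1 ≤ τ u)
    (hna : NonAttacking α τ) (hdes : descents α τ = ∅)
    (htri : ∀ u v w : ℕ × ℕ, ¬ IsCoinvTriple α τ u v w) (k : ℕ) :
    RowOK (fun i : Fin α.length => α.getD i 0 + 1 - k) (rowOf α τ k) (rowOf α τ (k + 1)) := by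
  have haug : ∀ (i : Fin α.length) k, k ≤ α.getD i 0 → ((i : ℕ), k) ∈ augDiagram α :=
    fun i k h => mem_augDiagram.mpr ⟨i.2, h⟩
  have hdia : ∀ (i : Fin α.length) k, k + 1 ≤ α.getD i 0 → ((i : ℕ), k + 1) ∈ diagram α :=
    fun i k h => mem_diagram.mpr ⟨i.2, Nat.le_add_left 1 k, h⟩
  have hne : ∀ {i j : Fin α.length}, i ≠ j → (i : ℕ) ≠ j := fun h e => h (Fin.ext e)
  refine ⟨fun i => ?_, fun i => ?_, fun i j h => ?_, fun i j hij => ⟨fun h1 h2 => ?_,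
    fun h1 h2 => ?_⟩⟩
  · rcases le_or_gt (k + 1) (α.getD i 0) with h | h
    · rw [rowOf_of_le h, rowOf_of_le (by omega)]
      by_contra hcon
      have : ((i : ℕ), k + 1) ∈ descents α τ := mem_filter.mpr ⟨hdia i k h, not_le.mp hcon⟩
      simp [hdes] at this
    · rw [rowOf_of_lt h]
      exact Nat.zero_le _
  · rcases le_or_gt (k + 1) (α.getD i 0) with h | h
    · have := hpos _ (haug i _ h)
      rw [rowOf_of_le h]
      omega
    · rw [rowOf_of_lt h]
      omega
  · by_contra hcon
    push Not at hcon
    rcases le_or_gt (k + 1) (α.getD i 0) with h1 | h1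
    · rcases le_or_gt (k + 1) (α.getD j 0) with h2 | h2
      · rw [rowOf_of_le h1, rowOf_of_le h2] at h
        refine hna _ (haug i _ h1) _ (haug j _ h2) (Or.inl ⟨fun e => ?_, rfl⟩) h
        exact hne hcon.2 (congrArg Prod.fst e)
      · rw [h, rowOf_of_lt h2] at hcon
        exact hcon.1 rfl
    · rw [rowOf_of_lt h1] at hcon
      exact hcon.1 rfl
  · rintro ⟨h3, h4⟩
    have hj : k ≤ α.getD j 0 := by
      by_contra hcon
      rw [rowOf_of_lt (not_le.mp hcon)] at h2
      omega
    have hi : k + 1 ≤ α.getD i 0 := by omega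
    rw [rowOf_of_le hj] at h2 h3 h4
    rw [rowOf_of_le hi] at h3
    rw [rowOf_of_le (by omega)] at h4
    have hn := hna _ (haug i _ hi) _ (haug j _ hj) (Or.inr (Or.inl ⟨rfl, Fin.lt_def.mp hij⟩))
    exact htri (i, k + 1) (j, k) (i, k) ⟨hdia i k hi, haug j _ hj, rfl,
      Or.inl ⟨rfl, Fin.lt_def.mp hij, by simp only; omega⟩, Or.inl ⟨h3.lt_of_ne hn, h4⟩⟩
  · rintro ⟨h3, h4⟩
    have hi : k + 1 ≤ α.getD i 0 := by
      by_contra hcon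
      rw [rowOf_of_lt (not_le.mp hcon)] at h2
      omega
    have hj : k + 1 ≤ α.getD j 0 := by omega
    rw [rowOf_of_le hi] at h2 h3 h4
    rw [rowOf_of_le hj] at h3
    rw [rowOf_of_le (by omega)] at h4
    have hn := hna _ (haug i _ hi) _ (haug j k (by omega))
      (Or.inr (Or.inl ⟨rfl, Fin.lt_def.mp hij⟩))
    exact htri (j, k + 1) (i, k + 1) (j, k) ⟨hdia j k hj, haug i _ hi, rfl,
      Or.inr ⟨rfl, Fin.lt_def.mp hij, by simp only; omega⟩, Or.inl ⟨h3, h4.lt_of_ne hn⟩⟩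

/-- The row conditions compare only consecutive rows, and so do attacks, descents and triples.
Distinctness in the bottom row is not part of `RowOK` and comes from `hbase`. -/
theorem of_rowOK_rowOf {α : List ℕ} {τ : ℕ × ℕ → ℕ} (hpos : ∀ u ∈ augDiagram α, 1 ≤ τ u)
    (hbase : ∀ i j, i < j → j < α.length → τ (i, 0) < τ (j, 0)) {r : ℕ}
    (hr : ∀ i, α.getD i 0 ≤ r)
    (hrow : ∀ k < r, RowOK (fun i : Fin α.length => α.getD i 0 + 1 - k) (rowOf α τ k)
      (rowOf α τ (k + 1))) :
    NonAttacking α τ ∧ descents α τ = ∅ ∧ ∀ u v w : ℕ × ℕ, ¬ IsCoinvTriple α τ u v w := by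
  have hinj : ∀ k i j, i < α.length → j < α.length → k ≤ α.getD i 0 → k ≤ α.getD j 0 →
      τ (i, k) = τ (j, k) → i = j := by
    intro k i j hi hj h1 h2 h
    rcases k with _ | k
    · rcases lt_trichotomy i j with hij | hij | hij
      · exact absurd h (hbase i j hij hj).ne
      · exact hij
      · exact absurd h (hbase j i hij hi).ne'
    · have := (hrow k (by have := hr i; omega)).inj ⟨i, hi⟩ ⟨j, hj⟩
      rw [rowOf_of_le h1, rowOf_of_le h2] at this
      rcases this h with h' | h'
      · have := hpos (i, k + 1) (mem_augDiagram.mpr ⟨hi, h1⟩)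
        simp only at h'
        omega
      · exact congrArg Fin.val h'
  have hle : ∀ k i, i < α.length → k + 1 ≤ α.getD i 0 → τ (i, k + 1) ≤ τ (i, k) := by
    intro k i hi h
    have := (hrow k (by have := hr i; omega)).le ⟨i, hi⟩
    rwa [rowOf_of_le h, rowOf_of_le (by simp only; omega)] at this
  have hp1 : ∀ k i j, i < j → j < α.length → k ≤ α.getD j 0 → α.getD j 0 < α.getD i 0 →
      ¬ (τ (i, k + 1) ≤ τ (j, k) ∧ τ (j, k) < τ (i, k)) := by
    intro k i j hij hj h1 h2
    have h3 := ((hrow k (by have := hr i; omega)).pair ⟨i, hij.trans hj⟩ ⟨j, hj⟩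
      (Fin.lt_def.mpr hij)).1 (by simp only; omega)
    rw [rowOf_of_le (by simpa using h1), rowOf_of_le (by simp only; omega),
      rowOf_of_le (by simp only; omega)] at h3
    exact h3 (hpos _ (mem_augDiagram.mpr ⟨hj, h1⟩))
  have hp2 : ∀ k i j, i < j → j < α.length → k + 1 ≤ α.getD i 0 → α.getD i 0 ≤ α.getD j 0 →
      ¬ (τ (j, k + 1) < τ (i, k + 1) ∧ τ (i, k + 1) ≤ τ (j, k)) := by
    intro k i j hij hj h1 h2
    have h3 := ((hrow k (by have := hr i; omega)).pair ⟨i, hij.trans hj⟩ ⟨j, hj⟩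
      (Fin.lt_def.mpr hij)).2 (by simp only; omega)
    rw [rowOf_of_le (by simpa using h1), rowOf_of_le (by simp only; omega),
      rowOf_of_le (by simp only; omega)] at h3
    exact h3 (hpos _ (mem_augDiagram.mpr ⟨hij.trans hj, h1⟩))
  -- If an upper box had the label of a lower box to its right, `PairOK` and the absence of descents
  -- would force two equal labels in one row: the lower row if the right column is strictly shorter,
  -- the upper row otherwise.
  have hcross : ∀ k i j, i < j → j < α.length → k + 1 ≤ α.getD i 0 → k ≤ α.getD j 0 →
      τ (i, k + 1) ≠ τ (j, k) := by
    intro k i j hij hj h1 h2 h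
    have hi := hij.trans hj
    have h3 := hle k i hi h1
    rcases lt_or_ge (α.getD j 0) (α.getD i 0) with h4 | h4
    · have h5 := hp1 k i j hij hj h2 h4
      have := hinj k i j hi hj (by omega) h2 (by omega)
      omega
    · have h5 := hp2 k i j hij hj h1 h4
      have h6 := hle k j hj (by omega)
      have := hinj (k + 1) i j hi hj h1 (by omega) (by omega)
      omega
  have hna : NonAttacking α τ := by
    rintro ⟨i, k⟩ hu ⟨j, l⟩ hv h he
    rw [mem_augDiagram] at hu hv
    simp only [Attacks] at h hu hv
    rcases h with ⟨h1, rfl⟩ | ⟨rfl, h2⟩ | ⟨rfl, h2⟩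
    · exact h1 (Prod.ext (hinj k i j hu.1 hv.1 hu.2 hv.2 he) rfl)
    · exact hcross l i j h2 hv.1 hu.2 hv.2 he
    · exact hcross k j i h2 hu.1 hv.2 hu.2 he.symm
  have hle' : ∀ u ∈ diagram α, τ u ≤ τ (below u) := by
    rintro ⟨i, k⟩ hu
    rw [mem_diagram] at hu
    simp only at hu
    obtain ⟨k, rfl⟩ := Nat.exists_eq_add_of_le' hu.2.1
    exact hle k i hu.1 hu.2.2
  refine ⟨hna, ?_, ?_⟩
  · rw [descents, Finset.filter_eq_empty_iff]
    exact fun u hu => not_lt.mpr (hle' u hu)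
  · rintro ⟨i, k⟩ ⟨j, l⟩ w ⟨hu, hv, rfl, h1, h2⟩
    have h3 := hle' _ hu
    rw [mem_diagram] at hu
    rw [mem_augDiagram] at hv
    simp only at hu hv
    obtain ⟨k, rfl⟩ := Nat.exists_eq_add_of_le' hu.2.1
    simp only [below, Nat.add_sub_cancel] at h1 h2 h3
    rcases h1 with ⟨rfl, h4, h5⟩ | ⟨rfl, h4, h5⟩
    · have := hp1 l i j h4 hv.1 hv.2 h5
      omega
    · have := hp2 k j i h4 hu.1 hv.2 h5
      omega

/-- The defining conditions of the labellings only depend on the order of the labels. -/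
theorem conditions_congr {A B : Type*} [LinearOrder A] [LinearOrder B] {α : List ℕ}
    {τ : ℕ × ℕ → A} {τ' : ℕ × ℕ → B}
    (h : ∀ u ∈ augDiagram α, ∀ v ∈ augDiagram α, (τ u < τ v ↔ τ' u < τ' v)) :
    (NonAttacking α τ ∧ descents α τ = ∅ ∧ ∀ u v w : ℕ × ℕ, ¬ IsCoinvTriple α τ u v w) ↔
      NonAttacking α τ' ∧ descents α τ' = ∅ ∧ ∀ u v w : ℕ × ℕ, ¬ IsCoinvTriple α τ' u v w := by
  have hdi : ∀ u ∈ diagram α, u ∈ augDiagram α ∧ below u ∈ augDiagram α := fun u hu => by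
    rw [mem_diagram] at hu
    exact ⟨mem_augDiagram.mpr ⟨hu.1, hu.2.2⟩,
      mem_augDiagram.mpr ⟨hu.1, (Nat.sub_le _ _).trans hu.2.2⟩⟩
  have h1 : NonAttacking α τ ↔ NonAttacking α τ' := by
    refine forall₂_congr fun u hu => forall₂_congr fun v hv => imp_congr_right fun _ => ?_
    rw [ne_iff_lt_or_gt, ne_iff_lt_or_gt, h u hu v hv, h v hv u hu]
  have h2 : descents α τ = descents α τ' :=
    Finset.filter_congr fun u hu => h _ (hdi u hu).2 _ (hdi u hu).1
  have h3 : ∀ u v w, IsCoinvTriple α τ u v w ↔ IsCoinvTriple α τ' u v w := by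
    intro u v w
    refine and_congr_right fun hu => and_congr_right fun hv => and_congr_right fun hw =>
      and_congr_right fun _ => ?_
    subst hw
    rw [h _ (hdi u hu).1 _ hv, h _ hv _ (hdi u hu).2, h _ (hdi u hu).2 _ (hdi u hu).1]
  rw [h1, h2]
  simp only [h3]

end Rows

/-! ### The row recursion as a sum over labellings -/

section Unroll

variable {R : Type*} [CommRing R] {N : ℕ}

/-- The rows `b, t 0, t 1, …`. -/
def stackRows {r n : ℕ} (b : Fin N → ℕ) (t : Fin r → Fin N → Fin (n + 1)) : ℕ → Fin N → ℕ
  | 0 => b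
  | k + 1 => fun i => if h : k < r then (t ⟨k, h⟩ i : ℕ) else 0

theorem stackRows_cons {r n : ℕ} (b : Fin N → ℕ) (c : Fin N → Fin (n + 1))
    (t : Fin r → Fin N → Fin (n + 1)) (k : ℕ) :
    stackRows b (Fin.cons c t : Fin (r + 1) → Fin N → Fin (n + 1)) (k + 1) =
      stackRows (fun i => (c i : ℕ)) t k := by
  rcases k with _ | k
  · rfl
  · funext i
    simp only [stackRows, Nat.add_lt_add_iff_right]
    rfl

open Classical in
theorem rowGen_eq_sum (x : ℕ → R) (n r : ℕ) : ∀ h b : Fin N → ℕ,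
    rowGen x n r h b = ∑ t : Fin r → Fin N → Fin (n + 1) with
      ∀ k < r, RowOK (fun i => h i - k) (stackRows b t k) (stackRows b t (k + 1)),
        ∏ k, ∏ i, x (t k i) := by
  induction r with
  | zero => intro h b; simp [rowGen]
  | succ r ih =>
    intro h b
    rw [rowGen, Finset.sum_filter, ← (Fin.consEquiv fun _ => Fin N → Fin (n + 1)).sum_comp,
      Fintype.sum_prod_type]
    refine Finset.sum_congr rfl fun c _ => ?_
    have hsplit : ∀ t : Fin r → Fin N → Fin (n + 1),
        (∀ k < r + 1, RowOK (fun i => h i - k)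
          (stackRows b (Fin.cons c t : Fin (r + 1) → Fin N → Fin (n + 1)) k)
          (stackRows b (Fin.cons c t : Fin (r + 1) → Fin N → Fin (n + 1)) (k + 1))) ↔
        RowOK h b (fun i => (c i : ℕ)) ∧ ∀ k < r, RowOK (fun i => h i - 1 - k)
          (stackRows (fun i => (c i : ℕ)) t k) (stackRows (fun i => (c i : ℕ)) t (k + 1)) := by
      intro t
      constructor
      · intro H
        refine ⟨?_, fun k hk => ?_⟩
        · have := H 0 (by omega)
          rwa [stackRows_cons] at this
        · have := H (k + 1) (by omega)
          rw [stackRows_cons, stackRows_cons] at this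
          simpa only [Nat.sub_sub, Nat.add_comm 1 k] using this
      · rintro ⟨H0, H⟩ k hk
        rcases k with _ | k
        · rw [stackRows_cons]
          exact H0
        · rw [stackRows_cons, stackRows_cons]
          simpa only [Nat.sub_sub, Nat.add_comm 1 k] using H k (by omega)
    simp only [Fin.consEquiv, Equiv.coe_fn_mk, hsplit, Fin.prod_univ_succ, Fin.cons_zero,
      Fin.cons_succ]
    rw [rowTerm, ih]
    split_ifs with hc
    · simp only [hc, true_and]
      rw [Finset.sum_filter, Finset.mul_sum]
      refine Finset.sum_congr rfl fun t _ => ?_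
      rw [mul_ite, mul_zero]
    · simp [hc]

/-- The labelling of the augmented diagram with labels `σ(u) + 1` and the bottom row `b`. -/
def extendLabels {α : List ℕ} (b : ℕ → ℕ) (σ : diagram α → ℕ) (u : ℕ × ℕ) : ℕ :=
  if h : u ∈ diagram α then σ ⟨u, h⟩ + 1 else b u.1

theorem extendLabels_zero {α : List ℕ} (b : ℕ → ℕ) (σ : diagram α → ℕ) (i : ℕ) :
    extendLabels b σ (i, 0) = b i := by
  rw [extendLabels, dif_neg]
  intro h
  have := mem_diagram.mp h
  omega

open Classical in
/-- The generating function as a sum over the labellings of the diagram. -/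
theorem rowGen_eq_sum_labellings (α : List ℕ) (b : ℕ → ℕ) {n r : ℕ}
    (hr : ∀ i, α.getD i 0 ≤ r) :
    rowGen (lblVar n) n r (fun i : Fin α.length => α.getD i 0 + 1) (fun i => b i) =
      ∑ σ : diagram α → Fin n with
        ∀ k < r, RowOK (fun i : Fin α.length => α.getD i 0 + 1 - k)
          (rowOf α (extendLabels b fun u => (σ u : ℕ)) k)
          (rowOf α (extendLabels b fun u => (σ u : ℕ)) (k + 1)),
        ∏ u, MvPolynomial.X (σ u) := by
  -- The full rectangle of labels: labels are shifted by one so that 0 can mark the positions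
  -- outside the diagram.
  let tab : (diagram α → Fin n) → Fin r → Fin α.length → Fin (n + 1) := fun σ k i =>
    if h : ((i : ℕ), (k : ℕ) + 1) ∈ diagram α then (σ ⟨_, h⟩).succ else 0
  have hmem : ∀ (i : Fin α.length) k, ((i : ℕ), k + 1) ∈ diagram α ↔ k + 1 ≤ α.getD i 0 :=
    fun i k => by simp [mem_diagram]
  have htab : ∀ σ, stackRows (fun i : Fin α.length => b i) (tab σ) =
      rowOf α (extendLabels b fun u => (σ u : ℕ)) := by
    intro σ
    funext k i
    rcases k with _ | k
    · rw [rowOf_of_le (Nat.zero_le _), extendLabels_zero]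
      rfl
    · rcases le_or_gt (k + 1) (α.getD i 0) with h | h
      · have hk : k < r := by have := hr i; omega
        rw [rowOf_of_le h, extendLabels, dif_pos ((hmem i k).mpr h)]
        simp only [stackRows, dif_pos hk, tab, dif_pos ((hmem i k).mpr h), Fin.val_succ]
      · rw [rowOf_of_lt h]
        have : ((i : ℕ), k + 1) ∉ diagram α := fun h' => by
          have := (hmem i k).mp h'
          omega
        simp only [stackRows, tab]
        split_ifs
        rfl
        rfl
  symm
  rw [rowGen_eq_sum]
  refine Finset.sum_bij (fun σ _ => tab σ) ?_ ?_ ?_ ?_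
  · intro σ hσ
    rw [mem_filter] at hσ ⊢
    rw [htab]
    exact ⟨mem_univ _, hσ.2⟩
  · intro σ _ σ' _ h
    funext ⟨⟨i, k⟩, hu⟩
    have hu' := mem_diagram.mp hu
    simp only at hu'
    obtain ⟨k, rfl⟩ := Nat.exists_eq_add_of_le' hu'.2.1
    have := congrFun (congrFun h ⟨k, by have := hr i; omega⟩) ⟨i, hu'.1⟩
    simp only [tab, dif_pos hu] at this
    exact Fin.succ_injective _ this
  · intro t ht
    rw [mem_filter] at ht
    -- Admissible rows have the label 0 exactly outside the diagram, so such a table is determined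
    -- by its entries on the boxes.
    have hz : ∀ (k : Fin r) (i : Fin α.length), (t k i : ℕ) = 0 ↔ α.getD i 0 ≤ k := by
      intro k i
      have := (ht.2 k k.2).zero i
      simp only [stackRows, dif_pos k.2] at this
      rw [this]
      omega
    have hlt : ∀ u : diagram α, u.1.2 - 1 < r := fun u => by
      have := mem_diagram.mp u.2
      have := hr u.1.1
      omega
    have hpos : ∀ u : diagram α,
        (t ⟨u.1.2 - 1, hlt u⟩ ⟨u.1.1, (mem_diagram.mp u.2).1⟩ : ℕ) ≠ 0 := fun u => by
      have := mem_diagram.mp u.2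
      rw [Ne, hz]
      simp only
      omega
    let σ : diagram α → Fin n := fun u =>
      ⟨t ⟨u.1.2 - 1, hlt u⟩ ⟨u.1.1, (mem_diagram.mp u.2).1⟩ - 1, by
        have := hpos u
        have := (t ⟨u.1.2 - 1, hlt u⟩ ⟨u.1.1, (mem_diagram.mp u.2).1⟩).2
        omega⟩
    have htσ : tab σ = t := by
      funext k i
      apply Fin.ext
      simp only [tab]
      split_ifs with h
      · have := hpos ⟨_, h⟩
        simp only [Fin.val_succ, Nat.add_sub_cancel] at this ⊢
        exact Nat.succ_pred_eq_of_ne_zero this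
      · rw [hmem] at h
        exact ((hz k i).mpr (by omega)).symm
    refine ⟨σ, ?_, htσ⟩
    rw [mem_filter, ← htab, htσ]
    exact ⟨mem_univ _, ht.2⟩
  · intro σ _
    let F : ℕ × ℕ → MvPolynomial (Fin n) ℚ := fun u =>
      lblVar n (if h : u ∈ diagram α then ((σ ⟨u, h⟩).succ : ℕ) else 0)
    have e1 : ∏ u, MvPolynomial.X (σ u) = ∏ u ∈ diagram α, F u := by
      rw [← Finset.prod_coe_sort (diagram α) F]
      refine Finset.prod_congr rfl fun u _ => ?_
      simp only [F, dif_pos u.2, Fin.val_succ, lblVar_succ]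
    -- The product extends to the rectangle because the label 0 has the variable 1.
    have e2 : ∏ u ∈ diagram α, F u = ∏ u ∈ range α.length ×ˢ Ico 1 (r + 1), F u := by
      refine Finset.prod_subset (fun u hu => ?_) fun u _ hu => ?_
      · rw [mem_diagram] at hu
        have := hr u.1
        rw [mem_product, mem_range, mem_Ico]
        omega
      · simp only [F, dif_neg hu, lblVar_zero]
    have e3 : ∀ (k : Fin r) (i : Fin α.length),
        lblVar n (tab σ k i : ℕ) = F (i, k + 1) := by
      intro k i
      simp only [F, tab]
      split_ifs <;> rfl
    rw [e1, e2]
    simp only [e3]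
    rw [Finset.prod_product, Finset.prod_range, Finset.prod_comm (s := univ) (t := univ)]
    refine Finset.prod_congr rfl fun i _ => ?_
    have := Finset.prod_Ico_add' (fun k => F (i, k)) 0 r 1
    rw [zero_add] at this
    rw [← this, ← Finset.range_eq_Ico, Finset.prod_range]

end Unroll

/-! ### The expansion of almost symmetric Schur functions -/

section Expansion

/-- The labels of the bottom row for `n` variables: `ω + i` becomes a large finite label. -/
def finiteBase (μ ν : List ℕ) (n i : ℕ) : ℕ :=
  if i < μ.length then i + 1 else n - (μ.length + ν.length) + i + 1

theorem finiteBase_lt (μ ν : List ℕ) (n : ℕ) {i j : ℕ} (h : i < j) :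
    finiteBase μ ν n i < finiteBase μ ν n j := by
  unfold finiteBase
  split_ifs <;> omega

/-- The bound on σ keeps its shifted labels below those that `finiteBase` puts under the columns of
ν. So the replacement of ω, ω + 1, … by finite labels preserves the order of all labels, and with it
all the conditions. -/
theorem mem_labellings_iff_rowOK (μ ν : List ℕ) {n r : ℕ}
    (hr : ∀ i, (μ ++ ν.reverse).getD i 0 ≤ r)
    (σ : diagram (μ ++ ν.reverse) → ℕ) (hσ : ∀ u, σ u < n - (μ.length + ν.length)) :
    σ ∈ labellings μ ν ↔ ∀ k < r,
      RowOK (fun i : Fin (μ ++ ν.reverse).length => (μ ++ ν.reverse).getD i 0 + 1 - k)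
        (rowOf _ (extendLabels (finiteBase μ ν n) σ) k)
        (rowOf _ (extendLabels (finiteBase μ ν n) σ) (k + 1)) := by
  have hcmp : ∀ u ∈ augDiagram (μ ++ ν.reverse), ∀ v ∈ augDiagram (μ ++ ν.reverse),
      (starLabelling μ ν σ u < starLabelling μ ν σ v ↔
        extendLabels (finiteBase μ ν n) σ u < extendLabels (finiteBase μ ν n) σ v) := by
    intro u _ v _
    have hω : ∀ a b : ℕ, ¬ (Ordinal.omega0 + (a : Ordinal.{0}) < (b : Ordinal.{0})) := fun a b h =>
      absurd ((Ordinal.natCast_lt_omega0 b).trans_le le_self_add) h.not_gt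
    have hω' : ∀ a b : ℕ, (b : Ordinal.{0}) < Ordinal.omega0 + (a : Ordinal.{0}) := fun a b =>
      (Ordinal.natCast_lt_omega0 b).trans_le le_self_add
    simp only [starLabelling, extendLabels, finiteBase]
    split_ifs with h1 h2 h3 h2 h3 h4 h3 h3
    all_goals first
      | have s1 := hσ ⟨u, h1⟩
      | skip
    all_goals first
      | have s2 := hσ ⟨v, h2⟩
      | have s2 := hσ ⟨v, h3⟩
      | skip
    all_goals simp only [hω, hω', Nat.cast_lt, add_lt_add_iff_left, true_iff, false_iff]
    all_goals omega
  rw [mem_labellings_iff, conditions_congr hcmp]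
  have hpos : ∀ u ∈ augDiagram (μ ++ ν.reverse), 1 ≤ extendLabels (finiteBase μ ν n) σ u := by
    intro u _
    unfold extendLabels finiteBase
    split_ifs <;> omega
  constructor
  · rintro ⟨h1, h2, h3⟩ k _
    exact rowOK_rowOf hpos h1 h2 h3 k
  · intro h
    refine of_rowOK_rowOf hpos (fun i j hij _ => ?_) hr h
    rw [extendLabels_zero, extendLabels_zero]
    exact finiteBase_lt μ ν n hij

/-- Below each column `finiteBase` puts the position of its part in the padded shape. The padding
zeros contribute no columns, and their positions are simply missing from the bottom row. -/
theorem keyPoly_padShape_eq_rowGen (μ ν : List ℕ) {n r : ℕ} (hn : μ.length + ν.length ≤ n)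
    (hr : ∀ i, (μ ++ ν.reverse).getD i 0 ≤ r) :
    keyPoly (padShape μ ν n) =
      rowGen (lblVar n) n r
        (fun i : Fin (μ ++ ν.reverse).length => (μ ++ ν.reverse).getD i 0 + 1)
        fun i => finiteBase μ ν n i := by
  have hlen : (μ ++ ν.reverse).length = μ.length + ν.length := by simp
  have hα1 : ∀ i < μ.length, (μ ++ ν.reverse).getD i 0 = μ.getD i 0 := fun i hi =>
    List.getD_append _ _ _ _ hi
  have hα2 : ∀ i, μ.length ≤ i → i < μ.length + ν.length →
      (μ ++ ν.reverse).getD i 0 = ν.getD (μ.length + ν.length - 1 - i) 0 := by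
    intro i h1 h2
    rw [List.getD_append_right _ _ _ _ h1, List.getD_eq_getElem _ _ (by simp; omega),
      List.getD_eq_getElem _ _ (by omega), List.getElem_reverse]
    congr 1
    omega
  symm
  apply rowGen_eq_keyPoly r _ (fun i => Nat.le_add_left 1 _) (fun i => Nat.succ_le_succ (hr i)) _ _
    rfl
  · refine ⟨fun i => ?_, fun i j h => Or.inr ?_⟩
    · refine iff_of_false ?_ (Nat.succ_ne_zero _)
      simp only [finiteBase]
      split_ifs <;> exact not_false
    · rcases lt_trichotomy i j with hij | hij | hij
      · exact absurd h (finiteBase_lt μ ν n (Fin.lt_def.mp hij)).ne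
      · exact hij
      · exact absurd h (finiteBase_lt μ ν n (Fin.lt_def.mp hij)).ne'
  · intro i
    have := i.2
    simp only [finiteBase]
    split_ifs <;> omega
  · exact fun i j hij _ => finiteBase_lt μ ν n (Fin.lt_def.mp hij)
  · intro m
    have hm := m.2
    refine ⟨fun i hi => ?_, fun hi => ?_⟩
    · have := i.2
      simp only [finiteBase] at hi
      simp only [padShape]
      split_ifs at hi with h
      · obtain hi : (i : ℕ) = m := by omega
        rw [if_pos (by omega), hα1 _ h, hi]
      · rw [if_neg (by omega), hα2 _ (by omega) (by omega)]
        congr 2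
        omega
    · rw [padShape]
      split_ifs with h
      · exact absurd (by simp [finiteBase, h]) (hi ⟨m, by omega⟩)
      · rw [List.getD_eq_default]
        by_contra hcon
        refine hi ⟨m - (n - (μ.length + ν.length)), by omega⟩ ?_
        simp only [finiteBase]
        rw [if_neg (by omega)]
        omega

theorem coeff_labelMonomial_ne_zero {D : Finset (ℕ × ℕ)} {σ : D → ℕ} {e : ℕ →₀ ℕ}
    (h : MvPowerSeries.coeff e (labelMonomial σ) ≠ 0) (u : D) : e (σ u) ≠ 0 := fun h0 =>
  h (MvPowerSeries.X_dvd_iff.mp (Finset.dvd_prod_of_mem _ (mem_univ u)) e h0)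

theorem toSeries_prod_X {D : Finset (ℕ × ℕ)} {n : ℕ} (σ : D → Fin n) :
    toSeries (∏ u, MvPolynomial.X (σ u)) = labelMonomial fun u => (σ u : ℕ) := by
  rw [toSeries, map_prod, labelMonomial, ← MvPolynomial.coeToMvPowerSeries.ringHom_apply, map_prod]
  refine Finset.prod_congr rfl fun u _ => ?_
  rw [MvPolynomial.rename_X, MvPolynomial.coeToMvPowerSeries.ringHom_apply, MvPolynomial.coe_X]

/-- For a fixed exponent only labellings with labels in its support contribute, which are finitely
many. With enough variables they are the contributing fillings in the formula for the key
polynomial. -/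
theorem hasSum_labellings (μ ν : List ℕ) (hν : ν.Pairwise fun a b => b ≤ a) :
    HasSum (fun σ : labellings μ ν => labelMonomial σ.1) (almostSymSchur μ ν) := by
  classical
  rw [MvPowerSeries.WithPiTopology.hasSum_iff_hasSum_coeff]
  intro e
  set α := μ ++ ν.reverse with hα
  set M := e.support.sup id + 1
  -- The labels that matter are below `M`; the remaining variables leave room for the bottom labels
  -- that stand for ω, ω + 1, ….
  set n := M + (μ.length + ν.length)
  set r := (range α.length).sup fun i => α.getD i 0
  have hM : ∀ k, e k ≠ 0 → k < M := fun k hk => Nat.lt_succ_of_le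
    (Finset.le_sup (f := id) (Finsupp.mem_support_iff.mpr hk))
  have hnM : n - (μ.length + ν.length) = M := Nat.add_sub_cancel _ _
  have hr : ∀ i, α.getD i 0 ≤ r := by
    intro i
    rcases lt_or_ge i α.length with h | h
    · exact Finset.le_sup (f := fun i => α.getD i 0) (mem_range.mpr h)
    · rw [List.getD_eq_default _ _ h]
      exact Nat.zero_le _
  have hen : ∀ k, e k ≠ 0 → k < n := fun k hk => (hM k hk).trans_le (Nat.le_add_right _ _)
  obtain ⟨d, hd⟩ := exists_mapDomain_val e hen
  let good : (diagram α → ℕ) → Prop := fun σ => ∀ k < r,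
    RowOK (fun i : Fin α.length => α.getD i 0 + 1 - k)
      (rowOf _ (extendLabels (finiteBase μ ν n) σ) k)
      (rowOf _ (extendLabels (finiteBase μ ν n) σ) (k + 1))
  have hcoeff : MvPowerSeries.coeff e (almostSymSchur μ ν) =
      ∑ σ : diagram α → Fin n with good fun u => σ u,
        MvPowerSeries.coeff e (labelMonomial fun u => (σ u : ℕ)) := by
    rw [coeff_almostSymSchur ν μ hν (Nat.le_add_left _ M) e hen,
      keyPoly_padShape_eq_rowGen μ ν (Nat.le_add_left _ M) hr, ← hd, coeff_toSeries,
      rowGen_eq_sum_labellings _ _ hr, MvPolynomial.coeff_sum]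
    refine Finset.sum_congr (Finset.filter_congr fun σ _ => Iff.rfl) fun σ _ => ?_
    rw [← coeff_toSeries, toSeries_prod_X]
  -- The common index set of the two sums: on either side, a labelling outside it uses some label
  -- whose variable is absent from the exponent, so its coefficient vanishes.
  let S := {σ : diagram α → Fin n // good (fun u => σ u) ∧ ∀ u, (σ u : ℕ) < M}
  have hmem : ∀ σ : diagram α → ℕ, (∀ u, σ u < M) → (σ ∈ labellings μ ν ↔ good σ) :=
    fun σ h => mem_labellings_iff_rowOK μ ν hr σ fun u => hnM ▸ h u
  let g : S → labellings μ ν := fun σ => ⟨fun u => σ.1 u, (hmem _ σ.2.2).mpr σ.2.1⟩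
  have hg : Function.Injective g := by
    intro σ σ' h
    apply Subtype.ext
    funext u
    exact Fin.ext (congrFun (congrArg Subtype.val h) u)
  refine (hg.hasSum_iff fun σ hσ => ?_).mp ?_
  · by_contra hcon
    have hlt : ∀ u, σ.1 u < M := fun u => hM _ (coeff_labelMonomial_ne_zero hcon u)
    exact hσ ⟨⟨fun u => ⟨σ.1 u, (hlt u).trans_le (Nat.le_add_right _ _)⟩,
      (hmem _ hlt).mp σ.2, hlt⟩, rfl⟩
  · have hsum : MvPowerSeries.coeff e (almostSymSchur μ ν) =
        ∑ σ : S, MvPowerSeries.coeff e (labelMonomial (g σ).1) := by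
      rw [hcoeff]
      have h1 : ∑ σ : S, MvPowerSeries.coeff e (labelMonomial (g σ).1) =
          ∑ σ : diagram α → Fin n with good (fun u => σ u) ∧ ∀ u, (σ u : ℕ) < M,
            MvPowerSeries.coeff e (labelMonomial fun u => (σ u : ℕ)) :=
        (Finset.sum_subtype (p := fun σ : diagram α → Fin n =>
          good (fun u => σ u) ∧ ∀ u, (σ u : ℕ) < M) _ (by simp)
          fun σ => MvPowerSeries.coeff e (labelMonomial fun u => (σ u : ℕ))).symm
      rw [h1]
      symm
      refine Finset.sum_subset (fun σ hσ => ?_) fun σ h1 h2 => ?_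
      · rw [mem_filter] at hσ ⊢
        exact ⟨hσ.1, hσ.2.1⟩
      · by_contra hcon
        rw [mem_filter] at h1 h2
        exact h2 ⟨h1.1, h1.2, fun u => hM _ (coeff_labelMonomial_ne_zero hcon u)⟩
    rw [hsum]
    exact hasSum_fintype _

end Expansion
end AlmostSymSchur

theorem mainTheorem2 (μ ν : List ℕ) (hμ : AlmostSymSchur.IsReduced μ)
    (hν : AlmostSymSchur.IsPartition ν) :
    (∀ σ : AlmostSymSchur.diagram (μ ++ ν.reverse) → ℕ,
      σ ∈ AlmostSymSchur.labellings μ ν ↔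
        AlmostSymSchur.NonAttacking (μ ++ ν.reverse) (AlmostSymSchur.starLabelling μ ν σ) ∧
        AlmostSymSchur.descents (μ ++ ν.reverse) (AlmostSymSchur.starLabelling μ ν σ) = ∅ ∧
        ∀ u v w : ℕ × ℕ,
          ¬ AlmostSymSchur.IsCoinvTriple (μ ++ ν.reverse) (AlmostSymSchur.starLabelling μ ν σ) u v w) ∧
    HasSum (fun σ : AlmostSymSchur.labellings μ ν => AlmostSymSchur.labelMonomial σ.1)
      (AlmostSymSchur.almostSymSchur μ ν) := by
  exact ⟨AlmostSymSchur.mem_labellings_iff μ ν, AlmostSymSchur.hasSum_labellings μ ν hν.1⟩
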